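/- Let ZFG[0] be the first-order theory, in the language with equality, membership $\in$ and a binary relation $\leq_\gamma$, whose axioms are those of Zermelo–Fraenkel set theory without the power set axiom (extensionality, foundation, pairing, union, infinity, separation, replacement) together with axioms stating that $\leq_\gamma$ is a global well-ordering of the universe: it is a linear order, and every non-empty class has a $\leq_\gamma$-least element. The schemes range over all formulas of the language, including those in which $\leq_\gamma$ occurs, with parameters. Rings are commutative with unit. Inside this theory, a topological space is a set of points together with a set of open subsets; a ringed space is a topological space with a sheaf of rings; and a Noetherian scheme is a ringed space $(X,\mathcal{O}_X)$ that has a finite cover by open subsets $U$ such that $(U,\mathcal{O}_X|_U)$ is isomorphic to the spectrum of a Noetherian ring. A sheaf of ideals of $\mathcal{O}_X$ is a function $\mathscr{I}$ on the open subsets of $X$ such that $\mathscr{I}(U)$ is an ideal of $\mathcal{O}_X(U)$ for each open $U$, the restriction maps of $\mathcal{O}_X$ carry $\mathscr{I}(U)$ into $\mathscr{I}(V)$ for open $V\subseteq U$, and $\mathscr{I}$ with these restrictions is a sheaf. **Theorem.** ZFG[0] proves: for every Noetherian scheme $X$ there is a set $\mathcal{I}d(X)$ whose elements are exactly the sheaves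 of ideals of the structure sheaf $\mathcal{O}_X$. -/

import Mathlib

namespace ZFG

open FirstOrder

section Derivations

open FirstOrder.Language

universe u v

variable {L : FirstOrder.Language.{u, v}}

/-- `inst φ t` is the result of substituting the term `t` for the bound variable of `∀ x, φ x`. -/
def inst (φ : L.BoundedFormula ℕ 1) (t : L.Term ℕ) : L.Formula ℕ :=
  φ.toFormula.subst (Sum.elim Term.var fun _ => t)

/-- Classical natural deduction for first-order logic with equality, with hypotheses `Γ` and
free variables indexed by `ℕ`.  In `allI` every free variable of `Γ` and of `φ` is shifted up by
one, so that the variable `0` put in place of the bound variable occurs in no hypothesis. -/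
inductive Derives : Set (L.Formula ℕ) → L.Formula ℕ → Prop
  | hyp {Γ : Set (L.Formula ℕ)} {φ : L.Formula ℕ} : φ ∈ Γ → Derives Γ φ
  | impI {Γ : Set (L.Formula ℕ)} {φ ψ : L.Formula ℕ} :
      Derives (insert φ Γ) ψ → Derives Γ (φ.imp ψ)
  | impE {Γ : Set (L.Formula ℕ)} {φ ψ : L.Formula ℕ} :
      Derives Γ (φ.imp ψ) → Derives Γ φ → Derives Γ ψ
  | raa {Γ : Set (L.Formula ℕ)} {φ : L.Formula ℕ} :
      Derives (insert φ.not Γ) ⊥ → Derives Γ φ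
  | allI {Γ : Set (L.Formula ℕ)} {φ : L.BoundedFormula ℕ 1} :
      Derives (Formula.relabel Nat.succ '' Γ)
        (Formula.relabel (Sum.elim Nat.succ fun _ => 0) φ.toFormula) →
      Derives Γ φ.all
  | allE {Γ : Set (L.Formula ℕ)} {φ : L.BoundedFormula ℕ 1} (t : L.Term ℕ) :
      Derives Γ φ.all → Derives Γ (inst φ t)
  | eqRefl {Γ : Set (L.Formula ℕ)} (t : L.Term ℕ) : Derives Γ (t.equal t)
  | eqSubst {Γ : Set (L.Formula ℕ)} {φ : L.BoundedFormula ℕ 1} {s t : L.Term ℕ} :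
      Derives Γ (s.equal t) → Derives Γ (inst φ s) → Derives Γ (inst φ t)

/-- The sentence `φ` is provable in the first-order theory `T`. -/
def Provable (T : L.Theory) (φ : L.Sentence) : Prop :=
  Derives (Formula.relabel (Empty.elim : Empty → ℕ) '' T)
    (Formula.relabel (Empty.elim : Empty → ℕ) φ)

end Derivations

/-! ### The language with membership and a global well-ordering -/

/-- The relation symbols: membership, and the global order `≤γ`; both are binary. -/
inductive SetRel : ℕ → Type
  | mem : SetRel 2
  | le : SetRel 2

/-- The first-order language with equality, `∈` and `≤γ`, without function symbols. -/
def LSet : Language := ⟨fun _ => Empty, SetRel⟩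

/-- The relation symbol `∈` of `LSet`. -/
def memSym : LSet.Relations 2 := SetRel.mem
/-- The relation symbol `≤γ` of `LSet`. -/
def leSym : LSet.Relations 2 := SetRel.le

/-- Formulas of `LSet`, written so that a quantifier binds a Lean variable.  Variables are natural
numbers and `n` is the number of variables in scope, which are then `0, …, n - 1`; a quantifier
in scope `n` binds the variable `n`.  (An atom naming a variable out of scope is `⊥`.  This never
happens for variables introduced by a quantifier.) -/
def Fm : Type := (n : ℕ) → LSet.BoundedFormula Empty n

namespace Fm

/-- The atomic formula `R x y`. -/
def atom (R : LSet.Relations 2) (x y : ℕ) : Fm := fun n =>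
  if h : x < n ∧ y < n then
    R.boundedFormula₂ (.var (.inr ⟨x, h.1⟩)) (.var (.inr ⟨y, h.2⟩))
  else ⊥

/-- Membership `x ∈ y`. -/
def mem (x y : ℕ) : Fm := atom memSym x y

/-- The global well-ordering `x ≤γ y`. -/
def le (x y : ℕ) : Fm := atom leSym x y

/-- Equality `x = y`. -/
def eq (x y : ℕ) : Fm := fun n =>
  if h : x < n ∧ y < n then
    Language.Term.bdEqual (.var (.inr ⟨x, h.1⟩)) (.var (.inr ⟨y, h.2⟩))
  else ⊥

/-- Negation. -/
def neg (φ : Fm) : Fm := fun n => (φ n).not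
/-- Implication. -/
def imp (φ ψ : Fm) : Fm := fun n => (φ n).imp (ψ n)
/-- Conjunction. -/
def and (φ ψ : Fm) : Fm := fun n => φ n ⊓ ψ n
/-- Disjunction. -/
def or (φ ψ : Fm) : Fm := fun n => φ n ⊔ ψ n
/-- Biimplication. -/
def iff (φ ψ : Fm) : Fm := fun n => (φ n).iff (ψ n)
/-- Universal quantification over all sets. -/
def all (φ : ℕ → Fm) : Fm := fun n => (φ n (n + 1)).all
/-- Existential quantification over all sets. -/
def ex (φ : ℕ → Fm) : Fm := fun n => (φ n (n + 1)).ex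

/-- The formula `φ(σ 0, σ 1, …)`, for a formula `φ` with `k` free variables. -/
def app {k : ℕ} (φ : LSet.Formula (Fin k)) (σ : Fin k → ℕ) : Fm := fun n =>
  if h : ∀ i, σ i < n then
    Language.BoundedFormula.relabel (n := n) (k := 0) (fun i => Sum.inr ⟨σ i, h i⟩) φ
  else ⊥

/-- The closed formula `φ`, as a sentence. -/
def sentence (φ : Fm) : LSet.Sentence := φ 0

/-- The universal closure of a formula `φ` with free variables `0, …, n - 1`. -/
def closure (n : ℕ) (φ : Fm) : LSet.Sentence := (φ n).alls

end Fm

open Fm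

infix:60 " ∈ₛ " => Fm.mem
infix:60 " =ₛ " => Fm.eq
infix:60 " ≤γ " => Fm.le
prefix:max "¬ₛ" => Fm.neg
infixr:45 " ∧ₛ " => Fm.and
infixr:40 " ∨ₛ " => Fm.or
infixr:35 " →ₛ " => Fm.imp
infix:30 " ↔ₛ " => Fm.iff

/-- `∀ x ∈ A, φ x`. -/
def allIn (A : ℕ) (φ : ℕ → Fm) : Fm := all fun x => x ∈ₛ A →ₛ φ x
/-- `∃ x ∈ A, φ x`. -/
def exIn (A : ℕ) (φ : ℕ → Fm) : Fm := ex fun x => x ∈ₛ A ∧ₛ φ x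
/-- `∃! x, φ x`. -/
def exUnique (φ : ℕ → Fm) : Fm := ex fun x => φ x ∧ₛ all fun y => φ y →ₛ y =ₛ x

/-! ### Basic set theory -/

/-- `x ⊆ y`. -/
def Sub (x y : ℕ) : Fm := allIn x fun z => z ∈ₛ y
/-- `x = ∅`. -/
def IsEmptySet (x : ℕ) : Fm := all fun z => ¬ₛ (z ∈ₛ x)
/-- `u = {x, y}`. -/
def IsUPair (u x y : ℕ) : Fm := all fun z => z ∈ₛ u ↔ₛ (z =ₛ x ∨ₛ z =ₛ y)
/-- `p = (x, y)`, the Kuratowski ordered pair `{{x, x}, {x, y}}`. -/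
def IsPair (p x y : ℕ) : Fm :=
  ex fun u => ex fun v => IsUPair u x x ∧ₛ IsUPair v x y ∧ₛ IsUPair p u v
/-- `u = ⋃ c`. -/
def IsUnion (u c : ℕ) : Fm := all fun z => z ∈ₛ u ↔ₛ exIn c fun v => z ∈ₛ v
/-- `w = u ∩ v`. -/
def IsInter (w u v : ℕ) : Fm := all fun z => z ∈ₛ w ↔ₛ (z ∈ₛ u ∧ₛ z ∈ₛ v)
/-- `y = x ∪ {x}`. -/
def IsSucc (y x : ℕ) : Fm := all fun z => z ∈ₛ y ↔ₛ (z ∈ₛ x ∨ₛ z =ₛ x)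
/-- `w` contains `∅` and is closed under `x ↦ x ∪ {x}`. -/
def IsInductive (w : ℕ) : Fm :=
  (ex fun o => IsEmptySet o ∧ₛ o ∈ₛ w) ∧ₛ
    allIn w fun x => ex fun y => IsSucc y x ∧ₛ y ∈ₛ w

/-! ### The theory ZFG[0] -/

def extensionality : Fm := all fun x => all fun y => (all fun z => z ∈ₛ x ↔ₛ z ∈ₛ y) →ₛ x =ₛ y

def foundation : Fm :=
  all fun x => (ex fun y => y ∈ₛ x) →ₛ exIn x fun y => allIn y fun z => ¬ₛ (z ∈ₛ x)

def pairing : Fm := all fun x => all fun y => ex fun u => IsUPair u x y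

def union : Fm := all fun c => ex fun u => IsUnion u c

def infinity : Fm := ex fun w => IsInductive w

/-- The substitution giving the parameters `0, …, n - 1` to the first `n` variables of a formula,
and `x`, `y` to the last two. -/
def args₂ (n x y : ℕ) : Fin (n + 2) → ℕ := fun i =>
  if i.1 < n then i.1 else if i.1 = n then x else y

/-- The substitution giving the parameters `0, …, n - 1` to the first `n` variables of a formula,
and `x` to the last one. -/
def args₁ (n x : ℕ) : Fin (n + 1) → ℕ := fun i => if i.1 < n then i.1 else x

/-- Separation for a formula `φ(p₀, …, pₙ₋₁, x)` of the full language. -/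
def separation (n : ℕ) (φ : LSet.Formula (Fin (n + 1))) : LSet.Sentence :=
  closure n <| all fun a => ex fun b => all fun x =>
    x ∈ₛ b ↔ₛ (x ∈ₛ a ∧ₛ app φ (args₁ n x))

/-- Replacement for a formula `φ(p₀, …, pₙ₋₁, x, y)` of the full language. -/
def replacement (n : ℕ) (φ : LSet.Formula (Fin (n + 2))) : LSet.Sentence :=
  closure n <| all fun a =>
    (allIn a fun x => exUnique fun y => app φ (args₂ n x y)) →ₛ
      ex fun b => all fun y => y ∈ₛ b ↔ₛ exIn a fun x => app φ (args₂ n x y)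

/-- `≤γ` is a linear order. -/
def linearOrder : Fm :=
  (all fun x => x ≤γ x) ∧ₛ
  (all fun x => all fun y => x ≤γ y →ₛ y ≤γ x →ₛ x =ₛ y) ∧ₛ
  (all fun x => all fun y => all fun z => x ≤γ y →ₛ y ≤γ z →ₛ x ≤γ z) ∧ₛ
  (all fun x => all fun y => x ≤γ y ∨ₛ y ≤γ x)

/-- If the class `{x | φ(p₀, …, pₙ₋₁, x)}` is not empty, it has a `≤γ`-least element. -/
def leastElement (n : ℕ) (φ : LSet.Formula (Fin (n + 1))) : LSet.Sentence :=
  closure n <| (ex fun x => app φ (args₁ n x)) →ₛ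
    ex fun x => app φ (args₁ n x) ∧ₛ all fun y => app φ (args₁ n y) →ₛ x ≤γ y

/-- ZFG[0]: Zermelo-Fraenkel set theory without the power set axiom, with a global well-ordering
`≤γ` of the universe that may occur in the formulas of the schemes. -/
def ZFG0 : LSet.Theory :=
  {extensionality.sentence, foundation.sentence, pairing.sentence, union.sentence,
    infinity.sentence, linearOrder.sentence} ∪
  {σ | ∃ n φ, σ = separation n φ} ∪
  {σ | ∃ n φ, σ = replacement n φ} ∪
  {σ | ∃ n φ, σ = leastElement n φ}

/-! ### Functions and finite sets -/

/-- `(x, y) ∈ f`, that is `f(x) = y` if `f` is a function. -/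
def Val (f x y : ℕ) : Fm := exIn f fun p => IsPair p x y

/-- `f` is a function with domain `A`. -/
def IsFunOn (f A : ℕ) : Fm :=
  (allIn f fun p => exIn A fun x => ex fun y => IsPair p x y) ∧ₛ
    allIn A fun x => exUnique fun y => Val f x y

/-- `f` is a function from `A` to `B`. -/
def IsFun (f A B : ℕ) : Fm :=
  IsFunOn f A ∧ₛ all fun x => all fun y => Val f x y →ₛ y ∈ₛ B

/-- `f` is a bijection from `A` to `B`. -/
def IsBij (f A B : ℕ) : Fm := IsFun f A B ∧ₛ allIn B fun y => exUnique fun x => Val f x y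

/-- `n` is a natural number: it is in every inductive set. -/
def IsNat (n : ℕ) : Fm := all fun w => IsInductive w →ₛ n ∈ₛ w

/-- `A` is finite: it is in bijection with a natural number. -/
def IsFinite (A : ℕ) : Fm := ex fun n => IsNat n ∧ₛ ex fun f => IsBij f n A

/-! ### Commutative rings -/

/-- `x * y = z` for the binary operation `op`, a function on ordered pairs. -/
def Op (op x y z : ℕ) : Fm := ex fun p => IsPair p x y ∧ₛ Val op p z

/-- `op` is a binary operation on `A`, a function from `A × A` to `A`. -/
def IsOp (A op : ℕ) : Fm :=
  (allIn op fun q => exIn A fun x => exIn A fun y => exIn A fun z =>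
    ex fun p => IsPair p x y ∧ₛ IsPair q p z) ∧ₛ
  allIn A fun x => allIn A fun y => exUnique fun z => Op op x y z

/-- `op` is commutative on `A`. -/
def IsCommOp (A op : ℕ) : Fm :=
  allIn A fun x => allIn A fun y => all fun z => Op op x y z →ₛ Op op y x z

/-- `op` is associative on `A`. -/
def IsAssocOp (A op : ℕ) : Fm :=
  allIn A fun x => allIn A fun y => allIn A fun z => all fun u => all fun v =>
    Op op x y u →ₛ Op op y z v →ₛ all fun w => Op op u z w ↔ₛ Op op x v w

/-- `e` is the neutral element of the commutative operation `op` on `A`. -/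
def IsUnitOf (A op e : ℕ) : Fm := e ∈ₛ A ∧ₛ allIn A fun x => Op op e x x

/-- `A` is a commutative ring with unit, with addition `a` and multiplication `m`. -/
def IsRing (A a m : ℕ) : Fm :=
  IsOp A a ∧ₛ IsOp A m ∧ₛ
  IsCommOp A a ∧ₛ IsAssocOp A a ∧ₛ
  (ex fun o => IsUnitOf A a o ∧ₛ allIn A fun x => exIn A fun y => Op a x y o) ∧ₛ
  IsCommOp A m ∧ₛ IsAssocOp A m ∧ₛ
  (ex fun e => IsUnitOf A m e) ∧ₛ
  (allIn A fun x => allIn A fun y => allIn A fun z => all fun s => all fun t => all fun u =>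
    Op a y z s →ₛ Op m x y t →ₛ Op m x z u →ₛ all fun w => Op m x s w ↔ₛ Op a t u w)

/-- `f` carries the operation `op` to the operation `op'`. -/
def Preserves (f op op' : ℕ) : Fm :=
  all fun x => all fun y => all fun z => all fun x' => all fun y' => all fun z' =>
    Op op x y z →ₛ Val f x x' →ₛ Val f y y' →ₛ Val f z z' →ₛ Op op' x' y' z'

/-- `f` is a homomorphism from the ring `(A, a, m)` to the ring `(B, b, n)`. -/
def IsRingHom (A a m B b n f : ℕ) : Fm :=
  IsFun f A B ∧ₛ Preserves f a b ∧ₛ Preserves f m n ∧ₛ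
  all fun x => all fun y => IsUnitOf A m x →ₛ Val f x y →ₛ IsUnitOf B n y

/-- `J` is an ideal of the ring `(A, a, m)`. -/
def IsIdeal (A a m J : ℕ) : Fm :=
  Sub J A ∧ₛ
  (ex fun o => IsUnitOf A a o ∧ₛ o ∈ₛ J) ∧ₛ
  (allIn J fun x => allIn J fun y => all fun z => Op a x y z →ₛ z ∈ₛ J) ∧ₛ
  (allIn A fun x => allIn J fun y => all fun z => Op m x y z →ₛ z ∈ₛ J)

/-- `p` is a prime ideal of the ring `(A, a, m)`. -/
def IsPrimeIdeal (A a m p : ℕ) : Fm :=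
  IsIdeal A a m p ∧ₛ
  (exIn A fun x => ¬ₛ (x ∈ₛ p)) ∧ₛ
  (allIn A fun x => allIn A fun y => allIn p fun z =>
    Op m x y z →ₛ (x ∈ₛ p ∨ₛ y ∈ₛ p))

/-- The ideal `J` of the ring `(A, a, m)` is generated by a finite set. -/
def IsFGIdeal (A a m J : ℕ) : Fm :=
  ex fun G => IsFinite G ∧ₛ Sub G J ∧ₛ
    all fun K => IsIdeal A a m K →ₛ Sub G K →ₛ Sub J K

/-- `(A, a, m)` is a Noetherian ring: every ideal is finitely generated. -/
def IsNoetherianRing (A a m : ℕ) : Fm :=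
  IsRing A a m ∧ₛ all fun J => IsIdeal A a m J →ₛ IsFGIdeal A a m J

/-- `x` is a power `f ^ k`, `k ≥ 0`, in the ring with carrier `A` and multiplication `m`: it is in
every set that contains `1` and is closed under multiplication by `f`. -/
def IsPower (A m f x : ℕ) : Fm :=
  all fun S => (ex fun e => IsUnitOf A m e ∧ₛ e ∈ₛ S) →ₛ
    (allIn S fun y => all fun z => Op m y f z →ₛ z ∈ₛ S) →ₛ x ∈ₛ S

/-! ### Sheaves and schemes

A space is a set `P` of points with a set `T` of open subsets.  A presheaf of sets `F` is a
function with domain `T`; its restriction maps are given by a function `r` whose value at `(U, V)`,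
for open sets `V ⊆ U`, is a function from `F(U)` to `F(V)`.  For a presheaf of rings `O` there are
two further functions `a` and `m` with domain `T`, whose values at `U` are the addition and the
multiplication of `O(U)`. -/

/-- `T` is a topology on the set `P`. -/
def IsSpace (P T : ℕ) : Fm :=
  (allIn T fun U => Sub U P) ∧ₛ
  P ∈ₛ T ∧ₛ
  (all fun C => Sub C T →ₛ exIn T fun U => IsUnion U C) ∧ₛ
  (allIn T fun U => allIn T fun V => exIn T fun W => IsInter W U V)

/-- `s ∈ F(U)`. -/
def IsSection (F U s : ℕ) : Fm := ex fun A => Val F U A ∧ₛ s ∈ₛ A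

/-- `t` is the restriction of `s` from `U` to `V`. -/
def Res (r U V s t : ℕ) : Fm :=
  ex fun p => ex fun g => IsPair p U V ∧ₛ Val r p g ∧ₛ Val g s t

/-- `F`, with the restrictions given by `r`, satisfies the sheaf condition: for every cover `C` of
an open set `U`, each family `c` of sections of `F` on the members of `C` that agree on
intersections comes from exactly one section on `U`. -/
def SheafCondition (T F r : ℕ) : Fm :=
  allIn T fun U => all fun C => Sub C T →ₛ IsUnion U C →ₛ all fun c =>
    IsFunOn c C →ₛ
    (all fun V => all fun s => Val c V s →ₛ IsSection F V s) →ₛ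
    (all fun V => all fun W => all fun s => all fun t => Val c V s →ₛ Val c W t →ₛ
      all fun Z => IsInter Z V W →ₛ ex fun u => Res r V Z s u ∧ₛ Res r W Z t u) →ₛ
    exUnique fun s => IsSection F U s ∧ₛ
      all fun V => all fun t => Val c V t →ₛ Res r U V s t

/-- `φ` holds of the ring of sections of `O` on `U`, given as a set with two operations. -/
def RingAt (O a m U : ℕ) (φ : ℕ → ℕ → ℕ → Fm) : Fm :=
  ex fun A => ex fun b => ex fun n => Val O U A ∧ₛ Val a U b ∧ₛ Val m U n ∧ₛ φ A b n

/-- `(P, T, O, a, m, r)` is a ringed space: `T` is a topology on `P`, and `O` with the operations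
`a`, `m` and the restrictions `r` is a sheaf of commutative rings on it. -/
def IsRingedSpace (P T O a m r : ℕ) : Fm :=
  IsSpace P T ∧ₛ
  IsFunOn O T ∧ₛ IsFunOn a T ∧ₛ IsFunOn m T ∧ₛ
  (allIn T fun U => RingAt O a m U fun A b n => IsRing A b n) ∧ₛ
  (allIn r fun q => exIn T fun U => exIn T fun V => ex fun p => ex fun g =>
    Sub V U ∧ₛ IsPair p U V ∧ₛ IsPair q p g) ∧ₛ
  (allIn T fun U => allIn T fun V => Sub V U →ₛ all fun p => IsPair p U V →ₛ
    exUnique fun g => Val r p g) ∧ₛ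
  (allIn T fun U => allIn T fun V => all fun p => all fun g => IsPair p U V →ₛ Val r p g →ₛ
    RingAt O a m U fun A b n => RingAt O a m V fun A' b' n' =>
      IsRingHom A b n A' b' n' g) ∧ₛ
  (allIn T fun U => all fun s => IsSection O U s →ₛ Res r U U s s) ∧ₛ
  (all fun U => all fun V => all fun W => all fun s => all fun t => all fun u =>
    Res r U V s t →ₛ Res r V W t u →ₛ Res r U W s u) ∧ₛ
  SheafCondition T O r

/-- The open set `V ⊆ U` is the distinguished open set `D(f)`, for a bijection `h` of `U` with a
set of prime ideals. -/
def IsDistinguished (h U f V : ℕ) : Fm :=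
  Sub V U ∧ₛ allIn U fun x => x ∈ₛ V ↔ₛ ex fun p => Val h x p ∧ₛ ¬ₛ (f ∈ₛ p)

/-- `t` is the image of `g` under the composite of `θ : R → O(U)` and the restriction to `V`. -/
def ImageOn (r U V θ g t : ℕ) : Fm := ex fun s => Val θ g s ∧ₛ Res r U V s t

/-- The map from `R` to the ring of sections `(A, n)` on `V` given by `θ : R → O(U)` and restriction
presents it as the localization `R_f`: the image of `f` is invertible, every section
is a fraction of an element of `R` by a power of `f`, and elements of `R` with equal images become
equal after multiplication by a power of `f`. -/
def IsLocalizationMap (R n r U V θ f A m : ℕ) : Fm :=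
  (all fun t => ImageOn r U V θ f t →ₛ exIn A fun v => ex fun e =>
    IsUnitOf A m e ∧ₛ Op m t v e) ∧ₛ
  (allIn A fun s => exIn R fun k => IsPower R n f k ∧ₛ exIn R fun g =>
    ex fun u => ex fun t => ImageOn r U V θ k u ∧ₛ ImageOn r U V θ g t ∧ₛ Op m s u t) ∧ₛ
  (allIn R fun g => allIn R fun g' => all fun t =>
    ImageOn r U V θ g t →ₛ ImageOn r U V θ g' t →ₛ
      exIn R fun k => IsPower R n f k ∧ₛ ex fun w => Op n k g w ∧ₛ Op n k g' w)

/-- The restriction of the ringed space to the open set `U` is isomorphic to the spectrum of the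
ring `(R, b, n)`, by the map `h` from `U` to prime ideals and the ring map `θ : R → O(U)`:
`h` is a bijection of `U` with the prime ideals of `R`; a subset of `U` is open exactly if it
corresponds to the complement of some closed set `V(J) = {p | J ⊆ p}`; and for each `f` in `R`, the
map from `R` to `O(D(f))` presents this ring as the localization `R_f`. -/
def IsSpecVia (T O a m r U R b n h θ : ℕ) : Fm :=
  IsFunOn h U ∧ₛ
  (all fun x => all fun p => Val h x p →ₛ IsPrimeIdeal R b n p) ∧ₛ
  (all fun p => IsPrimeIdeal R b n p →ₛ exUnique fun x => Val h x p) ∧ₛ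
  (all fun V => Sub V U →ₛ (V ∈ₛ T ↔ₛ ex fun J => IsIdeal R b n J ∧ₛ
    allIn U fun x => x ∈ₛ V ↔ₛ ex fun p => Val h x p ∧ₛ ¬ₛ (Sub J p))) ∧ₛ
  (RingAt O a m U fun A a' m' => IsRingHom R b n A a' m' θ) ∧ₛ
  (allIn R fun f => allIn T fun V => IsDistinguished h U f V →ₛ
    RingAt O a m V fun A _ m' => IsLocalizationMap R n r U V θ f A m')

/-- The open set `U` is affine, isomorphic to the spectrum of a Noetherian ring. -/
def IsNoetherianAffine (T O a m r U : ℕ) : Fm :=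
  ex fun R => ex fun b => ex fun n => ex fun h => ex fun θ =>
    IsNoetherianRing R b n ∧ₛ IsSpecVia T O a m r U R b n h θ

/-- `(P, T, O, a, m, r)` is a Noetherian scheme: a ringed space with a finite cover by open sets
isomorphic to spectra of Noetherian rings.  (Its stalks are then automatically local rings.) -/
def IsNoetherianScheme (P T O a m r : ℕ) : Fm :=
  IsRingedSpace P T O a m r ∧ₛ
  ex fun C => IsFinite C ∧ₛ Sub C T ∧ₛ IsUnion P C ∧ₛ
    allIn C fun U => IsNoetherianAffine T O a m r U

/-- `I` is a sheaf of ideals of the sheaf of rings `(O, a, m, r)`: a function with domain `T` whose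
value `I(U)` is an ideal of `O(U)`, preserved by the restriction maps of `O`, and such that `I` with
these restrictions is a sheaf. -/
def IsIdealSheaf (T O a m r I : ℕ) : Fm :=
  IsFunOn I T ∧ₛ
  (allIn T fun U => RingAt O a m U fun A b n => ex fun J => Val I U J ∧ₛ IsIdeal A b n J) ∧ₛ
  (all fun U => all fun V => all fun s => all fun t =>
    IsSection I U s →ₛ Res r U V s t →ₛ IsSection I V t) ∧ₛ
  SheafCondition T I r

end ZFG

open ZFG

/-! Without the power set axiom, the functions on the topology that might be ideal sheaves need not
form a set. They do form one on a Noetherian scheme because every ideal sheaf, quasi-coherent or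
not, is determined by finitely many local sections: there is a finite set `F` of pairs `(W, s)` with
`s` in `I(W)` such that `I` is the least ideal sheaf containing `F`. All such `F` lie in one set
obtained by recursion on the natural numbers (`exists_adj_closed`). The assignment sending `F` to
the least ideal sheaf containing it is a definable partial function, so replacement applies
(`IsNoetherianScheme.exists_set_of_isIdealSheaf`).

The finite set is found on each affine piece Spec `R` by Noetherian induction on an ideal `K`: some
`F` generates `I` at all points of V(K) (`exists_generatesAt_of_affine`). If `K` is the whole ring
there are no such points. If a product `fg` is in `K` but no factor is, V(K) is the union of the
smaller closed sets V(K + f) and V(K + g). If `K` is prime, it is the generic point `y` of V(K). The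
elements of `R` whose images are sections of `I` near `y` form a finitely generated ideal. The
images of its generators on a common neighbourhood `W` of `y` generate `I` at every point of V(K) in
`W`: a section of `I` near such a point is a fraction whose numerator is also a section near `y`
(`IsSpecVia.exists_res_mem`). What remains of V(K) lies in a smaller closed set. Generation is
expressed by comparison with all ideal sheaves containing `F`, so neither stalks nor generated
sheaves are constructed.

Noetherian induction is needed for definable classes of ideals, and the ideals of `R` need not form
a set. The global well-ordering selects a least bad ideal strictly above each bad one; iterating
this gives a chain whose union is finitely generated, a contradiction
(`IsNoetherianRing.induction`).

Formal provability is reduced to truth in all models by a Henkin completeness proof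
(`provable_of_forall_model`). Inside a model, the schemes apply to predicates definable with
parameters; the classes `D` and `DF` derive definability from the shape of a predicate or function.
-/

namespace ZFG

open FirstOrder FirstOrder.Language

/-! ### Renaming of free and bound variables in formulas. -/

section Renaming

universe u v

variable {L : FirstOrder.Language.{u, v}} {α β γ : Type*}

/-- Extension of a renaming of variables to one more bound variable. -/
def liftRen {n m : ℕ} (ρ : α ⊕ Fin n → β ⊕ Fin m) : α ⊕ Fin (n + 1) → β ⊕ Fin (m + 1) :=
  Sum.elim (fun a => Sum.map id Fin.castSucc (ρ (.inl a)))
    (Fin.lastCases (.inr (Fin.last m)) fun i => Sum.map id Fin.castSucc (ρ (.inr i)))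

@[simp] theorem liftRen_inl {n m : ℕ} (ρ : α ⊕ Fin n → β ⊕ Fin m) (a : α) :
    liftRen ρ (.inl a) = Sum.map id Fin.castSucc (ρ (.inl a)) := rfl

@[simp] theorem liftRen_last {n m : ℕ} (ρ : α ⊕ Fin n → β ⊕ Fin m) :
    liftRen ρ (.inr (Fin.last n)) = .inr (Fin.last m) := by
  simp [liftRen]

@[simp] theorem liftRen_castSucc {n m : ℕ} (ρ : α ⊕ Fin n → β ⊕ Fin m) (i : Fin n) :
    liftRen ρ (.inr i.castSucc) = Sum.map id Fin.castSucc (ρ (.inr i)) := by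
  simp [liftRen]

theorem liftRen_comp {k n m : ℕ} (σ : β ⊕ Fin n → γ ⊕ Fin m) (ρ : α ⊕ Fin k → β ⊕ Fin n) :
    liftRen σ ∘ liftRen ρ = liftRen (σ ∘ ρ) := by
  funext x
  rcases x with a | i
  · simp only [Function.comp, liftRen_inl]
    rcases ρ (.inl a) with b | j <;> simp
  · refine Fin.lastCases ?_ (fun i => ?_) i
    · simp
    · simp only [Function.comp, liftRen_castSucc]
      rcases ρ (.inr i) with b | j <;> simp

/-- Renaming of all the variables of a formula, free or bound outside. -/
def ren : ∀ {n m : ℕ} (_ : α ⊕ Fin n → β ⊕ Fin m), L.BoundedFormula α n → L.BoundedFormula β m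
  | _, _, _, .falsum => .falsum
  | _, _, ρ, .equal s t => .equal (s.relabel ρ) (t.relabel ρ)
  | _, _, ρ, .rel R ts => .rel R fun i => (ts i).relabel ρ
  | _, _, ρ, .imp φ ψ => .imp (ren ρ φ) (ren ρ ψ)
  | _, _, ρ, .all φ => .all (ren (liftRen ρ) φ)

theorem ren_ren {k n m : ℕ} (σ : β ⊕ Fin n → γ ⊕ Fin m) (ρ : α ⊕ Fin k → β ⊕ Fin n)
    (φ : L.BoundedFormula α k) : ren σ (ren ρ φ) = ren (σ ∘ ρ) φ := by
  induction φ generalizing n m with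
  | falsum => rfl
  | equal => simp [ren]
  | rel => simp [ren]
  | imp _ _ ih₁ ih₂ => simp [ren, ih₁, ih₂]
  | all _ ih => simp [ren, ih, liftRen_comp]

/-- Relabelling, `toFormula` and substitution of variables are separate recursions. Once each is a
case of `ren`, identities between their composites reduce through `ren_ren` to equalities of
functions on variables. -/
theorem relabel_eq_ren {n k : ℕ} (g : α → β ⊕ Fin n) (φ : L.BoundedFormula α k) :
    φ.relabel g = ren (BoundedFormula.relabelAux g k) φ := by
  induction φ with
  | falsum => rfl
  | equal => rfl
  | rel => rfl
  | imp _ _ ih₁ ih₂ => simp [ren, ih₁, ih₂]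
  | all _ ih =>
    rw [BoundedFormula.relabel_all, ih, ren]
    congr 2
    funext x
    rcases x with a | i
    · simp only [BoundedFormula.relabelAux, Function.comp, liftRen_inl, Sum.map_inl]
      rcases g a with b | j <;> simp [Fin.ext_iff]
    · refine Fin.lastCases ?_ (fun i => ?_) i
      · simp [BoundedFormula.relabelAux]
      · simp [BoundedFormula.relabelAux]

theorem formula_relabel_eq_ren (f : α → β) (φ : L.Formula α) :
    φ.relabel f = ren (Sum.map f id) φ := by
  rw [Formula.relabel, relabel_eq_ren]
  congr 1
  funext x
  rcases x with a | i
  · simp [BoundedFormula.relabelAux]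
  · exact i.elim0

theorem toFormula_eq_ren {n : ℕ} (φ : L.BoundedFormula α n) :
    φ.toFormula = ren (Sum.inl : _ → (α ⊕ Fin n) ⊕ Fin 0) φ := by
  induction φ with
  | falsum => rfl
  | equal => rfl
  | rel => rfl
  | imp _ _ ih₁ ih₂ => simp [ren, ih₁, ih₂]
  | @all n φ ih =>
    rw [BoundedFormula.toFormula, ih, relabel_eq_ren, ren_ren, ren]
    congr 2
    funext x
    rcases x with a | i
    · simp [BoundedFormula.relabelAux]
    · refine Fin.lastCases ?_ (fun i => ?_) i
      · simp only [BoundedFormula.relabelAux, Function.comp, Sum.map_inl, Sum.elim_inr]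
        rw [show Fin.last n = Fin.natAdd n (0 : Fin 1) from rfl, finSumFinEquiv_symm_apply_natAdd]
        simp
        rw [show (Sum.inr (Fin.natAdd n (0 : Fin 1)) : α ⊕ Fin (n+1)) = .inr (Fin.last n) from rfl,
          liftRen_last]
        rfl
      · simp only [BoundedFormula.relabelAux, Function.comp, Sum.map_inl, Sum.elim_inr,
          liftRen_castSucc]
        rw [show i.castSucc = Fin.castAdd 1 i from rfl, finSumFinEquiv_symm_apply_castAdd]
        simp

theorem subst_var_eq_ren {n : ℕ} (f : α → β) (φ : L.BoundedFormula α n) :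
    φ.subst (fun a => Term.var (f a)) = ren (Sum.map f id) φ := by
  have key : ∀ {k : ℕ} (t : L.Term (α ⊕ Fin k)),
      t.subst (Sum.elim (Term.relabel Sum.inl ∘ fun a => Term.var (f a)) (Term.var ∘ Sum.inr)) =
        t.relabel (Sum.map f id) := by
    intro k t
    induction t with
    | var x => rcases x with a | i <;> rfl
    | func _ _ ih => simp [ih]
  induction φ with
  | falsum => rfl
  | equal => simp [BoundedFormula.subst, BoundedFormula.mapTermRel, ren, key]
  | rel => simp [BoundedFormula.subst, BoundedFormula.mapTermRel, ren, key]
  | imp _ _ ih₁ ih₂ =>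
    rw [ren, ← ih₁, ← ih₂]
    rfl
  | all φ ih =>
    rw [ren, show liftRen (Sum.map f id) = Sum.map f id from ?_, ← ih]
    · rfl
    · funext x
      rcases x with a | i
      · rfl
      · refine Fin.lastCases ?_ (fun i => ?_) i <;> simp

/-- The renaming that puts the variable `x` in place of the last bound variable. -/
abbrev instRen (f : α → β) (x : β) : α ⊕ Fin 1 → β ⊕ Fin 0 :=
  Sum.elim (fun a => .inl (f a)) fun _ => .inl x

theorem inst_var (φ : L.BoundedFormula ℕ 1) (x : ℕ) :
    inst φ (Term.var x) = ren (instRen id x) φ := by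
  have h : (Sum.elim Term.var fun _ => Term.var x : ℕ ⊕ Fin 1 → L.Term ℕ) =
      fun a => Term.var (Sum.elim id (fun _ => x) a) := by
    funext a
    rcases a with a | a <;> rfl
  rw [inst, h, subst_var_eq_ren, toFormula_eq_ren, ren_ren]
  congr 1
  funext a
  rcases a with a | a <;> rfl

theorem relabel_toFormula (φ : L.BoundedFormula ℕ 1) (f : ℕ → ℕ) (x : ℕ) :
    Formula.relabel (Sum.elim f fun _ => x) φ.toFormula = ren (instRen f x) φ := by
  rw [formula_relabel_eq_ren, toFormula_eq_ren, ren_ren]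
  congr 1
  funext a
  rcases a with a | a <;> rfl

theorem ren_liftRen_map (f : ℕ → ℕ) {x : ℕ} (φ : L.BoundedFormula ℕ 1) (g : ℕ → ℕ) :
    ren (instRen g x) (ren (liftRen (Sum.map f (id : Fin 0 → Fin 0))) φ) =
      ren (instRen (g ∘ f) x) φ := by
  rw [ren_ren]
  congr 1
  funext a
  rcases a with a | a
  · rfl
  · rw [show a = Fin.last 0 from Subsingleton.elim (α := Fin 1) _ _, Function.comp_apply,
      liftRen_last]
    rfl

/-- All the free variables of `φ` are less than `N`. -/
def VarsBelow (N : ℕ) {n : ℕ} (φ : L.BoundedFormula ℕ n) : Prop :=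
  ∀ ⦃β : Type⦄ ⦃m : ℕ⦄ (ρ σ : ℕ ⊕ Fin n → β ⊕ Fin m), (∀ i, ρ (.inr i) = σ (.inr i)) →
    (∀ x < N, ρ (.inl x) = σ (.inl x)) → ren ρ φ = ren σ φ

theorem VarsBelow.mono {N N' n : ℕ} (h : N ≤ N') {φ : L.BoundedFormula ℕ n} (hφ : VarsBelow N φ) :
    VarsBelow N' φ :=
  fun _ _ ρ σ h₁ h₂ => hφ ρ σ h₁ fun x hx => h₂ x (hx.trans_le h)

theorem exists_term_relabel_eq {n : ℕ} (t : L.Term (ℕ ⊕ Fin n)) :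
    ∃ N, ∀ ⦃δ : Type⦄ (ρ σ : ℕ ⊕ Fin n → δ), (∀ i, ρ (.inr i) = σ (.inr i)) →
      (∀ x < N, ρ (.inl x) = σ (.inl x)) → t.relabel ρ = t.relabel σ := by
  induction t with
  | var x =>
    rcases x with a | i
    · exact ⟨a + 1, fun _ ρ σ _ h => by simp [h a (Nat.lt_succ_self a)]⟩
    · exact ⟨0, fun _ ρ σ h _ => by simp [h i]⟩
  | func F ts ih =>
    choose N hN using ih
    refine ⟨Finset.univ.sup N, fun _ ρ σ h h' => ?_⟩
    simp only [Term.relabel, Term.func.injEq, heq_eq_eq, true_and]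
    exact funext fun i => hN i ρ σ h fun x hx =>
      h' x (hx.trans_le (Finset.le_sup (Finset.mem_univ i)))

theorem exists_varsBelow {n : ℕ} (φ : L.BoundedFormula ℕ n) : ∃ N, VarsBelow N φ := by
  induction φ with
  | falsum => exact ⟨0, fun _ _ _ _ _ _ => rfl⟩
  | equal s t =>
    obtain ⟨N, hN⟩ := exists_term_relabel_eq s
    obtain ⟨K, hK⟩ := exists_term_relabel_eq t
    refine ⟨max N K, fun _ _ ρ σ h h' => ?_⟩
    rw [ren, ren, hN ρ σ h fun x hx => h' x (by omega), hK ρ σ h fun x hx => h' x (by omega)]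
  | rel R ts =>
    choose N hN using fun i => exists_term_relabel_eq (ts i)
    refine ⟨Finset.univ.sup N, fun _ _ ρ σ h h' => ?_⟩
    simp only [ren, BoundedFormula.rel.injEq, heq_eq_eq, true_and]
    exact funext fun i => hN i ρ σ h fun x hx =>
      h' x (hx.trans_le (Finset.le_sup (Finset.mem_univ i)))
  | imp _ _ ih₁ ih₂ =>
    obtain ⟨N, hN⟩ := ih₁
    obtain ⟨K, hK⟩ := ih₂
    refine ⟨max N K, fun _ _ ρ σ h h' => ?_⟩
    rw [ren, ren, hN ρ σ h fun x hx => h' x (by omega), hK ρ σ h fun x hx => h' x (by omega)]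
  | all _ ih =>
    obtain ⟨N, hN⟩ := ih
    refine ⟨N, fun _ _ ρ σ h h' => ?_⟩
    rw [ren, ren, hN]
    · intro i
      refine Fin.lastCases ?_ (fun i => ?_) i <;> simp [h]
    · intro x hx
      simp [h' x hx]

end Renaming

/-! ### Structural properties of natural deduction. -/

section Derivability

universe u v

variable {L : FirstOrder.Language.{u, v}} {Γ Δ : Set (L.Formula ℕ)} {φ ψ : L.Formula ℕ}

theorem Derives.weaken (h : Derives Γ φ) (hΓ : Γ ⊆ Δ) : Derives Δ φ := by
  induction h generalizing Δ with
  | hyp h => exact .hyp (hΓ h)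
  | impI _ ih => exact .impI (ih (Set.insert_subset_insert hΓ))
  | impE _ _ ih₁ ih₂ => exact .impE (ih₁ hΓ) (ih₂ hΓ)
  | raa _ ih => exact .raa (ih (Set.insert_subset_insert hΓ))
  | allI _ ih => exact .allI (ih (Set.image_mono hΓ))
  | allE t _ ih => exact .allE t (ih hΓ)
  | eqRefl t => exact .eqRefl t
  | eqSubst _ _ ih₁ ih₂ => exact .eqSubst (ih₁ hΓ) (ih₂ hΓ)

theorem Derives.exFalso (h : Derives Γ ⊥) : Derives Γ φ :=
  .raa (h.weaken (Set.subset_insert _ _))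

theorem Derives.cut (h : Derives Γ φ) (h' : Derives (insert φ Γ) ψ) : Derives Γ ψ :=
  .impE (.impI h') h

/-- A derivation uses finitely many hypotheses; this keeps the union of an increasing sequence of
consistent sets consistent. -/
theorem Derives.exists_finite (h : Derives Γ φ) : ∃ Δ ⊆ Γ, Δ.Finite ∧ Derives Δ φ := by
  have key : ∀ {Γ : Set (L.Formula ℕ)} {φ : L.Formula ℕ} {Δ : Set (L.Formula ℕ)},
      Δ ⊆ insert φ Γ → Δ.Finite → ∃ Δ' ⊆ Γ, Δ'.Finite ∧ Δ ⊆ insert φ Δ' := fun {Γ φ Δ} h hf =>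
    ⟨Δ \ {φ}, fun x hx => (h hx.1).resolve_left hx.2, hf.sdiff, fun x hx => by
      by_cases hxφ : x = φ
      · exact Or.inl hxφ
      · exact Or.inr ⟨hx, hxφ⟩⟩
  induction h with
  | hyp h => exact ⟨{_}, by simpa using h, Set.finite_singleton _, .hyp rfl⟩
  | impI _ ih =>
    obtain ⟨Δ, hΔ, hf, hd⟩ := ih
    obtain ⟨Δ', h₁, h₂, h₃⟩ := key hΔ hf
    exact ⟨Δ', h₁, h₂, .impI (hd.weaken h₃)⟩
  | impE _ _ ih₁ ih₂ =>
    obtain ⟨Δ₁, h₁, hf₁, hd₁⟩ := ih₁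
    obtain ⟨Δ₂, h₂, hf₂, hd₂⟩ := ih₂
    exact ⟨Δ₁ ∪ Δ₂, Set.union_subset h₁ h₂, hf₁.union hf₂,
      .impE (hd₁.weaken Set.subset_union_left) (hd₂.weaken Set.subset_union_right)⟩
  | raa _ ih =>
    obtain ⟨Δ, hΔ, hf, hd⟩ := ih
    obtain ⟨Δ', h₁, h₂, h₃⟩ := key hΔ hf
    exact ⟨Δ', h₁, h₂, .raa (hd.weaken h₃)⟩
  | allI _ ih =>
    obtain ⟨Δ, hΔ, hf, hd⟩ := ih
    obtain ⟨Δ', h₁, h₂, rfl⟩ := Set.exists_subset_image_finite_and.1 ⟨Δ, hΔ, hf, rfl⟩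
    exact ⟨Δ', h₁, h₂, .allI hd⟩
  | allE t _ ih =>
    obtain ⟨Δ, hΔ, hf, hd⟩ := ih
    exact ⟨Δ, hΔ, hf, .allE t hd⟩
  | eqRefl t => exact ⟨∅, Set.empty_subset _, Set.finite_empty, .eqRefl t⟩
  | eqSubst _ _ ih₁ ih₂ =>
    obtain ⟨Δ₁, h₁, hf₁, hd₁⟩ := ih₁
    obtain ⟨Δ₂, h₂, hf₂, hd₂⟩ := ih₂
    exact ⟨Δ₁ ∪ Δ₂, Set.union_subset h₁ h₂, hf₁.union hf₂,
      .eqSubst (hd₁.weaken Set.subset_union_left) (hd₂.weaken Set.subset_union_right)⟩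

theorem Derives.exists_of_iUnion {Γ : ℕ → Set (L.Formula ℕ)} (hΓ : Monotone Γ)
    (h : Derives (⋃ n, Γ n) φ) : ∃ n, Derives (Γ n) φ := by
  obtain ⟨Δ, hΔ, hf, hd⟩ := h.exists_finite
  obtain ⟨n, hn⟩ := hΓ.directed_le.exists_mem_subset_of_finset_subset_biUnion (s := hf.toFinset)
    (by simpa using hΔ)
  exact ⟨n, hd.weaken (by simpa using hn)⟩

end Derivability

/-! ### Completeness of natural deduction by Henkin's construction. -/

section Completeness

variable {Γ Δ H : Set (LSet.Formula ℕ)} {φ ψ : LSet.Formula ℕ}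

/-- There are no function symbols. Hence renaming covers all substitutions, and variables can serve
as the elements of the term model. -/
theorem exists_eq_var {α : Type*} (t : LSet.Term α) : ∃ x, t = Term.var x := by
  cases t with
  | var x => exact ⟨x, rfl⟩
  | func F => exact Empty.elim F

theorem relabel_relabel' {α β γ : Type*} (g : β → γ) (f : α → β) (φ : LSet.Formula α) :
    (φ.relabel f).relabel g = φ.relabel (g ∘ f) := by
  simp only [formula_relabel_eq_ren, ren_ren, Sum.map_comp_map, Function.comp_id]

theorem relabel_inst (f : ℕ → ℕ) (φ : LSet.BoundedFormula ℕ 1) (x : ℕ) :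
    Formula.relabel f (inst φ (Term.var x)) =
      inst (ren (liftRen (Sum.map f id)) φ) (Term.var (f x)) := by
  rw [inst_var, inst_var, ren_liftRen_map, formula_relabel_eq_ren, ren_ren]
  congr 1
  funext a
  rcases a with a | a <;> rfl

/-- This turns a fresh variable of any number into the variable `0` that `allI` requires. -/
theorem Derives.relabel (h : Derives Γ φ) (f : ℕ → ℕ) :
    Derives (Formula.relabel f '' Γ) (Formula.relabel f φ) := by
  induction h generalizing f with
  | hyp h => exact .hyp (Set.mem_image_of_mem _ h)
  | impI _ ih =>
    have := ih f
    rw [Set.image_insert_eq] at this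
    exact .impI this
  | impE _ _ ih₁ ih₂ => exact .impE (ih₁ f) (ih₂ f)
  | raa _ ih =>
    have := ih f
    rw [Set.image_insert_eq] at this
    exact .raa this
  | @allI Γ φ _ ih =>
    -- Under the quantifier, the renaming fixes the eigenvariable `0` and acts as `f` on the shifted
    -- variables.
    have := ih (fun n => n.casesOn 0 fun k => f k + 1)
    rw [formula_relabel_eq_ren] at this ⊢
    refine .allI ?_
    rw [relabel_toFormula] at this ⊢
    rw [ren_liftRen_map]
    rw [ren_ren] at this
    convert this using 1
    · simp only [Set.image_image, relabel_relabel']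
      rfl
    · congr 1
      funext a
      rcases a with a | a <;> rfl
  | allE t _ ih =>
    obtain ⟨x, rfl⟩ := exists_eq_var t
    have := ih f
    rw [formula_relabel_eq_ren] at this
    rw [relabel_inst]
    exact .allE _ this
  | eqRefl t => 
    obtain ⟨x, rfl⟩ := exists_eq_var t
    exact .eqRefl (Term.var (f x))
  | @eqSubst Γ φ s t _ _ ih₁ ih₂ =>
    obtain ⟨x, rfl⟩ := exists_eq_var s
    obtain ⟨y, rfl⟩ := exists_eq_var t
    have h₁ := ih₁ f
    have h₂ := ih₂ f
    rw [relabel_inst] at h₂ ⊢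
    exact .eqSubst (s := Term.var (f x)) (t := Term.var (f y)) h₁ h₂

/-- `Γ` is consistent, and its free variables are bounded. -/
def Extendable (Γ : Set (LSet.Formula ℕ)) : Prop :=
  ¬ Derives Γ ⊥ ∧ ∃ N, ∀ φ ∈ Γ, VarsBelow N φ

/-- If a counterexample at the fresh variable `N` were contradictory, `χ` would be derivable at `N`,
and generalization would contradict `χ.all.not`. -/
theorem not_derives_insert_witness {χ : LSet.BoundedFormula ℕ 1} {N : ℕ}
    (hΓ : ∀ φ ∈ Γ, VarsBelow N φ) (hχ : VarsBelow N χ) (hmem : χ.all.not ∈ Γ)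
    (hcon : ¬ Derives Γ ⊥) : ¬ Derives (insert (inst χ (Term.var N)).not Γ) ⊥ := by
  intro h
  refine hcon (.impE (.hyp hmem) (.allI ?_))
  -- On formulas with variables below `N` this is the shift, and `N` goes to `0`: exactly the
  -- premise of `allI`.
  have h' := (Derives.raa h).relabel fun y => if y < N then y + 1 else 0
  rw [inst_var, formula_relabel_eq_ren, ren_ren] at h'
  rw [relabel_toFormula]
  convert h' using 1
  · refine Set.image_congr fun φ hφ => ?_
    rw [formula_relabel_eq_ren, formula_relabel_eq_ren]
    refine hΓ φ hφ _ _ (fun i => rfl) fun x hx => ?_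
    simp [hx]
  · refine hχ _ _ (fun i => ?_) fun x hx => ?_
    · simp
    · simp [hx]

/-- One stage of Henkin's construction: `ψ` is added if consistent, with a witness if it negates a
universal formula. The bound on the variables survives, so the next stage again has a fresh
variable. -/
theorem Extendable.exists_step (hΓ : Extendable Γ) (ψ : LSet.Formula ℕ) :
    ∃ Δ, Γ ⊆ Δ ∧ Extendable Δ ∧ (ψ ∈ Δ ∨ Derives (insert ψ Γ) ⊥) ∧
      ∀ χ : LSet.BoundedFormula ℕ 1, ψ = χ.all.not → ψ ∈ Δ →
        ∃ x, (inst χ (Term.var x)).not ∈ Δ := by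
  obtain ⟨hcon, N, hN⟩ := hΓ
  obtain ⟨K, hK⟩ := exists_varsBelow ψ
  by_cases hd : Derives (insert ψ Γ) ⊥
  · refine ⟨Γ, subset_rfl, ⟨hcon, N, hN⟩, .inr hd, fun χ _ h => absurd ?_ hcon⟩
    rwa [Set.insert_eq_of_mem h] at hd
  · have hb : ∀ φ ∈ insert ψ Γ, VarsBelow (max N K) φ := by
      rintro φ (rfl | hφ)
      · exact hK.mono (le_max_right _ _)
      · exact (hN φ hφ).mono (le_max_left _ _)
    by_cases hχ : ∃ χ : LSet.BoundedFormula ℕ 1, ψ = χ.all.not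
    · obtain ⟨χ, rfl⟩ := hχ
      obtain ⟨J, hJ⟩ := exists_varsBelow χ
      obtain ⟨J', hJ'⟩ := exists_varsBelow (inst χ (Term.var (max (max N K) J))).not
      refine ⟨insert (inst χ (Term.var (max (max N K) J))).not (insert χ.all.not Γ),
        (Set.subset_insert _ _).trans (Set.subset_insert _ _), ⟨?_, max (max N K) J', ?_⟩,
        .inl (.inr (.inl rfl)), ?_⟩
      · exact not_derives_insert_witness (fun φ hφ => (hb φ hφ).mono (le_max_left _ _))
          (hJ.mono (le_max_right _ _)) (.inl rfl) hd
      · rintro φ (rfl | hφ)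
        · exact hJ'.mono (le_max_right _ _)
        · exact (hb φ hφ).mono (le_max_left _ _)
      · intro χ' hχ' _
        obtain rfl : χ = χ' := by
          simpa [BoundedFormula.not] using hχ'
        exact ⟨_, .inl rfl⟩
    · exact ⟨insert ψ Γ, Set.subset_insert _ _, ⟨hd, _, hb⟩, .inl (.inl rfl),
        fun χ h => absurd ⟨χ, h⟩ hχ⟩

/-- A maximal consistent set of formulas with witnesses. -/
structure IsHenkin (H : Set (LSet.Formula ℕ)) : Prop where
  consistent : ¬ Derives H ⊥
  maximal : ∀ ψ, ψ ∈ H ∨ Derives (insert ψ H) ⊥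
  witness : ∀ χ : LSet.BoundedFormula ℕ 1, χ.all.not ∈ H → ∃ x, (inst χ (Term.var x)).not ∈ H

instance : Countable LSet.Symbols := by
  have h₁ : Countable (Σ l, LSet.Functions l) :=
    Function.Injective.countable (f := fun x : Σ l, LSet.Functions l => (0 : ℕ)) fun x =>
      Empty.elim x.2
  have h₂ : Countable (Σ l, LSet.Relations l) := by
    refine Function.Injective.countable
      (f := fun x : Σ l, LSet.Relations l => (SetRel.casesOn x.2 0 1 : ℕ)) ?_
    rintro ⟨_, _ | _⟩ ⟨_, _ | _⟩ h
    all_goals first | rfl | simp at h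
  exact inferInstanceAs (Countable ((Σ l, LSet.Functions l) ⊕ Σ l, LSet.Relations l))

theorem Extendable.exists_isHenkin (hΓ : Extendable Γ) : ∃ H, Γ ⊆ H ∧ IsHenkin H := by
  obtain ⟨e, he⟩ := exists_surjective_nat (LSet.Formula ℕ)
  choose! next h₁ h₂ h₃ h₄ using fun (Δ : Set (LSet.Formula ℕ)) (h : Extendable Δ) => h.exists_step
  let S : ℕ → Set (LSet.Formula ℕ) := fun n => n.rec Γ fun k Δ => next Δ (e k)
  have hS : ∀ n, Extendable (S n) := fun n => by
    induction n with
    | zero => exact hΓ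
    | succ k ih => exact h₂ _ ih _
  have hmono : Monotone S := monotone_nat_of_le_succ fun n => h₁ _ (hS n) _
  refine ⟨⋃ n, S n, Set.subset_iUnion S 0, fun h => ?_, fun ψ => ?_, fun χ h => ?_⟩
  · obtain ⟨n, hn⟩ := h.exists_of_iUnion hmono
    exact (hS n).1 hn
  · obtain ⟨n, rfl⟩ := he ψ
    refine (h₃ _ (hS n) (e n)).imp (fun h => Set.mem_iUnion.2 ⟨n + 1, h⟩) fun h => ?_
    exact h.weaken (Set.insert_subset_insert (Set.subset_iUnion S n))
  · obtain ⟨n, hn⟩ := he χ.all.not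
    -- If stage `n` had rejected this formula, it would be inconsistent with `S n`, although both
    -- lie in a common later stage.
    have hmem : e n ∈ S (n + 1) := by
      refine (h₃ _ (hS n) (e n)).resolve_right fun hd => ?_
      obtain ⟨k, hk⟩ := Set.mem_iUnion.1 h
      refine (hS (max n k)).1 ((Derives.hyp (φ := χ.all.not) (hmono (le_max_right _ _) hk)).cut ?_)
      rw [← hn]
      exact hd.weaken (Set.insert_subset_insert (hmono (le_max_left _ _)))
    obtain ⟨x, hx⟩ := h₄ _ (hS n) (e n) χ hn hmem
    exact ⟨x, Set.mem_iUnion.2 ⟨n + 1, hx⟩⟩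

namespace IsHenkin

theorem mem_of_derives (hH : IsHenkin H) (h : Derives H φ) : φ ∈ H :=
  (hH.maximal φ).resolve_right fun h' => hH.consistent (h.cut h')

theorem imp_mem (hH : IsHenkin H) : φ.imp ψ ∈ H ↔ (φ ∈ H → ψ ∈ H) := by
  refine ⟨fun h h' => hH.mem_of_derives (.impE (.hyp h) (.hyp h')), fun h => ?_⟩
  refine hH.mem_of_derives (.impI ?_)
  rcases hH.maximal φ with h' | h'
  · exact .hyp (.inr (h h'))
  · exact h'.exFalso

theorem bot_notMem (hH : IsHenkin H) : (⊥ : LSet.Formula ℕ) ∉ H :=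
  fun h => hH.consistent (.hyp h)

theorem not_mem (hH : IsHenkin H) : φ.not ∈ H ↔ φ ∉ H := by
  rw [show φ.not = φ.imp ⊥ from rfl, hH.imp_mem]
  simp [hH.bot_notMem]

/-- The direction from instances to the universal formula is the one that needs witnesses. -/
theorem all_mem (hH : IsHenkin H) {χ : LSet.BoundedFormula ℕ 1} :
    χ.all ∈ H ↔ ∀ x, inst χ (Term.var x) ∈ H := by
  refine ⟨fun h x => hH.mem_of_derives (.allE _ (.hyp h)), fun h => ?_⟩
  by_contra h'
  obtain ⟨x, hx⟩ := hH.witness χ (hH.not_mem.2 h')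
  exact hH.not_mem.1 hx (h x)

theorem inst_mem (hH : IsHenkin H) {x y : ℕ}
    (h : (Term.var x : LSet.Term ℕ).equal (Term.var y) ∈ H) (χ : LSet.BoundedFormula ℕ 1)
    (hx : ren (instRen id x) χ ∈ H) : ren (instRen id y) χ ∈ H := by
  rw [← inst_var] at hx ⊢
  exact hH.mem_of_derives (.eqSubst (.hyp h) (.hyp hx))

/-- Provable equality of variables. -/
def setoid (hH : IsHenkin H) : Setoid ℕ where
  r x y := (Term.var x : LSet.Term ℕ).equal (Term.var y) ∈ H
  iseqv := by
    have symm : ∀ {x y : ℕ}, (Term.var x : LSet.Term ℕ).equal (Term.var y) ∈ H →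
        (Term.var y : LSet.Term ℕ).equal (Term.var x) ∈ H := fun {x y} h =>
      hH.inst_mem h (.equal (.var (.inr 0)) (.var (.inl x)))
        (hH.mem_of_derives (.eqRefl (Term.var x)) : (Term.var x : LSet.Term ℕ).equal (.var x) ∈ H)
    exact ⟨fun x => hH.mem_of_derives (.eqRefl _), symm, fun {x y z} h h' =>
      hH.inst_mem h' (.equal (.var (.inl x)) (.var (.inr 0))) h⟩

/-- The model whose elements are the variables up to provable equality. -/
def Carrier (hH : IsHenkin H) : Type := Quotient hH.setoid

/-- The element of the model given by a variable. -/
def ofVar (hH : IsHenkin H) (x : ℕ) : hH.Carrier := Quotient.mk _ x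

/-- A variable that gives an element of the model. -/
noncomputable def out (hH : IsHenkin H) (a : hH.Carrier) : ℕ := Quotient.out a

theorem ofVar_eq_ofVar (hH : IsHenkin H) {x y : ℕ} : hH.ofVar x = hH.ofVar y ↔ hH.setoid x y :=
  Quotient.eq (r := hH.setoid)

theorem ofVar_surjective (hH : IsHenkin H) : Function.Surjective hH.ofVar := Quotient.mk_surjective

theorem out_ofVar (hH : IsHenkin H) (x : ℕ) : hH.setoid (hH.out (hH.ofVar x)) x :=
  Quotient.mk_out (s := hH.setoid) _

instance (hH : IsHenkin H) : Nonempty hH.Carrier := ⟨hH.ofVar 0⟩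

noncomputable instance instStructure (hH : IsHenkin H) : LSet.Structure hH.Carrier where
  funMap f := Empty.elim f
  RelMap R xs := R.formula (fun i => Term.var (hH.out (xs i))) ∈ H

theorem rel_mem_congr (hH : IsHenkin H) {l : ℕ} (R : LSet.Relations l) {x y : Fin l → ℕ}
    (h : ∀ i, hH.setoid (x i) (y i)) (hx : R.formula (fun i => Term.var (x i)) ∈ H) :
    R.formula (fun i => Term.var (y i)) ∈ H := by
  -- Both relation symbols are binary, so the two arguments are replaced one after the other by
  -- `eqSubst`.
  have h2 : ∀ (R : LSet.Relations 2) (x y : Fin 2 → ℕ), (∀ i, hH.setoid (x i) (y i)) →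
      R.formula (fun i => Term.var (x i)) ∈ H → R.formula (fun i => Term.var (y i)) ∈ H := by
    intro R x y h hx
    have h₁ := hH.inst_mem (h 0) (.rel R ![.var (.inr 0), .var (.inl (x 1))]) (by
      convert hx using 1
      simp only [ren, Relations.formula, Relations.boundedFormula]
      congr 1
      funext i
      fin_cases i <;> rfl)
    have h₂ := hH.inst_mem (h 1) (.rel R ![.var (.inl (y 0)), .var (.inr 0)]) (by
      convert h₁ using 1
      simp only [ren]
      congr 1
      funext i
      fin_cases i <;> rfl)
    convert h₂ using 1
    simp only [ren, Relations.formula, Relations.boundedFormula]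
    congr 1
    funext i
    fin_cases i <;> rfl
  cases R
  · exact h2 SetRel.mem x y h hx
  · exact h2 SetRel.le x y h hx

/-- The truth lemma. Since `ρ` also gives values to bound variables, the induction passes through
quantifiers without substitution. -/
theorem realize_iff (hH : IsHenkin H) {n : ℕ} (φ : LSet.BoundedFormula ℕ n) (ρ : ℕ ⊕ Fin n → ℕ) :
    φ.Realize (fun x => hH.ofVar (ρ (.inl x))) (fun i => hH.ofVar (ρ (.inr i))) ↔
      ren (m := 0) (Sum.inl ∘ ρ) φ ∈ H := by
  have hρ : ∀ {n : ℕ} (ρ : ℕ ⊕ Fin n → ℕ) (a : ℕ ⊕ Fin n),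
      Sum.elim (fun x => hH.ofVar (ρ (.inl x))) (fun i => hH.ofVar (ρ (.inr i))) a = hH.ofVar (ρ a) := by
    intro n ρ a
    rcases a with a | a <;> rfl
  induction φ with
  | falsum => exact ⟨False.elim, hH.bot_notMem⟩
  | equal s t =>
    obtain ⟨x, rfl⟩ := exists_eq_var s
    obtain ⟨y, rfl⟩ := exists_eq_var t
    simp only [BoundedFormula.Realize, Term.realize_var, hρ]
    exact hH.ofVar_eq_ofVar
  | rel R ts =>
    choose x hx using fun i => exists_eq_var (ts i)
    obtain rfl : ts = fun i => Term.var (x i) := funext hx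
    simp only [BoundedFormula.Realize, Term.realize_var, hρ]
    exact ⟨hH.rel_mem_congr R fun i => hH.out_ofVar _,
      hH.rel_mem_congr R fun i => hH.setoid.symm (hH.out_ofVar _)⟩
  | imp _ _ ih₁ ih₂ =>
    exact (imp_congr (ih₁ ρ) (ih₂ ρ)).trans hH.imp_mem.symm
  | @all n φ ih =>
    rw [BoundedFormula.realize_all, ren]
    refine Iff.trans ?_ hH.all_mem.symm
    -- Every element of the model is named by a variable, so a quantifier over the model is a
    -- quantifier over variables.
    refine hH.ofVar_surjective.forall.trans (forall_congr' fun x => ?_)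
    have := ih (Sum.elim (fun a => ρ (.inl a)) (Fin.snoc (fun i => ρ (.inr i)) x))
    rw [inst_var, ren_ren]
    refine Iff.trans (iff_of_eq ?_) (this.trans (iff_of_eq ?_))
    · congr 1
      funext i
      refine Fin.lastCases ?_ (fun i => ?_) i <;> simp
    · congr 2
      funext a
      rcases a with a | i
      · rfl
      · refine Fin.lastCases ?_ (fun i => ?_) i <;> simp

end IsHenkin

/-- **Completeness**: a sentence that holds in all models of a theory is provable. -/
theorem provable_of_forall_model {T : LSet.Theory} {φ : LSet.Sentence}
    (h : ∀ (M : Type) [LSet.Structure M] [Nonempty M], M ⊨ T → M ⊨ φ) : Provable T φ := by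
  by_contra hφ
  have hsent : ∀ ψ : LSet.Sentence, VarsBelow 0 (Formula.relabel (Empty.elim : Empty → ℕ) ψ) := by
    intro ψ β m ρ σ h₁ _
    rw [formula_relabel_eq_ren, ren_ren, ren_ren]
    congr 1
    funext a
    rcases a with a | a
    · exact a.elim
    · exact h₁ a
  obtain ⟨H, hTH, hH⟩ := Extendable.exists_isHenkin
    (Γ := insert (Formula.relabel (Empty.elim : Empty → ℕ) φ).not
      (Formula.relabel (Empty.elim : Empty → ℕ) '' T))
    ⟨fun hd => hφ (.raa hd), 0, by
      rintro ψ (rfl | ⟨ψ, -, rfl⟩)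
      · exact hsent φ.not
      · exact hsent ψ⟩
  have key : ∀ ψ : LSet.Sentence, hH.Carrier ⊨ ψ ↔
      Formula.relabel (Empty.elim : Empty → ℕ) ψ ∈ H := by
    intro ψ
    have h₁ := hH.realize_iff (Formula.relabel (Empty.elim : Empty → ℕ) ψ)
      (Sum.elim id fun _ => 0)
    rw [hsent ψ (Sum.inl ∘ (Sum.elim id fun _ => 0)) id (fun i => i.elim0) (by simp),
      show ren (id : ℕ ⊕ Fin 0 → ℕ ⊕ Fin 0) (Formula.relabel (Empty.elim : Empty → ℕ) ψ) =
        Formula.relabel (Empty.elim : Empty → ℕ) ψ by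
          rw [formula_relabel_eq_ren, ren_ren]; rfl] at h₁
    rw [← h₁, Formula.boundedFormula_realize_eq_realize, Formula.realize_relabel, Sentence.Realize]
    exact iff_of_eq (congrArg _ (Subsingleton.elim _ _))
  refine hH.not_mem.1 (hTH (.inl rfl)) ((key φ).1 (h hH.Carrier ?_))
  refine ⟨fun ψ hψ => (key ψ).2 (hTH (.inr ⟨ψ, hψ, rfl⟩))⟩

end Completeness

/-! ### Truth of scoped formulas in a structure. -/

section Semantics

variable {M : Type} [LSet.Structure M]

/-- Membership in a structure for `LSet`. -/
def E (x y : M) : Prop := Structure.RelMap memSym ![x, y]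

/-- The global order in a structure for `LSet`. -/
def LEγ (x y : M) : Prop := Structure.RelMap leSym ![x, y]

infix:60 " ∈' " => E
infix:60 " ≤' " => LEγ

/-- The formula `φ` in scope `n` holds when the variable `i` takes the value `v i`. -/
def Fm.Holds (φ : Fm) (n : ℕ) (v : ℕ → M) : Prop :=
  (φ n).Realize (default : Empty → M) fun i : Fin n => v i

namespace Fm

variable {n x y : ℕ} {v : ℕ → M} {φ ψ : Fm}

theorem holds_atom {R : LSet.Relations 2} (hx : x < n) (hy : y < n) :
    (atom R x y).Holds n v ↔ Structure.RelMap R ![v x, v y] := by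
  simp [Holds, atom, hx, hy]

@[simp] theorem holds_mem (hx : x < n) (hy : y < n) : (x ∈ₛ y).Holds n v ↔ v x ∈' v y :=
  holds_atom hx hy

@[simp] theorem holds_le (hx : x < n) (hy : y < n) : (x ≤γ y).Holds n v ↔ v x ≤' v y :=
  holds_atom hx hy

@[simp] theorem holds_eq (hx : x < n) (hy : y < n) : (x =ₛ y).Holds n v ↔ v x = v y := by
  simp [Holds, eq, hx, hy]

@[simp] theorem holds_neg : (¬ₛ φ).Holds n v ↔ ¬ φ.Holds n v := Iff.rfl

@[simp] theorem holds_imp : (φ →ₛ ψ).Holds n v ↔ (φ.Holds n v → ψ.Holds n v) := Iff.rfl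

@[simp] theorem holds_and : (φ ∧ₛ ψ).Holds n v ↔ φ.Holds n v ∧ ψ.Holds n v :=
  BoundedFormula.realize_inf

@[simp] theorem holds_or : (φ ∨ₛ ψ).Holds n v ↔ φ.Holds n v ∨ ψ.Holds n v :=
  BoundedFormula.realize_sup

@[simp] theorem holds_iff : (φ ↔ₛ ψ).Holds n v ↔ (φ.Holds n v ↔ ψ.Holds n v) :=
  BoundedFormula.realize_iff

omit [LSet.Structure M] in
-- Valuations are total functions on `ℕ`, so a quantifier in scope `n` updates the value at `n`; no
-- dependent tuples are needed afterwards.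
theorem snoc_eq_update (a : M) :
    (Fin.snoc (fun i : Fin n => v i) a : Fin (n + 1) → M) =
      fun i : Fin (n + 1) => Function.update v n a i := by
  funext i
  refine Fin.lastCases ?_ (fun i => ?_) i
  · simp
  · simp [Function.update_of_ne i.2.ne]

@[simp] theorem holds_all {φ : ℕ → Fm} :
    (all φ).Holds n v ↔ ∀ a, (φ n).Holds (n + 1) (Function.update v n a) := by
  simp [Holds, all, snoc_eq_update]

@[simp] theorem holds_ex {φ : ℕ → Fm} :
    (ex φ).Holds n v ↔ ∃ a, (φ n).Holds (n + 1) (Function.update v n a) := by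
  simp [Holds, ex, snoc_eq_update]

theorem holds_app {k : ℕ} {φ : LSet.Formula (Fin k)} {σ : Fin k → ℕ} (h : ∀ i, σ i < n) :
    (app φ σ).Holds n v ↔ φ.Realize fun i => v (σ i) := by
  simp only [Holds, app, h, implies_true, dif_pos]
  refine BoundedFormula.realize_relabel.trans (iff_of_eq ?_)
  rw [Formula.Realize]
  congr 1
  exact Subsingleton.elim _ _

theorem realize_closure [Nonempty M] : M ⊨ closure n φ ↔ ∀ v : ℕ → M, φ.Holds n v := by
  rw [closure, Sentence.Realize, BoundedFormula.realize_alls]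
  refine ⟨fun h v => h _, fun h xs => ?_⟩
  have := h fun i => if hi : i < n then xs ⟨i, hi⟩ else Classical.arbitrary M
  simpa only [Holds, Fin.is_lt, dif_pos] using this

theorem realize_sentence (v : ℕ → M) : M ⊨ sentence φ ↔ φ.Holds 0 v := by
  rw [Sentence.Realize, Formula.Realize, sentence, Holds]
  exact iff_of_eq (congrArg _ (Subsingleton.elim _ _))

@[simp] theorem holds_allIn {φ : ℕ → Fm} (hx : x < n) :
    (allIn x φ).Holds n v ↔ ∀ a, a ∈' v x → (φ n).Holds (n + 1) (Function.update v n a) := by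
  simp (disch := omega) [allIn, holds_all, holds_imp, holds_mem, Function.update_of_ne]

@[simp] theorem holds_exIn {φ : ℕ → Fm} (hx : x < n) :
    (exIn x φ).Holds n v ↔ ∃ a, a ∈' v x ∧ (φ n).Holds (n + 1) (Function.update v n a) := by
  simp (disch := omega) [exIn, holds_ex, holds_and, holds_mem, Function.update_of_ne]

@[simp] theorem holds_exUnique {φ : ℕ → Fm} : (exUnique φ).Holds n v ↔
    ∃ a, (φ n).Holds (n + 1) (Function.update v n a) ∧ ∀ b,
      (φ (n + 1)).Holds (n + 2) (Function.update (Function.update v n a) (n + 1) b) → b = a := by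
  simp (disch := omega) [exUnique, Function.update_of_ne]

end Fm

end Semantics

/-! ### Predicates and functions definable with parameters. -/

section Definability

variable {M : Type} [LSet.Structure M]

/-- Types of tuples of elements of `M`, built from `M` by `Γ ↦ Γ × M`. -/
class Ctx (Γ : Type) (M : outParam Type) where
  /-- The components of a tuple, the last one first. -/
  enc : Γ → ℕ → M

/-- Indices past the end of a tuple read its first component, so `enc` is total and no length has to
be carried along. -/
instance : Ctx M M := ⟨fun x _ => x⟩
instance {Γ : Type} [Ctx Γ M] : Ctx (Γ × M) M := ⟨fun w n => n.casesOn w.2 fun k => Ctx.enc w.1 k⟩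

variable {Γ Δ : Type} [Ctx Γ M] [Ctx Δ M]

/-- The predicate `P` is definable with parameters. -/
class D (P : Γ → Prop) : Prop where
  out : ∃ φ : LSet.Formula (M ⊕ ℕ), ∀ w, P w ↔ φ.Realize (Sum.elim id (Ctx.enc w))

/-- The function `f` is definable with parameters. -/
class DF (f : Γ → M) : Prop where
  out : D fun w : Γ × M => w.2 = f w.1

/-- The components of `F w` are components of `w`. -/
class VarMap (F : Γ → Δ) : Prop where
  out : ∃ r : ℕ → ℕ, ∀ w i, Ctx.enc (F w) i = Ctx.enc w (r i)

theorem D.congr {P Q : Γ → Prop} (hP : D P) (h : ∀ w, Q w ↔ P w) : D Q := by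
  rwa [show Q = P from funext fun w => propext (h w)]

instance VarMap.id : VarMap fun w : Γ => w := ⟨fun i => i, fun _ _ => rfl⟩

instance VarMap.fst (F : Γ → Δ × M) [h : VarMap F] : VarMap fun w => (F w).1 := by
  obtain ⟨r, hr⟩ := h.out
  exact ⟨fun i => r (i + 1), fun w i => hr w (i + 1)⟩

omit [LSet.Structure M] in
theorem VarMap.exists_snd (F : Γ → Δ × M) [h : VarMap F] : ∃ i, ∀ w, (F w).2 = Ctx.enc w i := by
  obtain ⟨r, hr⟩ := h.out
  exact ⟨r 0, fun w => hr w 0⟩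

instance VarMap.snd (F : Γ → Δ × M) [VarMap F] : VarMap fun w => (F w).2 := by
  obtain ⟨i, hi⟩ := VarMap.exists_snd F
  exact ⟨fun _ => i, fun w _ => hi w⟩

instance VarMap.prod (F : Γ → Δ) (g : Γ → M) [hF : VarMap F] [hg : VarMap g] :
    VarMap fun w => (F w, g w) := by
  obtain ⟨r, hr⟩ := hF.out
  obtain ⟨s, hs⟩ := hg.out
  refine ⟨fun i => i.casesOn (s 0) r, fun w i => ?_⟩
  rcases i with _ | i
  · exact hs w 0
  · exact hr w i

theorem D.comp_varMap {P : Δ → Prop} (hP : D P) (F : Γ → Δ) [hF : VarMap F] :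
    D fun w => P (F w) := by
  obtain ⟨φ, hφ⟩ := hP.out
  obtain ⟨r, hr⟩ := hF.out
  refine ⟨φ.relabel (Sum.map id r), fun w => ?_⟩
  rw [hφ, Formula.realize_relabel]
  refine iff_of_eq (congrArg _ (funext fun a => ?_))
  rcases a with a | a
  · rfl
  · exact hr w a

instance D.not (P : Γ → Prop) [h : D P] : D fun w => ¬ P w := by
  obtain ⟨φ, hφ⟩ := h.out
  exact ⟨φ.not, fun w => by rw [hφ, Formula.realize_not]⟩

instance D.imp (P Q : Γ → Prop) [h : D P] [h' : D Q] : D fun w => P w → Q w := by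
  obtain ⟨φ, hφ⟩ := h.out
  obtain ⟨ψ, hψ⟩ := h'.out
  exact ⟨φ.imp ψ, fun w => by rw [hφ, hψ, Formula.realize_imp]⟩

instance D.and (P Q : Γ → Prop) [h : D P] [h' : D Q] : D fun w => P w ∧ Q w := by
  obtain ⟨φ, hφ⟩ := h.out
  obtain ⟨ψ, hψ⟩ := h'.out
  exact ⟨φ ⊓ ψ, fun w => by rw [hφ, hψ, Formula.realize_inf]⟩

instance D.or (P Q : Γ → Prop) [h : D P] [h' : D Q] : D fun w => P w ∨ Q w := by
  obtain ⟨φ, hφ⟩ := h.out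
  obtain ⟨ψ, hψ⟩ := h'.out
  exact ⟨φ ⊔ ψ, fun w => by rw [hφ, hψ, Formula.realize_sup]⟩

instance D.iff (P Q : Γ → Prop) [h : D P] [h' : D Q] : D fun w => P w ↔ Q w := by
  obtain ⟨φ, hφ⟩ := h.out
  obtain ⟨ψ, hψ⟩ := h'.out
  exact ⟨φ.iff ψ, fun w => by rw [hφ, hψ, Formula.realize_iff]⟩

instance D.all (P : Γ → M → Prop) [h : D fun w : Γ × M => P w.1 w.2] : D fun w => ∀ x, P w x := by
  obtain ⟨φ, hφ⟩ := h.out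
  -- Component `0` of the extended tuple becomes the bound variable; component `k + 1` becomes the
  -- free variable `k`.
  refine ⟨(BoundedFormula.relabel (n := 1) (k := 0) (Sum.elim (fun c => Sum.inl (Sum.inl c))
    fun i : ℕ => i.casesOn (Sum.inr 0) fun k => Sum.inl (Sum.inr k)) φ :
      LSet.BoundedFormula (M ⊕ ℕ) 1).all, fun w => ?_⟩
  rw [Formula.Realize, BoundedFormula.realize_all]
  refine forall_congr' fun x => (hφ (w, x)).trans ?_
  rw [Formula.Realize]
  refine Iff.trans (iff_of_eq ?_) BoundedFormula.realize_relabel.symm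
  congr 1
  · funext a
    rcases a with a | _ | a
    · rfl
    · rfl
    · rfl
  · exact Subsingleton.elim _ _

instance D.ex (P : Γ → M → Prop) [h : D fun w : Γ × M => P w.1 w.2] : D fun w => ∃ x, P w x :=
  (inferInstance : D fun w => ¬ ∀ x, ¬ P w x).congr fun w => by simp

theorem D.eq_vars (f g : Γ → M) [hf : VarMap f] [hg : VarMap g] : D fun w => f w = g w := by
  obtain ⟨r, hr⟩ := hf.out
  obtain ⟨s, hs⟩ := hg.out
  refine ⟨(Term.var (.inr (r 0))).equal (Term.var (.inr (s 0))), fun w => ?_⟩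
  rw [Formula.realize_equal]
  exact iff_of_eq (congrArg₂ _ (hr w 0) (hs w 0))

theorem D.rel_vars (R : LSet.Relations 2) (f g : Γ → M) [hf : VarMap f] [hg : VarMap g] :
    D fun w => Structure.RelMap R ![f w, g w] := by
  obtain ⟨r, hr⟩ := hf.out
  obtain ⟨s, hs⟩ := hg.out
  refine ⟨R.formula₂ (Term.var (.inr (r 0))) (Term.var (.inr (s 0))), fun w => ?_⟩
  rw [Formula.realize_rel₂]
  exact iff_of_eq (congrArg _ (congrArg₂ (fun a b => ![a, b]) (hr w 0) (hs w 0)))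

instance DF.const (c : M) : DF fun _ : Γ => c :=
  ⟨⟨(Term.var (.inr 0)).equal (Term.var (.inl c)), fun w => by
    rw [Formula.realize_equal]
    rfl⟩⟩

instance DF.var (f : Γ → M) [hf : VarMap f] : DF f := by
  obtain ⟨r, hr⟩ := hf.out
  refine ⟨⟨(Term.var (.inr 0)).equal (Term.var (.inr (r 0 + 1))), fun w => ?_⟩⟩
  rw [Formula.realize_equal]
  exact iff_of_eq (congrArg (w.2 = ·) (hr w.1 0))

/-- All the components of the map `F` are definable. -/
class DMap (F : Γ → Δ) : Prop where
  out : ∀ i, DF fun w => Ctx.enc (F w) i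

instance DMap.base (f : Γ → M) [h : DF f] : DMap f := ⟨fun _ => h⟩

instance DMap.prod (F : Γ → Δ) (g : Γ → M) [hF : DMap F] [hg : DF g] :
    DMap fun w => (F w, g w) := by
  refine ⟨fun i => ?_⟩
  rcases i with _ | i
  · exact hg
  · exact hF.out i

/-- Definable functions are not terms, so they cannot be substituted. The formula says instead that
there are values for the finitely many free variables of `φ` which satisfy the graphs and `φ`. -/
theorem D.comp {P : Δ → Prop} (h : D P) (F : Γ → Δ) [hF : DMap F] : D fun w => P (F w) := by
  classical
  obtain ⟨φ, hφ⟩ := h.out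
  choose γ hγ using fun i => (hF.out i).out.out
  let θ : φ.freeVarFinset → LSet.Formula ((M ⊕ ℕ) ⊕ φ.freeVarFinset) := fun a =>
    Sum.elim (fun c => (Term.var (.inr a)).equal (Term.var (.inl (.inl c))))
      (fun i => (γ i).relabel (Sum.elim (fun c => .inl (.inl c))
        fun k : ℕ => k.casesOn (.inr a) fun k => .inl (.inr k))) a.1
  have hθ : ∀ (a : φ.freeVarFinset) (w : Γ) (x : φ.freeVarFinset → M),
      (θ a).Realize (Sum.elim (Sum.elim id (Ctx.enc w)) x) ↔
        x a = Sum.elim id (Ctx.enc (F w)) a.1 := by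
    rintro ⟨a | i, ha⟩ w x
    · simp [θ, Formula.realize_equal]
    · refine Iff.trans ?_ (hγ i (w, x ⟨.inr i, ha⟩)).symm
      simp only [θ, Sum.elim_inr, Formula.realize_relabel]
      refine iff_of_eq (congrArg _ (funext fun b => ?_))
      rcases b with b | _ | b <;> rfl
  refine ⟨Formula.iExs φ.freeVarFinset (Formula.relabel Sum.inr (φ.restrictFreeVar id) ⊓
    BoundedFormula.iInf θ), fun w => ?_⟩
  have hres : ∀ x : φ.freeVarFinset → M, (∀ a, x a = Sum.elim id (Ctx.enc (F w)) a.1) →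
      (Formula.Realize (φ.restrictFreeVar id) x ↔ P (F w)) := fun x hx =>
    (BoundedFormula.realize_restrictFreeVar _ hx).trans (hφ (F w)).symm
  rw [Formula.realize_iExs]
  constructor
  · intro hP
    refine ⟨fun a => Sum.elim id (Ctx.enc (F w)) a.1, ?_⟩
    rw [Formula.realize_inf, Formula.realize_relabel]
    refine ⟨(hres _ fun a => rfl).2 hP, ?_⟩
    exact BoundedFormula.realize_iInf.2 fun a => (hθ a w _).2 rfl
  · rintro ⟨x, hx⟩
    rw [Formula.realize_inf, Formula.realize_relabel] at hx
    exact (hres x fun a => (hθ a w x).1 (BoundedFormula.realize_iInf.1 hx.2 a)).1 hx.1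

theorem DF.of_graph {f : Γ → M} {Q : Γ → M → Prop} (h : ∀ w y, y = f w ↔ Q w y)
    [hQ : D fun w : Γ × M => Q w.1 w.2] : DF f :=
  ⟨hQ.congr fun w => h w.1 w.2⟩

theorem DF.comp {F : Δ → M} (h : DF F) (G : Γ → Δ) [hG : DMap G] : DF fun w => F (G w) := by
  have : DMap fun w : Γ × M => (G w.1, w.2) := by
    refine ⟨fun i => ?_⟩
    rcases i with _ | i
    · exact inferInstanceAs (DF fun w : Γ × M => w.2)
    · exact ⟨(hG.out i).out.comp_varMap fun w : (Γ × M) × M => (w.1.1, w.2)⟩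
  exact ⟨h.out.comp fun w : Γ × M => (G w.1, w.2)⟩

theorem DF.comp_varMap {f : Δ → M} (hf : DF f) (F : Γ → Δ) [VarMap F] : DF fun w => f (F w) := by
  have : DMap F := ⟨fun i => by
    obtain ⟨r, hr⟩ := ‹VarMap F›.out
    have : VarMap fun w => Ctx.enc (F w) i := ⟨fun _ => r i, fun w _ => hr w i⟩
    infer_instance⟩
  exact hf.comp F

instance D.eq (f g : Γ → M) [DF f] [DF g] : D fun w => f w = g w :=
  D.comp (P := fun w : M × M => w.1 = w.2) (D.eq_vars _ _) fun w => (f w, g w)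

instance D.mem (f g : Γ → M) [DF f] [DF g] : D fun w => f w ∈' g w :=
  D.comp (P := fun w : M × M => w.1 ∈' w.2) (D.rel_vars memSym _ _) fun w => (f w, g w)

instance D.le (f g : Γ → M) [DF f] [DF g] : D fun w => f w ≤' g w :=
  D.comp (P := fun w : M × M => w.1 ≤' w.2) (D.rel_vars leSym _ _) fun w => (f w, g w)

instance D.existsUnique (P : Γ → M → Prop) [h : D fun w : Γ × M => P w.1 w.2] :
    D fun w => ∃! x, P w x := by
  have := h.comp_varMap fun w : (Γ × M) × M => (w.1.1, w.2)
  exact inferInstanceAs (D fun w => ∃ x, P w x ∧ ∀ y, P w y → y = x)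

end Definability

set_option synthInstance.maxSize 1000000000000
set_option synthInstance.maxHeartbeats 4000000
set_option maxHeartbeats 4000000

/-! ### The notions of set theory and algebraic geometry in a model -/

namespace Model

variable {M : Type} [LSet.Structure M] {Γ : Type} [Ctx Γ M] {k : ℕ} {ν : ℕ → M}

/-- The interpretation of `ZFG.Sub` in a model. -/
def Sub (x y : M) : Prop :=
  ∀ z, z ∈' x → z ∈' y

@[simp] theorem holds_Sub {x y : ℕ} (h1 : x < k) (h2 : y < k) : (ZFG.Sub x y).Holds k ν ↔ Sub
    (ν x) (ν y) := by
  simp (disch := omega) [ZFG.Sub, Sub]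

instance D_Sub (f1 f2 : Γ → M) [DF f1] [DF f2] : D fun w => Sub (f1 w) (f2 w) :=
  D.comp (P := fun w : M × M => Sub w.1 w.2)
    (by unfold Sub; infer_instance) fun w => (f1 w, f2 w)

/-- The interpretation of `ZFG.IsEmptySet` in a model. -/
def IsEmptySet (x : M) : Prop :=
  ∀ z, ¬ z ∈' x

@[simp] theorem holds_IsEmptySet {x : ℕ} (h1 : x < k) : (ZFG.IsEmptySet x).Holds k ν ↔ IsEmptySet
    (ν x) := by
  simp (disch := omega) [ZFG.IsEmptySet, IsEmptySet]

instance D_IsEmptySet (f1 : Γ → M) [DF f1] : D fun w => IsEmptySet (f1 w) :=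
  D.comp (P := fun w : M => IsEmptySet w)
    (by unfold IsEmptySet; infer_instance) fun w => f1 w

/-- The interpretation of `ZFG.IsUPair` in a model. -/
def IsUPair (u x y : M) : Prop :=
  ∀ z, z ∈' u ↔ (z = x ∨ z = y)

@[simp] theorem holds_IsUPair {u x y : ℕ} (h1 : u < k) (h2 : x < k) (h3 : y < k) :
    (ZFG.IsUPair u x y).Holds k ν ↔ IsUPair (ν u) (ν x) (ν y) := by
  simp (disch := omega) [ZFG.IsUPair, IsUPair]

instance D_IsUPair (f1 f2 f3 : Γ → M) [DF f1] [DF f2] [DF f3] : D fun w => IsUPair (f1 w) (f2 w)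
    (f3 w) :=
  D.comp (P := fun w : (M × M) × M => IsUPair w.1.1 w.1.2 w.2)
    (by unfold IsUPair; infer_instance) fun w => ((f1 w, f2 w), f3 w)

/-- The interpretation of `ZFG.IsPair` in a model. -/
def IsPair (p x y : M) : Prop :=
  ∃ u v, IsUPair u x x ∧ IsUPair v x y ∧ IsUPair p u v

@[simp] theorem holds_IsPair {p x y : ℕ} (h1 : p < k) (h2 : x < k) (h3 : y < k) :
    (ZFG.IsPair p x y).Holds k ν ↔ IsPair (ν p) (ν x) (ν y) := by
  simp (disch := omega) [ZFG.IsPair, IsPair]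

instance D_IsPair (f1 f2 f3 : Γ → M) [DF f1] [DF f2] [DF f3] : D fun w => IsPair (f1 w) (f2 w)
    (f3 w) :=
  D.comp (P := fun w : (M × M) × M => IsPair w.1.1 w.1.2 w.2)
    (by unfold IsPair; infer_instance) fun w => ((f1 w, f2 w), f3 w)

/-- The interpretation of `ZFG.IsUnion` in a model. -/
def IsUnion (u c : M) : Prop :=
  ∀ z, z ∈' u ↔ ∃ v, v ∈' c ∧ z ∈' v

@[simp] theorem holds_IsUnion {u c : ℕ} (h1 : u < k) (h2 : c < k) : (ZFG.IsUnion u c).Holds k ν ↔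
    IsUnion (ν u) (ν c) := by
  simp (disch := omega) [ZFG.IsUnion, IsUnion]

instance D_IsUnion (f1 f2 : Γ → M) [DF f1] [DF f2] : D fun w => IsUnion (f1 w) (f2 w) :=
  D.comp (P := fun w : M × M => IsUnion w.1 w.2)
    (by unfold IsUnion; infer_instance) fun w => (f1 w, f2 w)

/-- The interpretation of `ZFG.IsInter` in a model. -/
def IsInter (w u v : M) : Prop :=
  ∀ z, z ∈' w ↔ (z ∈' u ∧ z ∈' v)

@[simp] theorem holds_IsInter {w u v : ℕ} (h1 : w < k) (h2 : u < k) (h3 : v < k) :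
    (ZFG.IsInter w u v).Holds k ν ↔ IsInter (ν w) (ν u) (ν v) := by
  simp (disch := omega) [ZFG.IsInter, IsInter]

instance D_IsInter (f1 f2 f3 : Γ → M) [DF f1] [DF f2] [DF f3] : D fun w => IsInter (f1 w) (f2 w)
    (f3 w) :=
  D.comp (P := fun w : (M × M) × M => IsInter w.1.1 w.1.2 w.2)
    (by unfold IsInter; infer_instance) fun w => ((f1 w, f2 w), f3 w)

/-- The interpretation of `ZFG.IsSucc` in a model. -/
def IsSucc (y x : M) : Prop :=
  ∀ z, z ∈' y ↔ (z ∈' x ∨ z = x)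

@[simp] theorem holds_IsSucc {y x : ℕ} (h1 : y < k) (h2 : x < k) : (ZFG.IsSucc y x).Holds k ν ↔
    IsSucc (ν y) (ν x) := by
  simp (disch := omega) [ZFG.IsSucc, IsSucc]

instance D_IsSucc (f1 f2 : Γ → M) [DF f1] [DF f2] : D fun w => IsSucc (f1 w) (f2 w) :=
  D.comp (P := fun w : M × M => IsSucc w.1 w.2)
    (by unfold IsSucc; infer_instance) fun w => (f1 w, f2 w)

/-- The interpretation of `ZFG.IsInductive` in a model. -/
def IsInductive (w : M) : Prop :=
  (∃ o, IsEmptySet o ∧ o ∈' w) ∧ ∀ x, x ∈' w → ∃ y, IsSucc y x ∧ y ∈' w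

@[simp] theorem holds_IsInductive {w : ℕ} (h1 : w < k) : (ZFG.IsInductive w).Holds k ν ↔
    IsInductive (ν w) := by
  simp (disch := omega) [ZFG.IsInductive, IsInductive]

instance D_IsInductive (f1 : Γ → M) [DF f1] : D fun w => IsInductive (f1 w) :=
  D.comp (P := fun w : M => IsInductive w)
    (by unfold IsInductive; infer_instance) fun w => f1 w

/-- The interpretation of `ZFG.Val` in a model. -/
def Val (f x y : M) : Prop :=
  ∃ p, p ∈' f ∧ IsPair p x y

@[simp] theorem holds_Val {f x y : ℕ} (h1 : f < k) (h2 : x < k) (h3 : y < k) :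
    (ZFG.Val f x y).Holds k ν ↔ Val (ν f) (ν x) (ν y) := by
  simp (disch := omega) [ZFG.Val, Val]

instance D_Val (f1 f2 f3 : Γ → M) [DF f1] [DF f2] [DF f3] : D fun w => Val (f1 w) (f2 w) (f3 w) :=
  D.comp (P := fun w : (M × M) × M => Val w.1.1 w.1.2 w.2)
    (by unfold Val; infer_instance) fun w => ((f1 w, f2 w), f3 w)

/-- The interpretation of `ZFG.IsFunOn` in a model. -/
def IsFunOn (f A : M) : Prop :=
  (∀ p, p ∈' f → ∃ x, x ∈' A ∧ ∃ y, IsPair p x y) ∧ ∀ x, x ∈' A → ∃! y, Val f x y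

@[simp] theorem holds_IsFunOn {f A : ℕ} (h1 : f < k) (h2 : A < k) : (ZFG.IsFunOn f A).Holds k ν ↔
    IsFunOn (ν f) (ν A) := by
  simp (disch := omega) [ZFG.IsFunOn, IsFunOn, ExistsUnique]

instance D_IsFunOn (f1 f2 : Γ → M) [DF f1] [DF f2] : D fun w => IsFunOn (f1 w) (f2 w) :=
  D.comp (P := fun w : M × M => IsFunOn w.1 w.2)
    (by unfold IsFunOn; infer_instance) fun w => (f1 w, f2 w)

/-- The interpretation of `ZFG.IsFun` in a model. -/
def IsFun (f A B : M) : Prop :=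
  IsFunOn f A ∧ ∀ x y, Val f x y → y ∈' B

@[simp] theorem holds_IsFun {f A B : ℕ} (h1 : f < k) (h2 : A < k) (h3 : B < k) :
    (ZFG.IsFun f A B).Holds k ν ↔ IsFun (ν f) (ν A) (ν B) := by
  simp (disch := omega) [ZFG.IsFun, IsFun]

/-- The interpretation of `ZFG.IsBij` in a model. -/
def IsBij (f A B : M) : Prop :=
  IsFun f A B ∧ ∀ y, y ∈' B → ∃! x, Val f x y

@[simp] theorem holds_IsBij {f A B : ℕ} (h1 : f < k) (h2 : A < k) (h3 : B < k) :
    (ZFG.IsBij f A B).Holds k ν ↔ IsBij (ν f) (ν A) (ν B) := by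
  simp (disch := omega) [ZFG.IsBij, IsBij, ExistsUnique]

/-- The interpretation of `ZFG.IsNat` in a model. -/
def IsNat (n : M) : Prop :=
  ∀ w, IsInductive w → n ∈' w

@[simp] theorem holds_IsNat {n : ℕ} (h1 : n < k) : (ZFG.IsNat n).Holds k ν ↔ IsNat (ν n) := by
  simp (disch := omega) [ZFG.IsNat, IsNat]

instance D_IsNat (f1 : Γ → M) [DF f1] : D fun w => IsNat (f1 w) :=
  D.comp (P := fun w : M => IsNat w)
    (by unfold IsNat; infer_instance) fun w => f1 w

/-- The interpretation of `ZFG.IsFinite` in a model. -/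
def IsFinite (A : M) : Prop :=
  ∃ n, IsNat n ∧ ∃ f, IsBij f n A

@[simp] theorem holds_IsFinite {A : ℕ} (h1 : A < k) : (ZFG.IsFinite A).Holds k ν ↔ IsFinite (ν A)
    := by
  simp (disch := omega) [ZFG.IsFinite, IsFinite]

/-- The interpretation of `ZFG.Op` in a model. -/
def Op (op x y z : M) : Prop :=
  ∃ p, IsPair p x y ∧ Val op p z

@[simp] theorem holds_Op {op x y z : ℕ} (h1 : op < k) (h2 : x < k) (h3 : y < k) (h4 : z < k) :
    (ZFG.Op op x y z).Holds k ν ↔ Op (ν op) (ν x) (ν y) (ν z) := by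
  simp (disch := omega) [ZFG.Op, Op]

instance D_Op (f1 f2 f3 f4 : Γ → M) [DF f1] [DF f2] [DF f3] [DF f4] : D fun w => Op (f1 w) (f2 w)
    (f3 w) (f4 w) :=
  D.comp (P := fun w : ((M × M) × M) × M => Op w.1.1.1 w.1.1.2 w.1.2 w.2)
    (by unfold Op; infer_instance) fun w => (((f1 w, f2 w), f3 w), f4 w)

/-- The interpretation of `ZFG.IsOp` in a model. -/
def IsOp (A op : M) : Prop :=
  (∀ q, q ∈' op → ∃ x, x ∈' A ∧ ∃ y, y ∈' A ∧ ∃ z, z ∈' A ∧ ∃ p, IsPair p x y ∧ IsPair q p z) ∧ ∀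
  x, x ∈' A → ∀ y, y ∈' A → ∃! z, Op op x y z

@[simp] theorem holds_IsOp {A op : ℕ} (h1 : A < k) (h2 : op < k) : (ZFG.IsOp A op).Holds k ν ↔
    IsOp (ν A) (ν op) := by
  simp (disch := omega) [ZFG.IsOp, IsOp, ExistsUnique]

/-- The interpretation of `ZFG.IsCommOp` in a model. -/
def IsCommOp (A op : M) : Prop :=
  ∀ x, x ∈' A → ∀ y, y ∈' A → ∀ z, Op op x y z → Op op y x z

@[simp] theorem holds_IsCommOp {A op : ℕ} (h1 : A < k) (h2 : op < k) : (ZFG.IsCommOp A op).Holds k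
    ν ↔ IsCommOp (ν A) (ν op) := by
  simp (disch := omega) [ZFG.IsCommOp, IsCommOp]

/-- The interpretation of `ZFG.IsAssocOp` in a model. -/
def IsAssocOp (A op : M) : Prop :=
  ∀ x, x ∈' A → ∀ y, y ∈' A → ∀ z, z ∈' A → ∀ u v, Op op x y u → Op op y z v → ∀ w, Op op u z w ↔
  Op op x v w

@[simp] theorem holds_IsAssocOp {A op : ℕ} (h1 : A < k) (h2 : op < k) : (ZFG.IsAssocOp A op).Holds
    k ν ↔ IsAssocOp (ν A) (ν op) := by
  simp (disch := omega) [ZFG.IsAssocOp, IsAssocOp]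

/-- The interpretation of `ZFG.IsUnitOf` in a model. -/
def IsUnitOf (A op e : M) : Prop :=
  e ∈' A ∧ ∀ x, x ∈' A → Op op e x x

@[simp] theorem holds_IsUnitOf {A op e : ℕ} (h1 : A < k) (h2 : op < k) (h3 : e < k) :
    (ZFG.IsUnitOf A op e).Holds k ν ↔ IsUnitOf (ν A) (ν op) (ν e) := by
  simp (disch := omega) [ZFG.IsUnitOf, IsUnitOf]

instance D_IsUnitOf (f1 f2 f3 : Γ → M) [DF f1] [DF f2] [DF f3] : D fun w => IsUnitOf (f1 w) (f2 w)
    (f3 w) :=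
  D.comp (P := fun w : (M × M) × M => IsUnitOf w.1.1 w.1.2 w.2)
    (by unfold IsUnitOf; infer_instance) fun w => ((f1 w, f2 w), f3 w)

/-- The interpretation of `ZFG.IsRing` in a model. -/
def IsRing (A a m : M) : Prop :=
  IsOp A a ∧ IsOp A m ∧ IsCommOp A a ∧ IsAssocOp A a ∧ (∃ o, IsUnitOf A a o ∧ ∀ x, x ∈' A → ∃ y, y
  ∈' A ∧ Op a x y o) ∧ IsCommOp A m ∧ IsAssocOp A m ∧ (∃ e, IsUnitOf A m e) ∧ ∀ x, x ∈' A → ∀ y, y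
  ∈' A → ∀ z, z ∈' A → ∀ s t u, Op a y z s → Op m x y t → Op m x z u → ∀ w, Op m x s w ↔ Op a t u
  w

@[simp] theorem holds_IsRing {A a m : ℕ} (h1 : A < k) (h2 : a < k) (h3 : m < k) :
    (ZFG.IsRing A a m).Holds k ν ↔ IsRing (ν A) (ν a) (ν m) := by
  simp (disch := omega) [ZFG.IsRing, IsRing]

/-- The interpretation of `ZFG.Preserves` in a model. -/
def Preserves (f op op' : M) : Prop :=
  ∀ x y z x' y' z', Op op x y z → Val f x x' → Val f y y' → Val f z z' → Op op' x' y' z'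

@[simp] theorem holds_Preserves {f op op' : ℕ} (h1 : f < k) (h2 : op < k) (h3 : op' < k) :
    (ZFG.Preserves f op op').Holds k ν ↔ Preserves (ν f) (ν op) (ν op') := by
  simp (disch := omega) [ZFG.Preserves, Preserves]

/-- The interpretation of `ZFG.IsRingHom` in a model. -/
def IsRingHom (A a m B b n f : M) : Prop :=
  IsFun f A B ∧ Preserves f a b ∧ Preserves f m n ∧ ∀ x y, IsUnitOf A m x → Val f x y → IsUnitOf B
  n y

@[simp] theorem holds_IsRingHom {A a m B b n f : ℕ} (h1 : A < k) (h2 : a < k) (h3 : m < k)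
    (h4 : B < k) (h5 : b < k) (h6 : n < k) (h7 : f < k) : (ZFG.IsRingHom A a m B b n f).Holds k ν
    ↔ IsRingHom (ν A) (ν a) (ν m) (ν B) (ν b) (ν n) (ν f) := by
  simp (disch := omega) [ZFG.IsRingHom, IsRingHom]

/-- The interpretation of `ZFG.IsIdeal` in a model. -/
def IsIdeal (A a m J : M) : Prop :=
  Sub J A ∧ (∃ o, IsUnitOf A a o ∧ o ∈' J) ∧ (∀ x, x ∈' J → ∀ y, y ∈' J → ∀ z, Op a x y z → z ∈'
  J) ∧ ∀ x, x ∈' A → ∀ y, y ∈' J → ∀ z, Op m x y z → z ∈' J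

@[simp] theorem holds_IsIdeal {A a m J : ℕ} (h1 : A < k) (h2 : a < k) (h3 : m < k) (h4 : J < k) :
    (ZFG.IsIdeal A a m J).Holds k ν ↔ IsIdeal (ν A) (ν a) (ν m) (ν J) := by
  simp (disch := omega) [ZFG.IsIdeal, IsIdeal]

instance D_IsIdeal (f1 f2 f3 f4 : Γ → M) [DF f1] [DF f2] [DF f3] [DF f4] : D fun w => IsIdeal
    (f1 w) (f2 w) (f3 w) (f4 w) :=
  D.comp (P := fun w : ((M × M) × M) × M => IsIdeal w.1.1.1 w.1.1.2 w.1.2 w.2)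
    (by unfold IsIdeal; infer_instance) fun w => (((f1 w, f2 w), f3 w), f4 w)

/-- The interpretation of `ZFG.IsPrimeIdeal` in a model. -/
def IsPrimeIdeal (A a m p : M) : Prop :=
  IsIdeal A a m p ∧ (∃ x, x ∈' A ∧ ¬ x ∈' p) ∧ ∀ x, x ∈' A → ∀ y, y ∈' A → ∀ z, z ∈' p → Op m x y
  z → (x ∈' p ∨ y ∈' p)

@[simp] theorem holds_IsPrimeIdeal {A a m p : ℕ} (h1 : A < k) (h2 : a < k) (h3 : m < k)
    (h4 : p < k) : (ZFG.IsPrimeIdeal A a m p).Holds k ν ↔ IsPrimeIdeal (ν A) (ν a) (ν m) (ν p) :=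
    by
  simp (disch := omega) [ZFG.IsPrimeIdeal, IsPrimeIdeal]

/-- The interpretation of `ZFG.IsFGIdeal` in a model. -/
def IsFGIdeal (A a m J : M) : Prop :=
  ∃ G, IsFinite G ∧ Sub G J ∧ ∀ K, IsIdeal A a m K → Sub G K → Sub J K

@[simp] theorem holds_IsFGIdeal {A a m J : ℕ} (h1 : A < k) (h2 : a < k) (h3 : m < k) (h4 : J < k)
    : (ZFG.IsFGIdeal A a m J).Holds k ν ↔ IsFGIdeal (ν A) (ν a) (ν m) (ν J) := by
  simp (disch := omega) [ZFG.IsFGIdeal, IsFGIdeal]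

/-- The interpretation of `ZFG.IsNoetherianRing` in a model. -/
def IsNoetherianRing (A a m : M) : Prop :=
  IsRing A a m ∧ ∀ J, IsIdeal A a m J → IsFGIdeal A a m J

@[simp] theorem holds_IsNoetherianRing {A a m : ℕ} (h1 : A < k) (h2 : a < k) (h3 : m < k) :
    (ZFG.IsNoetherianRing A a m).Holds k ν ↔ IsNoetherianRing (ν A) (ν a) (ν m) := by
  simp (disch := omega) [ZFG.IsNoetherianRing, IsNoetherianRing]

/-- The interpretation of `ZFG.IsPower` in a model. -/
def IsPower (A m f x : M) : Prop :=
  ∀ S, (∃ e, IsUnitOf A m e ∧ e ∈' S) → (∀ y, y ∈' S → ∀ z, Op m y f z → z ∈' S) → x ∈' S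

@[simp] theorem holds_IsPower {A m f x : ℕ} (h1 : A < k) (h2 : m < k) (h3 : f < k) (h4 : x < k) :
    (ZFG.IsPower A m f x).Holds k ν ↔ IsPower (ν A) (ν m) (ν f) (ν x) := by
  simp (disch := omega) [ZFG.IsPower, IsPower]

/-- The interpretation of `ZFG.IsSpace` in a model. -/
def IsSpace (P T : M) : Prop :=
  (∀ U, U ∈' T → Sub U P) ∧ P ∈' T ∧ (∀ C, Sub C T → ∃ U, U ∈' T ∧ IsUnion U C) ∧ ∀ U, U ∈' T → ∀
  V, V ∈' T → ∃ W, W ∈' T ∧ IsInter W U V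

@[simp] theorem holds_IsSpace {P T : ℕ} (h1 : P < k) (h2 : T < k) : (ZFG.IsSpace P T).Holds k ν ↔
    IsSpace (ν P) (ν T) := by
  simp (disch := omega) [ZFG.IsSpace, IsSpace]

/-- The interpretation of `ZFG.IsSection` in a model. -/
def IsSection (F U s : M) : Prop :=
  ∃ A, Val F U A ∧ s ∈' A

@[simp] theorem holds_IsSection {F U s : ℕ} (h1 : F < k) (h2 : U < k) (h3 : s < k) :
    (ZFG.IsSection F U s).Holds k ν ↔ IsSection (ν F) (ν U) (ν s) := by
  simp (disch := omega) [ZFG.IsSection, IsSection]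

instance D_IsSection (f1 f2 f3 : Γ → M) [DF f1] [DF f2] [DF f3] : D fun w => IsSection (f1 w)
    (f2 w) (f3 w) :=
  D.comp (P := fun w : (M × M) × M => IsSection w.1.1 w.1.2 w.2)
    (by unfold IsSection; infer_instance) fun w => ((f1 w, f2 w), f3 w)

/-- The interpretation of `ZFG.Res` in a model. -/
def Res (r U V s t : M) : Prop :=
  ∃ p g, IsPair p U V ∧ Val r p g ∧ Val g s t

@[simp] theorem holds_Res {r U V s t : ℕ} (h1 : r < k) (h2 : U < k) (h3 : V < k) (h4 : s < k)
    (h5 : t < k) : (ZFG.Res r U V s t).Holds k ν ↔ Res (ν r) (ν U) (ν V) (ν s) (ν t) := by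
  simp (disch := omega) [ZFG.Res, Res]

instance D_Res (f1 f2 f3 f4 f5 : Γ → M) [DF f1] [DF f2] [DF f3] [DF f4] [DF f5] : D fun w => Res
    (f1 w) (f2 w) (f3 w) (f4 w) (f5 w) :=
  D.comp (P := fun w : (((M × M) × M) × M) × M => Res w.1.1.1.1 w.1.1.1.2 w.1.1.2 w.1.2 w.2)
    (by unfold Res; infer_instance) fun w => ((((f1 w, f2 w), f3 w), f4 w), f5 w)

/-- The interpretation of `ZFG.SheafCondition` in a model. -/
def SheafCondition (T F r : M) : Prop :=
  ∀ U, U ∈' T → ∀ C, Sub C T → IsUnion U C → ∀ c, IsFunOn c C → (∀ V s, Val c V s → IsSection F V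
  s) → (∀ V W s t, Val c V s → Val c W t → ∀ Z, IsInter Z V W → ∃ u, Res r V Z s u ∧ Res r W Z t
  u) → ∃! s, IsSection F U s ∧ ∀ V t, Val c V t → Res r U V s t

@[simp] theorem holds_SheafCondition {T F r : ℕ} (h1 : T < k) (h2 : F < k) (h3 : r < k) :
    (ZFG.SheafCondition T F r).Holds k ν ↔ SheafCondition (ν T) (ν F) (ν r) := by
  simp (disch := omega) [ZFG.SheafCondition, SheafCondition, ExistsUnique]

instance D_SheafCondition (f1 f2 f3 : Γ → M) [DF f1] [DF f2] [DF f3] : D fun w => SheafCondition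
    (f1 w) (f2 w) (f3 w) :=
  D.comp (P := fun w : (M × M) × M => SheafCondition w.1.1 w.1.2 w.2)
    (by unfold SheafCondition; infer_instance) fun w => ((f1 w, f2 w), f3 w)

/-- The interpretation of `ZFG.RingAt` in a model. -/
def RingAt (O a m U : M) (φ : M → M → M → Prop) : Prop :=
  ∃ A b n, Val O U A ∧ Val a U b ∧ Val m U n ∧ φ A b n

@[simp] theorem holds_RingAt {O a m U : ℕ} {φ : ℕ → ℕ → ℕ → Fm} (hO : O < k) (ha : a < k)
    (hm : m < k) (hU : U < k) : (ZFG.RingAt O a m U φ).Holds k ν ↔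
      RingAt (ν O) (ν a) (ν m) (ν U) fun A b n => (φ k (k + 1) (k + 2)).Holds (k + 3)
        (Function.update (Function.update (Function.update ν k A) (k + 1) b) (k + 2) n) := by
  simp (disch := omega) [ZFG.RingAt, RingAt]

/-- The predicate `φ` varies with the context, so the definition is unfolded in the context extended
by the ring and its operations. -/
instance D_RingAt (O a m U : Γ → M) [hO : DF O] [ha : DF a] [hm : DF m] [hU : DF U]
    (φ : Γ → M → M → M → Prop)
    [D fun w : ((Γ × M) × M) × M => φ w.1.1.1 w.1.1.2 w.1.2 w.2] :
    D fun w => RingAt (O w) (a w) (m w) (U w) (φ w) := by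
  have := hO.comp_varMap fun w : ((Γ × M) × M) × M => w.1.1.1
  have := ha.comp_varMap fun w : ((Γ × M) × M) × M => w.1.1.1
  have := hm.comp_varMap fun w : ((Γ × M) × M) × M => w.1.1.1
  have := hU.comp_varMap fun w : ((Γ × M) × M) × M => w.1.1.1
  unfold RingAt
  infer_instance

/-- The interpretation of `ZFG.IsRingedSpace` in a model. -/
def IsRingedSpace (P T O a m r : M) : Prop :=
  IsSpace P T ∧ IsFunOn O T ∧ IsFunOn a T ∧ IsFunOn m T ∧ (∀ U, U ∈' T → RingAt O a m U fun A b n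
  => IsRing A b n) ∧ (∀ q, q ∈' r → ∃ U, U ∈' T ∧ ∃ V, V ∈' T ∧ ∃ p g, Sub V U ∧ IsPair p U V ∧
  IsPair q p g) ∧ (∀ U, U ∈' T → ∀ V, V ∈' T → Sub V U → ∀ p, IsPair p U V → ∃! g, Val r p g) ∧ (∀
  U, U ∈' T → ∀ V, V ∈' T → ∀ p g, IsPair p U V → Val r p g → RingAt O a m U fun A b n => RingAt O
  a m V fun A' b' n' => IsRingHom A b n A' b' n' g) ∧ (∀ U, U ∈' T → ∀ s, IsSection O U s → Res r
  U U s s) ∧ (∀ U V W s t u, Res r U V s t → Res r V W t u → Res r U W s u) ∧ SheafCondition T O r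

@[simp] theorem holds_IsRingedSpace {P T O a m r : ℕ} (h1 : P < k) (h2 : T < k) (h3 : O < k)
    (h4 : a < k) (h5 : m < k) (h6 : r < k) : (ZFG.IsRingedSpace P T O a m r).Holds k ν ↔
    IsRingedSpace (ν P) (ν T) (ν O) (ν a) (ν m) (ν r) := by
  simp (disch := omega) [ZFG.IsRingedSpace, IsRingedSpace, ExistsUnique]

/-- The interpretation of `ZFG.IsDistinguished` in a model. -/
def IsDistinguished (h U f V : M) : Prop :=
  Sub V U ∧ ∀ x, x ∈' U → (x ∈' V ↔ ∃ p, Val h x p ∧ ¬ f ∈' p)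

@[simp] theorem holds_IsDistinguished {h U f V : ℕ} (h1 : h < k) (h2 : U < k) (h3 : f < k)
    (h4 : V < k) : (ZFG.IsDistinguished h U f V).Holds k ν ↔ IsDistinguished (ν h) (ν U) (ν f)
    (ν V) := by
  simp (disch := omega) [ZFG.IsDistinguished, IsDistinguished]

/-- The interpretation of `ZFG.ImageOn` in a model. -/
def ImageOn (r U V θ g t : M) : Prop :=
  ∃ s, Val θ g s ∧ Res r U V s t

@[simp] theorem holds_ImageOn {r U V θ g t : ℕ} (h1 : r < k) (h2 : U < k) (h3 : V < k)
    (h4 : θ < k) (h5 : g < k) (h6 : t < k) : (ZFG.ImageOn r U V θ g t).Holds k ν ↔ ImageOn (ν r)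
    (ν U) (ν V) (ν θ) (ν g) (ν t) := by
  simp (disch := omega) [ZFG.ImageOn, ImageOn]

instance D_ImageOn (f1 f2 f3 f4 f5 f6 : Γ → M) [DF f1] [DF f2] [DF f3] [DF f4] [DF f5] [DF f6] : D
    fun w => ImageOn (f1 w) (f2 w) (f3 w) (f4 w) (f5 w) (f6 w) :=
  D.comp (P := fun w : ((((M × M) × M) × M) × M) × M => ImageOn w.1.1.1.1.1 w.1.1.1.1.2 w.1.1.1.2 w.1.1.2 w.1.2 w.2)
    (by unfold ImageOn; infer_instance) fun w => (((((f1 w, f2 w), f3 w), f4 w), f5 w), f6 w)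

/-- The interpretation of `ZFG.IsLocalizationMap` in a model. -/
def IsLocalizationMap (R n r U V θ f A m : M) : Prop :=
  (∀ t, ImageOn r U V θ f t → ∃ v, v ∈' A ∧ ∃ e, IsUnitOf A m e ∧ Op m t v e) ∧ (∀ s, s ∈' A → ∃
  k, k ∈' R ∧ IsPower R n f k ∧ ∃ g, g ∈' R ∧ ∃ u t, ImageOn r U V θ k u ∧ ImageOn r U V θ g t ∧
  Op m s u t) ∧ ∀ g, g ∈' R → ∀ g', g' ∈' R → ∀ t, ImageOn r U V θ g t → ImageOn r U V θ g' t → ∃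
  k, k ∈' R ∧ IsPower R n f k ∧ ∃ w, Op n k g w ∧ Op n k g' w

@[simp] theorem holds_IsLocalizationMap {R n r U V θ f A m : ℕ} (h1 : R < k) (h2 : n < k)
    (h3 : r < k) (h4 : U < k) (h5 : V < k) (h6 : θ < k) (h7 : f < k) (h8 : A < k) (h9 : m < k) :
    (ZFG.IsLocalizationMap R n r U V θ f A m).Holds k ν ↔ IsLocalizationMap (ν R) (ν n) (ν r)
    (ν U) (ν V) (ν θ) (ν f) (ν A) (ν m) := by
  simp (disch := omega) [ZFG.IsLocalizationMap, IsLocalizationMap]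

/-- The interpretation of `ZFG.IsSpecVia` in a model. -/
def IsSpecVia (T O a m r U R b n h θ : M) : Prop :=
  IsFunOn h U ∧ (∀ x p, Val h x p → IsPrimeIdeal R b n p) ∧ (∀ p, IsPrimeIdeal R b n p → ∃! x, Val
  h x p) ∧ (∀ V, Sub V U → (V ∈' T ↔ ∃ J, IsIdeal R b n J ∧ ∀ x, x ∈' U → (x ∈' V ↔ ∃ p, Val h x p
  ∧ ¬ Sub J p))) ∧ (RingAt O a m U fun A a' m' => IsRingHom R b n A a' m' θ) ∧ ∀ f, f ∈' R → ∀ V,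
  V ∈' T → IsDistinguished h U f V → RingAt O a m V fun A _ m' => IsLocalizationMap R n r U V θ f
  A m'

@[simp] theorem holds_IsSpecVia {T O a m r U R b n h θ : ℕ} (h1 : T < k) (h2 : O < k) (h3 : a < k)
    (h4 : m < k) (h5 : r < k) (h6 : U < k) (h7 : R < k) (h8 : b < k) (h9 : n < k) (h10 : h < k)
    (h11 : θ < k) : (ZFG.IsSpecVia T O a m r U R b n h θ).Holds k ν ↔ IsSpecVia (ν T) (ν O) (ν a)
    (ν m) (ν r) (ν U) (ν R) (ν b) (ν n) (ν h) (ν θ) := by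
  simp (disch := omega) [ZFG.IsSpecVia, IsSpecVia, ExistsUnique]

/-- The interpretation of `ZFG.IsNoetherianAffine` in a model. -/
def IsNoetherianAffine (T O a m r U : M) : Prop :=
  ∃ R b n h θ, IsNoetherianRing R b n ∧ IsSpecVia T O a m r U R b n h θ

@[simp] theorem holds_IsNoetherianAffine {T O a m r U : ℕ} (h1 : T < k) (h2 : O < k) (h3 : a < k)
    (h4 : m < k) (h5 : r < k) (h6 : U < k) : (ZFG.IsNoetherianAffine T O a m r U).Holds k ν ↔
    IsNoetherianAffine (ν T) (ν O) (ν a) (ν m) (ν r) (ν U) := by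
  simp (disch := omega) [ZFG.IsNoetherianAffine, IsNoetherianAffine]

/-- The interpretation of `ZFG.IsNoetherianScheme` in a model. -/
def IsNoetherianScheme (P T O a m r : M) : Prop :=
  IsRingedSpace P T O a m r ∧ ∃ C, IsFinite C ∧ Sub C T ∧ IsUnion P C ∧ ∀ U, U ∈' C →
  IsNoetherianAffine T O a m r U

@[simp] theorem holds_IsNoetherianScheme {P T O a m r : ℕ} (h1 : P < k) (h2 : T < k) (h3 : O < k)
    (h4 : a < k) (h5 : m < k) (h6 : r < k) : (ZFG.IsNoetherianScheme P T O a m r).Holds k ν ↔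
    IsNoetherianScheme (ν P) (ν T) (ν O) (ν a) (ν m) (ν r) := by
  simp (disch := omega) [ZFG.IsNoetherianScheme, IsNoetherianScheme]

/-- The interpretation of `ZFG.IsIdealSheaf` in a model. -/
def IsIdealSheaf (T O a m r I : M) : Prop :=
  IsFunOn I T ∧ (∀ U, U ∈' T → RingAt O a m U fun A b n => ∃ J, Val I U J ∧ IsIdeal A b n J) ∧ (∀
  U V s t, IsSection I U s → Res r U V s t → IsSection I V t) ∧ SheafCondition T I r

@[simp] theorem holds_IsIdealSheaf {T O a m r I : ℕ} (h1 : T < k) (h2 : O < k) (h3 : a < k)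
    (h4 : m < k) (h5 : r < k) (h6 : I < k) : (ZFG.IsIdealSheaf T O a m r I).Holds k ν ↔
    IsIdealSheaf (ν T) (ν O) (ν a) (ν m) (ν r) (ν I) := by
  simp (disch := omega) [ZFG.IsIdealSheaf, IsIdealSheaf]

instance D_IsIdealSheaf (f1 f2 f3 f4 f5 f6 : Γ → M) [DF f1] [DF f2] [DF f3] [DF f4] [DF f5]
    [DF f6] : D fun w => IsIdealSheaf (f1 w) (f2 w) (f3 w) (f4 w) (f5 w) (f6 w) :=
  D.comp (P := fun w : ((((M × M) × M) × M) × M) × M => IsIdealSheaf w.1.1.1.1.1 w.1.1.1.1.2 w.1.1.1.2 w.1.1.2 w.1.2 w.2)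
    (by unfold IsIdealSheaf; infer_instance) fun w => (((((f1 w, f2 w), f3 w), f4 w), f5 w), f6 w)

end Model

/-! ### From the axioms of ZFG[0] to a class of models with schemes for definable predicates. -/

namespace Model

/-- The axioms of ZFG[0] in a model, with schemes for definable classes. -/
class ZF (M : Type) [LSet.Structure M] : Prop where
  ext : ∀ x y : M, (∀ z, z ∈' x ↔ z ∈' y) → x = y
  foundation : ∀ x : M, (∃ y, y ∈' x) → ∃ y, y ∈' x ∧ ∀ z, z ∈' y → ¬ z ∈' x
  pairing : ∀ x y : M, ∃ u, IsUPair u x y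
  union : ∀ c : M, ∃ u, IsUnion u c
  infinity : ∃ w : M, IsInductive w
  le_antisymm : ∀ x y : M, x ≤' y → y ≤' x → x = y
  sep : ∀ (P : M → Prop) [D P] (a : M), ∃ b, ∀ x, x ∈' b ↔ (x ∈' a ∧ P x)
  repl : ∀ (R : M → M → Prop) [D fun w : M × M => R w.1 w.2] (a : M),
    (∀ x, x ∈' a → ∃! y, R x y) → ∃ b, ∀ y, y ∈' b ↔ ∃ x, x ∈' a ∧ R x y
  least : ∀ (P : M → Prop) [D P], (∃ x, P x) → ∃ x, P x ∧ ∀ y, P y → x ≤' y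

section

variable {M : Type} [LSet.Structure M]

/-- The parameters of a definition can be listed. -/
theorem exists_fin_formula [Nonempty M] {k : ℕ} (φ : LSet.Formula (M ⊕ ℕ)) (g : ℕ → Fin k) :
    ∃ (n : ℕ) (p : Fin n → M) (ψ : LSet.Formula (Fin (n + k))), ∀ y : Fin k → M,
      φ.Realize (Sum.elim id (y ∘ g)) ↔ ψ.Realize (Fin.append p y) := by
  classical
  let e := Fintype.equivFin φ.freeVarFinset
  let f : φ.freeVarFinset → Fin (Fintype.card φ.freeVarFinset + k) := fun a =>
    Sum.elim (fun _ => Fin.castAdd k (e a)) (fun i => Fin.natAdd _ (g i)) a.1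
  -- A position that belongs to an ordinary variable gets an arbitrary parameter; the new formula
  -- does not mention it.
  refine ⟨_, fun i => Sum.elim id (fun _ => Classical.arbitrary M) (e.symm i).1,
    φ.restrictFreeVar f, fun y => ?_⟩
  refine (BoundedFormula.realize_restrictFreeVar _ ?_).symm
  rintro ⟨a | i, ha⟩
  · simp [f]
  · simp [f]

/-- The scope `m` and the variable `x` are arbitrary because the schemes use the same formula under
different numbers of quantifiers, with the parameters always in the first `n` variables. -/
theorem exists_unary [Nonempty M] (P : M → Prop) [h : D P] :
    ∃ (n : ℕ) (p : ℕ → M) (ψ : LSet.Formula (Fin (n + 1))), ∀ (m : ℕ) (ν : ℕ → M) (x : ℕ),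
      n ≤ m → x < m → (∀ i < n, ν i = p i) → ((Fm.app ψ (args₁ n x)).Holds m ν ↔ P (ν x)) := by
  obtain ⟨φ, hφ⟩ := h.out
  obtain ⟨n, p, ψ, hψ⟩ := exists_fin_formula φ fun _ => (0 : Fin 1)
  refine ⟨n, fun i => if h : i < n then p ⟨i, h⟩ else Classical.arbitrary M, ψ,
    fun m ν x hm hx hν => ?_⟩
  rw [Fm.holds_app]
  · rw [hφ]
    refine Iff.trans (iff_of_eq (congrArg _ (funext fun i => ?_))) (hψ fun _ => ν x).symm
    refine Fin.addCases (fun i => ?_) (fun i => ?_) i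
    · simp [args₁, hν]
    · simp [args₁]
  · intro i
    simp only [args₁]
    split_ifs <;> omega

theorem exists_binary [Nonempty M] (R : M → M → Prop) [h : D fun w : M × M => R w.1 w.2] :
    ∃ (n : ℕ) (p : ℕ → M) (ψ : LSet.Formula (Fin (n + 2))), ∀ (m : ℕ) (ν : ℕ → M) (x y : ℕ),
      n ≤ m → x < m → y < m → (∀ i < n, ν i = p i) →
        ((Fm.app ψ (args₂ n x y)).Holds m ν ↔ R (ν x) (ν y)) := by
  obtain ⟨φ, hφ⟩ := h.out
  -- A pair is encoded with its last component first, while `args₂` puts `x` before `y`.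
  obtain ⟨n, p, ψ, hψ⟩ := exists_fin_formula φ fun i => i.casesOn (1 : Fin 2) fun _ => 0
  refine ⟨n, fun i => if h : i < n then p ⟨i, h⟩ else Classical.arbitrary M, ψ,
    fun m ν x y hm hx hy hν => ?_⟩
  rw [Fm.holds_app]
  · rw [hφ (ν x, ν y)]
    refine Iff.trans (iff_of_eq (congrArg _ (funext fun i => ?_)))
      ((hψ ![ν x, ν y]).symm.trans (iff_of_eq (congrArg _ (funext fun a => ?_))))
    · refine Fin.addCases (fun i => ?_) (fun i => ?_) i
      · simp [args₂, hν]
      · fin_cases i <;> simp [args₂]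
    · rcases a with a | _ | a <;> rfl
  · intro i
    simp only [args₂]
    split_ifs <;> omega

theorem zf_of_model [Nonempty M] (hM : M ⊨ ZFG0) : ZF M := by
  have hmem : ∀ φ ∈ ZFG0, M ⊨ φ := fun φ => Theory.Model.realize_of_mem φ
  have hs : ∀ φ : Fm, φ.sentence ∈ ZFG0 → φ.Holds 0 fun _ => Classical.arbitrary M :=
    fun φ h => (Fm.realize_sentence _).1 (hmem _ h)
  have hlin := hs linearOrder (by simp [ZFG0])
  constructor
  · have := hs extensionality (by simp [ZFG0])
    simpa (disch := omega) [extensionality] using this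
  · have := hs foundation (by simp [ZFG0])
    simpa (disch := omega) [foundation] using this
  · have := hs pairing (by simp [ZFG0])
    simpa (disch := omega) [pairing] using this
  · have := hs union (by simp [ZFG0])
    simpa (disch := omega) [union] using this
  · have := hs infinity (by simp [ZFG0])
    simpa (disch := omega) [infinity] using this
  · simp (disch := omega) only [linearOrder, Fm.holds_and] at hlin
    have := hlin.2.1
    simpa (disch := omega) using this
  · intro P _ a
    obtain ⟨n, p, ψ, hψ⟩ := exists_unary P
    have := Fm.realize_closure.1 (hmem (separation n ψ) (by
      simp only [ZFG0, Set.mem_union, Set.mem_ofPred_eq]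
      exact .inl (.inl (.inr ⟨n, ψ, rfl⟩)))) p
    simp (disch := omega) only [Fm.holds_all, Fm.holds_ex, Fm.holds_iff, Fm.holds_mem,
      Fm.holds_and, Function.update_self, Function.update_of_ne] at this
    obtain ⟨b, hb⟩ := this a
    refine ⟨b, fun x => (hb x).trans (and_congr_right fun _ => ?_)⟩
    rw [hψ _ _ _ (by omega) (by omega) fun i hi => by
      simp (disch := omega) [Function.update_of_ne], Function.update_self]
  · intro R _ a ha
    obtain ⟨n, p, ψ, hψ⟩ := exists_binary R
    have := Fm.realize_closure.1 (hmem (replacement n ψ) (by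
      simp only [ZFG0, Set.mem_union, Set.mem_ofPred_eq]
      exact .inl (.inr ⟨n, ψ, rfl⟩))) p
    simp (disch := omega) only [Fm.holds_all, Fm.holds_ex, Fm.holds_iff, Fm.holds_mem,
      Fm.holds_imp, Fm.holds_allIn, Fm.holds_exIn, Fm.holds_exUnique,
      Function.update_self, Function.update_of_ne] at this
    obtain ⟨b, hb⟩ := this a fun x hx => by
      obtain ⟨y, hy, hy'⟩ := ha x hx
      refine ⟨y, ?_, fun z hz => hy' z ?_⟩
      · rw [hψ _ _ _ _ (by omega) (by omega) (by omega) fun i hi => by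
          simp (disch := omega) [Function.update_of_ne] ]
        simpa (disch := omega) [Function.update_of_ne] using hy
      · rw [hψ _ _ _ _ (by omega) (by omega) (by omega) fun i hi => by
          simp (disch := omega) [Function.update_of_ne] ] at hz
        simpa (disch := omega) [Function.update_of_ne] using hz
    refine ⟨b, fun y => (hb y).trans (exists_congr fun x => and_congr_right fun _ => ?_)⟩
    rw [hψ _ _ _ _ (by omega) (by omega) (by omega) fun i hi => by
      simp (disch := omega) [Function.update_of_ne] ]
    simp (disch := omega) [Function.update_of_ne]
  · intro P _ ⟨a, ha⟩
    obtain ⟨n, p, ψ, hψ⟩ := exists_unary P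
    have := Fm.realize_closure.1 (hmem (leastElement n ψ) (by
      simp only [ZFG0, Set.mem_union, Set.mem_ofPred_eq]
      exact .inr ⟨n, ψ, rfl⟩)) p
    simp (disch := omega) only [Fm.holds_all, Fm.holds_ex, Fm.holds_le, Fm.holds_imp,
      Fm.holds_and, Function.update_self, Function.update_of_ne] at this
    obtain ⟨x, hx, hx'⟩ := this ⟨a, by
      rwa [hψ _ _ _ (by omega) (by omega) fun i hi => by
        simp (disch := omega) [Function.update_of_ne], Function.update_self]⟩
    refine ⟨x, ?_, fun y hy => hx' y ?_⟩
    · rwa [hψ _ _ _ (by omega) (by omega) fun i hi => by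
        simp (disch := omega) [Function.update_of_ne], Function.update_self] at hx
    · rwa [hψ _ _ _ (by omega) (by omega) fun i hi => by
        simp (disch := omega) [Function.update_of_ne], Function.update_self]

end

end Model

namespace Model

/-! ### Elementary set theory in a model -/

section SetTheory

variable {M : Type} [LSet.Structure M] [ZF M] {Γ : Type} [Ctx Γ M]

theorem ext {x y : M} (h : ∀ z, z ∈' x ↔ z ∈' y) : x = y := ZF.ext x y h

theorem existsUnique_of_mem_iff {P : M → Prop} (h : ∃ b : M, ∀ x, x ∈' b ↔ P x) :
    ∃! b : M, ∀ x, x ∈' b ↔ P x := by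
  obtain ⟨b, hb⟩ := h
  exact ⟨b, hb, fun c hc => ext fun z => (hc z).trans (hb z).symm⟩

/-- By extensionality a chosen set is characterized by its elements; this gives chosen set
operations a definable graph. -/
theorem eq_choose_iff {P : M → Prop} (h : ∃ b : M, ∀ x, x ∈' b ↔ P x) (y : M) :
    y = h.choose ↔ ∀ x, x ∈' y ↔ P x :=
  ⟨fun e => e ▸ h.choose_spec, fun hy => (existsUnique_of_mem_iff h).unique hy h.choose_spec⟩

theorem exists_empty : ∃ o : M, ∀ z, ¬ z ∈' o := by
  obtain ⟨w, ⟨o, ho, -⟩, -⟩ := ZF.infinity (M := M)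
  exact ⟨o, ho⟩

/-- The empty set. -/
noncomputable def empty : M := exists_empty.choose

@[simp] theorem notMem_empty (z : M) : ¬ z ∈' empty := exists_empty.choose_spec z

theorem eq_empty_iff {x : M} : x = empty ↔ ∀ z, ¬ z ∈' x :=
  ⟨fun h => h ▸ notMem_empty, fun h => ext fun z => by simp [h z]⟩

/-- The unordered pair. -/
noncomputable def upair (x y : M) : M := (ZF.pairing x y).choose

@[simp] theorem mem_upair {x y z : M} : z ∈' upair x y ↔ z = x ∨ z = y :=
  (ZF.pairing x y).choose_spec z

theorem isUPair_iff {u x y : M} : IsUPair u x y ↔ u = upair x y :=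
  ⟨fun h => ext fun z => (h z).trans mem_upair.symm, fun h => h ▸ fun _ => mem_upair⟩

/-- The ordered pair. -/
noncomputable def pair (x y : M) : M := upair (upair x x) (upair x y)

theorem isPair_iff {p x y : M} : IsPair p x y ↔ p = pair x y := by
  simp [IsPair, isUPair_iff, pair]

theorem upair_eq_upair {x y z w : M} :
    upair x y = upair z w ↔ (x = z ∧ y = w) ∨ (x = w ∧ y = z) := by
  constructor
  · intro h
    have h₁ : ∀ a, (a = x ∨ a = y) ↔ (a = z ∨ a = w) := fun a => by
      rw [← mem_upair, h, mem_upair]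
    have := h₁ x
    have := h₁ y
    have := h₁ z
    have := h₁ w
    grind
  · rintro (⟨rfl, rfl⟩ | ⟨rfl, rfl⟩)
    · rfl
    · exact ext fun a => by simp [or_comm]

@[simp] theorem pair_eq_pair {x y z w : M} : pair x y = pair z w ↔ x = z ∧ y = w := by
  simp only [pair, upair_eq_upair]
  grind

instance DF_pair (f g : Γ → M) [DF f] [DF g] : DF fun w => pair (f w) (g w) :=
  DF.comp (F := fun w : M × M => pair w.1 w.2)
    (DF.of_graph (Q := fun w y => IsPair y w.1 w.2) fun _ _ => isPair_iff.symm) fun w => (f w, g w)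

theorem val_iff {f x y : M} : Val f x y ↔ pair x y ∈' f := by
  simp [Val, isPair_iff]

theorem exists_adj (S x : M) : ∃ b, ∀ z, z ∈' b ↔ (z ∈' S ∨ z = x) := by
  obtain ⟨b, hb⟩ := ZF.union (upair S (upair x x))
  exact ⟨b, fun z => by rw [hb z]; simp⟩

/-- The set `S ∪ {x}`. -/
noncomputable def adj (S x : M) : M := (exists_adj S x).choose

@[simp] theorem mem_adj {S x z : M} : z ∈' adj S x ↔ z ∈' S ∨ z = x :=
  (exists_adj S x).choose_spec z

instance DF_adj (f g : Γ → M) [DF f] [DF g] : DF fun w => adj (f w) (g w) :=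
  DF.comp (F := fun w : M × M => adj w.1 w.2)
    (DF.of_graph (Q := fun w y => ∀ z, z ∈' y ↔ (z ∈' w.1 ∨ z = w.2))
      fun w y => eq_choose_iff (exists_adj w.1 w.2) y) fun w => (f w, g w)

theorem isSucc_iff {y x : M} : IsSucc y x ↔ y = adj x x :=
  (eq_choose_iff (exists_adj x x) y).symm

@[simp] theorem adj_ne_empty {S x : M} : adj S x ≠ empty := fun h =>
  notMem_empty x (h ▸ mem_adj.2 (.inr rfl))

/-- Otherwise each of `x`, `y` would belong to the other, against foundation for the unordered pair.
-/
theorem succ_inj {x y : M} (h : adj x x = adj y y) : x = y := by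
  by_contra hxy
  have h₁ : x ∈' y := (mem_adj.1 (h ▸ mem_adj.2 (.inr rfl) : x ∈' adj y y)).resolve_right hxy
  have h₂ : y ∈' x :=
    (mem_adj.1 (h ▸ mem_adj.2 (.inr rfl) : y ∈' adj x x)).resolve_right (Ne.symm hxy)
  obtain ⟨a, ha, ha'⟩ := ZF.foundation (upair x y) ⟨x, by simp⟩
  rcases mem_upair.1 ha with rfl | rfl
  · exact ha' y h₂ (by simp)
  · exact ha' x h₁ (by simp)

theorem isInductive_iff {w : M} :
    IsInductive w ↔ empty ∈' w ∧ ∀ x, x ∈' w → adj x x ∈' w := by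
  have : ∀ o : M, IsEmptySet o ↔ o = empty := fun o => eq_empty_iff.symm
  simp [IsInductive, isSucc_iff, this]

theorem isNat_empty : IsNat (empty : M) := fun _ hw => (isInductive_iff.1 hw).1

theorem IsNat.succ {n : M} (h : IsNat n) : IsNat (adj n n) := fun w hw =>
  (isInductive_iff.1 hw).2 n (h w hw)

instance : D (IsNat : M → Prop) := D_IsNat fun n => n

theorem exists_omega : ∃ ω : M, ∀ n, n ∈' ω ↔ IsNat n := by
  obtain ⟨w, hw⟩ := ZF.infinity (M := M)
  obtain ⟨b, hb⟩ := ZF.sep (fun n : M => IsNat n) w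
  exact ⟨b, fun n => (hb n).trans ⟨fun h => h.2, fun h => ⟨h w hw, h⟩⟩⟩

theorem IsNat.induction {P : M → Prop} [D P] (h₀ : P empty)
    (hs : ∀ n, IsNat n → P n → P (adj n n)) {n : M} (hn : IsNat n) : P n := by
  obtain ⟨ω, hω⟩ := exists_omega (M := M)
  obtain ⟨b, hb⟩ := ZF.sep P ω
  refine ((hb n).1 (hn b (isInductive_iff.2 ⟨(hb _).2 ⟨(hω _).2 isNat_empty, h₀⟩, ?_⟩))).2
  intro x hx
  obtain ⟨h₁, h₂⟩ := (hb x).1 hx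
  have h₁ := (hω x).1 h₁
  exact (hb _).2 ⟨(hω _).2 h₁.succ, hs x h₁ h₂⟩

/-- Each element of `f` is `(0, k)`, or of the form `(i + 1, s x)` with `(i, x) ∈ f`. -/
def IsAttempt (s : M → M) (k f : M) : Prop :=
  ∀ p, p ∈' f → p = pair empty k ∨ ∃ i x, pair i x ∈' f ∧ p = pair (adj i i) (s x)

/-- The orbit of `k` under `s` is a set with the corresponding induction principle. -/
theorem exists_orbit (s : M → M) [hs : DF s] (k : M) :
    ∃ c : M, k ∈' c ∧ (∀ x, x ∈' c → s x ∈' c) ∧ ∀ (Q : M → Prop) [D Q], Q k →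
      (∀ x, x ∈' c → Q x → Q (s x)) → ∀ x, x ∈' c → Q x := by
  -- Every formula below that mentions `s` is thereby definable.
  have : ∀ {Γ : Type} [Ctx Γ M] (f : Γ → M) [DF f], DF fun w => s (f w) := fun f => hs.comp f
  have hD : D fun w : M × M => ∃ f, IsAttempt s k f ∧ pair w.1 w.2 ∈' f := by
    unfold IsAttempt
    infer_instance
  -- Recursion along the natural numbers of the model, which may be nonstandard. A pair at a
  -- successor must come from a pair at its predecessor in the same attempt, so values are unique
  -- without attempts being functions.
  have hfun : ∀ n : M, IsNat n → ∃! x, ∃ f, IsAttempt s k f ∧ pair n x ∈' f := by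
    intro n hn
    refine IsNat.induction (P := fun n => ∃! x, ∃ f, IsAttempt s k f ∧ pair n x ∈' f) ?_ ?_ hn
    · refine ⟨k, ⟨adj empty (pair empty k), ?_, by simp⟩, ?_⟩
      · intro p hp
        left
        simpa using hp
      · rintro y ⟨f, hf, hy⟩
        rcases hf _ hy with h | ⟨i, x, -, h⟩
        · exact (pair_eq_pair.1 h).2
        · exact absurd (pair_eq_pair.1 h).1.symm adj_ne_empty
    · rintro n - ⟨x, ⟨f, hf, hx⟩, huniq⟩
      refine ⟨s x, ⟨adj f (pair (adj n n) (s x)), ?_, by simp⟩, ?_⟩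
      · intro p hp
        rcases mem_adj.1 hp with hp | rfl
        · refine (hf p hp).imp_right ?_
          rintro ⟨i, z, h, rfl⟩
          exact ⟨i, z, by simp [h], rfl⟩
        · exact .inr ⟨n, x, by simp [hx], rfl⟩
      · rintro y ⟨g, hg, hy⟩
        rcases hg _ hy with h | ⟨i, z, hz, h⟩
        · exact absurd (pair_eq_pair.1 h).1 adj_ne_empty
        · obtain ⟨h₁, rfl⟩ := pair_eq_pair.1 h
          obtain rfl := succ_inj h₁
          rw [huniq z ⟨g, hg, hz⟩]
  obtain ⟨ω, hω⟩ := exists_omega (M := M)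
  obtain ⟨c, hc⟩ := ZF.repl (fun n x => ∃ f, IsAttempt s k f ∧ pair n x ∈' f) ω
    fun n hn => hfun n ((hω n).1 hn)
  have h₀ : IsAttempt s k (adj empty (pair empty k)) := fun p hp => .inl (by simpa using hp)
  have hsucc : ∀ n x, (∃ f, IsAttempt s k f ∧ pair n x ∈' f) →
      ∃ f, IsAttempt s k f ∧ pair (adj n n) (s x) ∈' f := by
    rintro n x ⟨f, hf, hx⟩
    refine ⟨adj f (pair (adj n n) (s x)), ?_, by simp⟩
    intro p hp
    rcases mem_adj.1 hp with hp | rfl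
    · refine (hf p hp).imp_right ?_
      rintro ⟨i, z, h, rfl⟩
      exact ⟨i, z, by simp [h], rfl⟩
    · exact .inr ⟨n, x, by simp [hx], rfl⟩
  refine ⟨c, (hc k).2 ⟨empty, (hω _).2 isNat_empty, _, h₀, by simp⟩, fun x hx => ?_, ?_⟩
  · obtain ⟨n, hn, h⟩ := (hc x).1 hx
    exact (hc _).2 ⟨_, (hω _).2 ((hω n).1 hn).succ, hsucc n x h⟩
  · intro Q hQ h₁ h₂ x hx
    have : ∀ {Γ : Type} [Ctx Γ M] (f : Γ → M) [DF f], D fun w => Q (f w) := fun f => hQ.comp f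
    obtain ⟨n, hn, h⟩ := (hc x).1 hx
    have key : ∀ n, IsNat n → ∀ y, (∃ f, IsAttempt s k f ∧ pair n y ∈' f) → Q y := by
      intro n hn
      refine IsNat.induction (P := fun n => ∀ y, (∃ f, IsAttempt s k f ∧ pair n y ∈' f) → Q y)
        ?_ ?_ hn
      · intro y hy
        rwa [(hfun _ isNat_empty).unique hy (⟨_, h₀, by simp⟩ :
          ∃ f, IsAttempt s k f ∧ pair empty k ∈' f)]
      · intro n hn ih y hy
        obtain ⟨z, hz, -⟩ := hfun n hn
        rw [(hfun _ hn.succ).unique hy (hsucc n z hz)]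
        exact h₂ z ((hc z).2 ⟨n, (hω n).2 hn, hz⟩) (ih z hz)
    exact key n ((hω n).1 hn) x h

/-- A bijection `f` from a natural number lists `A`. Internal induction on `i` treats the image of
the numbers below `i`, which grows by at most one element at each step. -/
theorem IsFinite.induction {A : M} (hA : IsFinite A) {P : M → Prop} [hP : D P] (h₀ : P empty)
    (hs : ∀ S x, Sub S A → x ∈' A → P S → P (adj S x)) : P A := by
  have : ∀ {Γ : Type} [Ctx Γ M] (f : Γ → M) [DF f], D fun w => P (f w) := fun f => hP.comp f
  obtain ⟨n, hn, f, ⟨hf, hfA⟩, hbij⟩ := hA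
  have key : ∀ i, IsNat i →
      ∀ S, (∀ y, y ∈' S ↔ (y ∈' A ∧ ∃ j, j ∈' i ∧ Val f j y)) → P S := by
    intro i hi
    refine IsNat.induction
      (P := fun i => ∀ S, (∀ y, y ∈' S ↔ (y ∈' A ∧ ∃ j, j ∈' i ∧ Val f j y)) → P S) ?_ ?_ hi
    · intro S hS
      rwa [show S = empty from ext fun z => by simp [hS z] ]
    · intro i _ ih S hS
      obtain ⟨S', hS'⟩ := ZF.sep (fun y => ∃ j, j ∈' i ∧ Val f j y) A
      -- The number `i` may lie outside the domain of `f`; then the image does not grow.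
      by_cases h : ∃ y, Val f i y
      · obtain ⟨y, hy⟩ := h
        obtain ⟨p, hp, hp'⟩ := hy
        obtain ⟨x, hx, z, hz⟩ := hf.1 p hp
        rw [isPair_iff] at hp' hz
        subst hz
        obtain ⟨rfl, rfl⟩ := pair_eq_pair.1 hp'
        have hy : Val f x z := val_iff.2 hp
        rw [show S = adj S' z from ext fun a => ?_]
        · exact hs S' z (fun a ha => ((hS' a).1 ha).1) (hfA _ _ hy) (ih S' hS')
        · rw [hS, mem_adj, hS']
          constructor
          · rintro ⟨ha, j, hj, hja⟩
            rcases mem_adj.1 hj with hj | rfl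
            · exact .inl ⟨ha, j, hj, hja⟩
            · exact .inr ((hf.2 _ hx).unique hja hy)
          · rintro (⟨ha, j, hj, hja⟩ | rfl)
            · exact ⟨ha, j, mem_adj.2 (.inl hj), hja⟩
            · exact ⟨hfA _ _ hy, x, mem_adj.2 (.inr rfl), hy⟩
      · refine ih S fun y => (hS y).trans (and_congr_right fun _ => ⟨?_, ?_⟩)
        · rintro ⟨j, hj, hjy⟩
          rcases mem_adj.1 hj with hj | rfl
          · exact ⟨j, hj, hjy⟩
          · exact absurd ⟨y, hjy⟩ h
        · rintro ⟨j, hj, hjy⟩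
          exact ⟨j, mem_adj.2 (.inl hj), hjy⟩
  refine key n hn A fun y => ⟨fun hy => ⟨hy, ?_⟩, fun h => h.1⟩
  obtain ⟨j, hj, -⟩ := hbij y hy
  obtain ⟨p, hp, hp'⟩ := hj
  obtain ⟨x, hx, z, hz⟩ := hf.1 p hp
  rw [isPair_iff] at hp' hz
  subst hz
  obtain ⟨rfl, rfl⟩ := pair_eq_pair.1 hp'
  exact ⟨x, hx, val_iff.2 hp⟩

/-- Replacement in `y`, replacement in `x` and a union suffice; products need no power set. -/
theorem exists_image₂ (F : M → M → M) [hF : DF fun w : M × M => F w.1 w.2] (A B : M) :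
    ∃ C : M, ∀ z, z ∈' C ↔ ∃ x, x ∈' A ∧ ∃ y, y ∈' B ∧ z = F x y := by
  have : ∀ {Γ : Type} [Ctx Γ M] (f g : Γ → M) [DF f] [DF g], DF fun w => F (f w) (g w) :=
    fun f g => hF.comp fun w => (f w, g w)
  have h : ∀ x, ∃ C : M, ∀ z, z ∈' C ↔ ∃ y, y ∈' B ∧ z = F x y := fun x =>
    ZF.repl (fun y z => z = F x y) B fun y _ => ⟨F x y, rfl, fun _ h => h⟩
  obtain ⟨c, hc⟩ := ZF.repl (fun x C => ∀ z, z ∈' C ↔ ∃ y, y ∈' B ∧ z = F x y) A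
    fun x _ => existsUnique_of_mem_iff (h x)
  obtain ⟨u, hu⟩ := ZF.union c
  refine ⟨u, fun z => (hu z).trans ⟨?_, ?_⟩⟩
  · rintro ⟨v, hv, hz⟩
    obtain ⟨x, hx, hv⟩ := (hc v).1 hv
    exact ⟨x, hx, (hv z).1 hz⟩
  · rintro ⟨x, hx, hz⟩
    obtain ⟨v, hv⟩ := h x
    exact ⟨v, (hc v).2 ⟨x, hx, hv⟩, (hv z).2 hz⟩

/-- A bound for the finite subsets of `A`: starting from `{∅}`, iterate the step that adjoins one
element of `A` to each member, and take the union of the orbit. -/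
theorem exists_adj_closed (A : M) : ∃ 𝓕 : M, empty ∈' 𝓕 ∧
    ∀ F, F ∈' 𝓕 → ∀ x, x ∈' A → adj F x ∈' 𝓕 := by
  have h : ∀ B : M, ∃ C : M, ∀ z, z ∈' C ↔ ∃ x, x ∈' B ∧ ∃ y, y ∈' A ∧ z = adj x y :=
    fun B => exists_image₂ adj B A
  let s : M → M := fun B => (h B).choose
  have : DF s := DF.of_graph (Q := fun B C => ∀ z, z ∈' C ↔ ∃ x, x ∈' B ∧ ∃ y, y ∈' A ∧ z = adj x y)
    fun B C => eq_choose_iff (h B) C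
  obtain ⟨c, h₀, hs, -⟩ := exists_orbit s (adj empty empty)
  obtain ⟨u, hu⟩ := ZF.union c
  refine ⟨u, (hu _).2 ⟨_, h₀, by simp⟩, fun F hF x hx => ?_⟩
  obtain ⟨v, hv, hFv⟩ := (hu F).1 hF
  exact (hu _).2 ⟨s v, hs v hv, ((h v).choose_spec _).2 ⟨F, hFv, x, hx, rfl⟩⟩

end SetTheory

end Model

namespace Model

/-! ### Commutative algebra in a model -/

section Algebra

variable {M : Type} [LSet.Structure M] [ZF M] {Γ : Type} [Ctx Γ M] {A B R a b m n op f : M}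

instance (c : M) : D (Sub c) := D_Sub (fun _ => c) fun x => x

instance : D (IsIdeal R b n) := D_IsIdeal (fun _ => R) (fun _ => b) (fun _ => n) fun x => x

omit [ZF M] in
theorem Sub.trans {x y z : M} (h : Sub x y) (h' : Sub y z) : Sub x z := fun t ht => h' t (h t ht)

omit [ZF M] in
theorem Sub.rfl {x : M} : Sub x x := fun _ h => h

theorem Sub.antisymm {x y : M} (h : Sub x y) (h' : Sub y x) : x = y :=
  ext fun z => ⟨h z, h' z⟩

theorem sub_adj {S x A : M} : Sub (adj S x) A ↔ Sub S A ∧ x ∈' A := by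
  simp [Sub, or_imp, forall_and]

theorem op_iff {x y z : M} : Op op x y z ↔ pair (pair x y) z ∈' op := by
  simp [Op, isPair_iff, val_iff]

theorem IsOp.mem (h : IsOp A op) {x y z : M} (hz : Op op x y z) :
    x ∈' A ∧ y ∈' A ∧ z ∈' A := by
  obtain ⟨x', hx, y', hy, z', hz', p, hp, hq⟩ := h.1 _ (op_iff.1 hz)
  rw [isPair_iff] at hp hq
  subst hp
  simp only [pair_eq_pair] at hq
  obtain ⟨⟨rfl, rfl⟩, rfl⟩ := hq
  exact ⟨hx, hy, hz'⟩

omit [ZF M] in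
theorem IsOp.exists (h : IsOp A op) {x y : M} (hx : x ∈' A) (hy : y ∈' A) : ∃ z, Op op x y z :=
  (h.2 x hx y hy).exists

theorem IsOp.unique (h : IsOp A op) {x y z z' : M} (hz : Op op x y z) (hz' : Op op x y z') :
    z = z' :=
  (h.2 x (h.mem hz).1 y (h.mem hz).2.1).unique hz hz'

theorem IsUnitOf.unique (h : IsOp A op) (hc : IsCommOp A op) {e e' : M} (he : IsUnitOf A op e)
    (he' : IsUnitOf A op e') : e = e' :=
  h.unique (hc _ he'.1 _ he.1 _ (he'.2 e he.1)) (he.2 e' he'.1)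

/-- The elements of `A` with a commutative, associative operation with unit, as a monoid. -/
noncomputable abbrev commMonoid {e : M} (h : IsOp A op) (hc : IsCommOp A op)
    (ha : IsAssocOp A op) (he : IsUnitOf A op e) : CommMonoid {x : M // x ∈' A} where
  mul x y := ⟨(h.exists x.2 y.2).choose, (h.mem (h.exists x.2 y.2).choose_spec).2.2⟩
  one := ⟨e, he.1⟩
  mul_comm x y := Subtype.ext
    (h.unique (hc _ x.2 _ y.2 _ (h.exists x.2 y.2).choose_spec) (h.exists y.2 x.2).choose_spec)
  mul_assoc x y z := Subtype.ext <| by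
    have h₁ := (h.exists x.2 y.2).choose_spec
    have h₂ := (h.exists y.2 z.2).choose_spec
    have h₃ := (h.exists (h.mem h₁).2.2 z.2).choose_spec
    exact h.unique ((ha _ x.2 _ y.2 _ z.2 _ _ h₁ h₂ _).1 h₃)
      (h.exists x.2 (h.mem h₂).2.2).choose_spec
  one_mul x := Subtype.ext (h.unique (h.exists he.1 x.2).choose_spec (he.2 x x.2))
  mul_one x := Subtype.ext
    (h.unique (h.exists x.2 he.1).choose_spec (hc _ he.1 _ x.2 _ (he.2 x x.2)))

/-- With an external monoid structure, identities for an internal operation become ordinary monoid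
calculations. -/
theorem exists_commMonoid {e : M} (h : IsOp A op) (hc : IsCommOp A op) (ha : IsAssocOp A op)
    (he : IsUnitOf A op e) : ∃ _ : CommMonoid {x : M // x ∈' A},
      (1 : {x : M // x ∈' A}).1 = e ∧ ∀ x y z : {x : M // x ∈' A}, Op op x.1 y.1 z.1 ↔ x * y = z :=
  ⟨commMonoid h hc ha he, rfl, fun x y _ =>
    ⟨fun hz => Subtype.ext (h.unique (h.exists x.2 y.2).choose_spec hz),
      fun hz => hz ▸ (h.exists x.2 y.2).choose_spec⟩⟩

/-- An idempotent of a group is neutral. This shows that ring maps preserve zero, which `IsRingHom`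
does not demand. -/
theorem isUnitOf_of_op_self (hB : IsOp B op) (hc : IsCommOp B op) (ha : IsAssocOp B op)
    (hu : ∃ o, IsUnitOf B op o ∧ ∀ x, x ∈' B → ∃ y, y ∈' B ∧ Op op x y o) {y : M}
    (hy : Op op y y y) : IsUnitOf B op y := by
  obtain ⟨o, ho, hinv⟩ := hu
  obtain ⟨w, hw, hyw⟩ := hinv y (hB.mem hy).1
  obtain ⟨_, rfl, h⟩ := exists_commMonoid hB hc ha ho
  lift y to {x // x ∈' B} using (hB.mem hy).1
  lift w to {x // x ∈' B} using hw
  rw [h] at hy hyw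
  rwa [← show y = 1 by rw [← mul_one y, ← hyw, ← mul_assoc, hy] ] at ho

theorem op_mul_mul (hB : IsOp B op) (hc : IsCommOp B op) (ha : IsAssocOp B op) {e : M}
    (he : IsUnitOf B op e) {x x' y y' p q : M} (hx : Op op x x' e) (hy : Op op y y' e)
    (hp : Op op x y p) (hq : Op op x' y' q) : Op op p q e := by
  obtain ⟨_, rfl, h⟩ := exists_commMonoid hB hc ha he
  lift x to {x // x ∈' B} using (hB.mem hx).1
  lift x' to {x // x ∈' B} using (hB.mem hx).2.1
  lift y to {x // x ∈' B} using (hB.mem hy).1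
  lift y' to {x // x ∈' B} using (hB.mem hy).2.1
  lift p to {x // x ∈' B} using (hB.mem hp).2.2
  lift q to {x // x ∈' B} using (hB.mem hq).2.2
  rw [h] at *
  rw [← hp, ← hq, mul_mul_mul_comm, hx, hy, mul_one]

/-- This solves `s * u = t` for `s` when `u` has inverse `v`: a fraction is recovered from its
numerator. -/
theorem op_of_op_unit (hB : IsOp B op) (hc : IsCommOp B op) (ha : IsAssocOp B op) {e : M}
    (he : IsUnitOf B op e) {s u v t : M} (hs : Op op s u t) (hu : Op op u v e) : Op op v t s := by
  obtain ⟨_, rfl, h⟩ := exists_commMonoid hB hc ha he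
  lift s to {x // x ∈' B} using (hB.mem hs).1
  lift u to {x // x ∈' B} using (hB.mem hs).2.1
  lift t to {x // x ∈' B} using (hB.mem hs).2.2
  lift v to {x // x ∈' B} using (hB.mem hu).2.1
  rw [h] at *
  rw [← hs, mul_comm, mul_assoc, hu, mul_one]

theorem IsRing.zero_unique (hR : IsRing R b n) {o o' : M} (h : IsUnitOf R b o)
    (h' : IsUnitOf R b o') : o = o' :=
  h.unique hR.1 hR.2.2.1 h'

theorem IsRing.zero_mem (hR : IsRing R b n) {J o : M} (hJ : IsIdeal R b n J)
    (h : IsUnitOf R b o) : o ∈' J := by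
  obtain ⟨o', ho', hJo⟩ := hJ.2.1
  rwa [hR.zero_unique h ho']

/-- The ideal generated by a subset. -/
theorem IsRing.exists_span (hR : IsRing R b n) {S : M} (hS : Sub S R) :
    ∃ K, IsIdeal R b n K ∧ Sub S K ∧ ∀ J, IsIdeal R b n J → Sub S J → Sub K J := by
  -- The intersection of all ideals containing `S`, cut out of `R` by separation; the ideals
  -- themselves need not form a set.
  obtain ⟨K, hK⟩ := ZF.sep (fun x => ∀ J, IsIdeal R b n J → Sub S J → x ∈' J) R
  refine ⟨K, ⟨fun x hx => ((hK x).1 hx).1, ?_, ?_, ?_⟩,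
    fun x hx => (hK x).2 ⟨hS x hx, fun J _ hJ => hJ x hx⟩,
    fun J hJ hSJ x hx => ((hK x).1 hx).2 J hJ hSJ⟩
  · obtain ⟨o, ho, -⟩ := hR.2.2.2.2.1
    exact ⟨o, ho, (hK o).2 ⟨ho.1, fun J hJ _ => hR.zero_mem hJ ho⟩⟩
  · exact fun x hx y hy z hz => (hK z).2 ⟨(hR.1.mem hz).2.2, fun J hJ hSJ =>
      hJ.2.2.1 x (((hK x).1 hx).2 J hJ hSJ) y (((hK y).1 hy).2 J hJ hSJ) z hz⟩
  · exact fun x hx y hy z hz => (hK z).2 ⟨(hR.2.1.mem hz).2.2, fun J hJ hSJ =>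
      hJ.2.2.2 x hx y (((hK y).1 hy).2 J hJ hSJ) z hz⟩

omit [ZF M] in
/-- The union of a set of ideals that is a chain is an ideal. -/
theorem isIdeal_union {c u k : M} (hk : k ∈' c) (hu : IsUnion u c)
    (hc : ∀ J, J ∈' c → IsIdeal R b n J)
    (hchain : ∀ J, J ∈' c → ∀ K, K ∈' c → Sub J K ∨ Sub K J) : IsIdeal R b n u := by
  refine ⟨?_, ?_, ?_, ?_⟩
  · intro x hx
    obtain ⟨J, hJ, hx⟩ := (hu x).1 hx
    exact (hc J hJ).1 x hx
  · obtain ⟨o, ho, hok⟩ := (hc k hk).2.1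
    exact ⟨o, ho, (hu o).2 ⟨k, hk, hok⟩⟩
  · intro x hx y hy z hz
    obtain ⟨J, hJ, hx⟩ := (hu x).1 hx
    obtain ⟨K, hK, hy⟩ := (hu y).1 hy
    rcases hchain J hJ K hK with h | h
    · exact (hu z).2 ⟨K, hK, (hc K hK).2.2.1 x (h x hx) y hy z hz⟩
    · exact (hu z).2 ⟨J, hJ, (hc J hJ).2.2.1 x hx y (h y hy) z hz⟩
  · intro x hx y hy z hz
    obtain ⟨J, hJ, hy⟩ := (hu y).1 hy
    exact (hu z).2 ⟨J, hJ, (hc J hJ).2.2.2 x hx y hy z hz⟩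

/-- The orbit of a set under an increasing function is a chain. -/
theorem orbit_chain {s : M → M} [hs : DF s] {k c : M}
    (hc : ∀ (Q : M → Prop) [D Q], Q k → (∀ x, x ∈' c → Q x → Q (s x)) → ∀ x, x ∈' c → Q x)
    (hinc : ∀ x, Sub x (s x)) {x y : M} (hx : x ∈' c) (hy : y ∈' c) : Sub x y ∨ Sub y x := by
  have : ∀ {Γ : Type} [Ctx Γ M] (f : Γ → M) [DF f], DF fun w => s (f w) := fun f => hs.comp f
  have hk : ∀ x, x ∈' c → Sub k x := by
    exact hc _ Sub.rfl fun x _ h => h.trans (hinc x)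
  -- As in the proof of Zorn's lemma, call `y` good if `s x ⊆ y` for all `x ⊊ y` in the orbit.
  -- Nothing in the orbit lies strictly between a good `y` and `s y`.
  have hstep : ∀ y, (∀ x, x ∈' c → Sub x y → ¬ Sub y x → Sub (s x) y) → y ∈' c →
      ∀ x, x ∈' c → Sub x y ∨ Sub (s y) x := by
    intro y hgood hy
    refine hc (fun x => Sub x y ∨ Sub (s y) x) (.inl (hk y hy)) ?_
    rintro x hx (h | h)
    · by_cases h' : Sub y x
      · rw [h.antisymm h']
        exact .inr Sub.rfl
      · exact .inl (hgood x hx h h')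
    · exact .inr (h.trans (hinc x))
  -- By orbit induction every `y` is good; membership in `c` is repeated because it belongs to the
  -- inductive predicate.
  have hgood : ∀ y, y ∈' c → y ∈' c → ∀ x, x ∈' c → Sub x y → ¬ Sub y x → Sub (s x) y := by
    refine hc (fun y => y ∈' c → ∀ x, x ∈' c → Sub x y → ¬ Sub y x → Sub (s x) y) ?_ ?_
    · exact fun _ x hx _ h => absurd (hk x hx) h
    · intro y hy ih _ x hx h h'
      rcases hstep y (ih hy) hy x hx with h₁ | h₁
      · by_cases h₂ : Sub y x
        · rw [h₁.antisymm h₂]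
          exact Sub.rfl
        · exact (ih hy x hx h₁ h₂).trans (hinc y)
      · exact absurd h₁ h'
  exact (hstep y (hgood y hy hy) hy x hx).imp_right (hinc y).trans

/-- Noetherian induction for definable classes of ideals. -/
theorem IsNoetherianRing.induction (hR : IsNoetherianRing R b n) {Φ : M → Prop} [hΦ : D Φ]
    (h : ∀ K, IsIdeal R b n K → (∀ J, IsIdeal R b n J → Sub K J → ¬ Sub J K → Φ J) → Φ K)
    {K : M} (hK : IsIdeal R b n K) : Φ K := by
  have : ∀ {Γ : Type} [Ctx Γ M] (f : Γ → M) [DF f], D fun w => Φ (f w) := fun f => hΦ.comp f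
  by_contra hbad
  let Bad : M → M → Prop := fun K J => IsIdeal R b n J ∧ Sub K J ∧ ¬ Sub J K ∧ ¬ Φ J
  -- The global order makes the next bad ideal a definable function of the present one, in place of
  -- dependent choice for classes. If there is none, the value is `K`.
  have hstep : ∀ K, ∃ y, (Bad K y ∧ ∀ z, Bad K z → y ≤' z) ∨ ((¬ ∃ J, Bad K J) ∧ y = K) := by
    intro K
    by_cases hJ : ∃ J, Bad K J
    · have : D (Bad K) := by
        unfold Bad
        infer_instance
      obtain ⟨y, hy⟩ := ZF.least (Bad K) hJ
      exact ⟨y, .inl hy⟩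
    · exact ⟨K, .inr ⟨hJ, rfl⟩⟩
  choose s hs using hstep
  have hDF : DF s := by
    refine DF.of_graph (Q := fun K y =>
      (Bad K y ∧ ∀ z, Bad K z → y ≤' z) ∨ ((¬ ∃ J, Bad K J) ∧ y = K)) fun K y => ⟨?_, ?_⟩
    · rintro rfl
      exact hs K
    · rintro (hy | hy)
      · rcases hs K with h' | h'
        · exact ZF.le_antisymm _ _ (hy.2 _ h'.1) (h'.2 _ hy.1)
        · exact absurd ⟨y, hy.1⟩ h'.1
      · rcases hs K with h' | h'
        · exact absurd ⟨_, h'.1⟩ hy.1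
        · rw [hy.2, h'.2]
  have hinc : ∀ x, Sub x (s x) := by
    intro x
    rcases hs x with h' | h'
    · exact h'.1.2.1
    · rw [h'.2]
      exact Sub.rfl
  have hnext : ∀ x, IsIdeal R b n x → ¬ Φ x → Bad x (s x) := by
    intro x hx hΦx
    rcases hs x with h' | h'
    · exact h'.1
    · refine absurd (h x hx fun J hJ h₁ h₂ => ?_) hΦx
      by_contra h₃
      exact h'.1 ⟨J, hJ, h₁, h₂, h₃⟩
  obtain ⟨c, hkc, hsc, hc⟩ := exists_orbit s K
  have hcbad : ∀ x, x ∈' c → IsIdeal R b n x ∧ ¬ Φ x :=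
    hc (fun x => IsIdeal R b n x ∧ ¬ Φ x) ⟨hK, hbad⟩ fun x _ hx =>
      have := hnext x hx.1 hx.2
      ⟨this.1, this.2.2.2⟩
  obtain ⟨u, hu⟩ := ZF.union c
  have hchain : ∀ J, J ∈' c → ∀ K, K ∈' c → Sub J K ∨ Sub K J :=
    fun J hJ K hK => orbit_chain hc hinc hJ hK
  have hideal := isIdeal_union hkc hu (fun J hJ => (hcbad J hJ).1) hchain
  obtain ⟨G, hG, hGu, hgen⟩ := hR.2 u hideal
  -- A finite subset of the union of a chain lies in one of its members.
  have hfin : ∃ J, J ∈' c ∧ Sub G J := by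
    refine hG.induction (P := fun S => ∃ J, J ∈' c ∧ Sub S J)
      ⟨K, hkc, fun z hz => absurd hz (notMem_empty z)⟩ ?_
    rintro S x - hx ⟨J, hJ, hSJ⟩
    obtain ⟨J', hJ', hxJ'⟩ := (hu x).1 (hGu x hx)
    rcases hchain J hJ J' hJ' with h' | h'
    · exact ⟨J', hJ', sub_adj.2 ⟨hSJ.trans h', hxJ'⟩⟩
    · exact ⟨J, hJ, sub_adj.2 ⟨hSJ, h' x hxJ'⟩⟩
  obtain ⟨J, hJ, hGJ⟩ := hfin
  have hbadJ := hcbad J hJ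
  -- The whole union is now inside `J`, while it contains the strictly larger `s J`.
  refine (hnext J hbadJ.1 hbadJ.2).2.2.1 (Sub.trans ?_ (hgen J hbadJ.1 hGJ))
  exact fun z hz => (hu z).2 ⟨s J, hsc J hJ, hz⟩

end Algebra

end Model

namespace Model

/-! ### Sections of a sheaf of rings in a model -/

section Sections

variable {M : Type} [LSet.Structure M] [ZF M] {P T O a m r I U V W R b n h θ : M}

theorem IsFunOn.mem {f A x y : M} (hf : IsFunOn f A) (h : Val f x y) : x ∈' A := by
  obtain ⟨x', hx', y', h'⟩ := hf.1 _ (val_iff.1 h)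
  rw [isPair_iff] at h'
  rwa [(pair_eq_pair.1 h').1]

theorem IsFunOn.unique {f A x y y' : M} (hf : IsFunOn f A) (h : Val f x y) (h' : Val f x y') :
    y = y' :=
  (hf.2 x (hf.mem h)).unique h h'

theorem IsFunOn.ext {f g A : M} (hf : IsFunOn f A) (hg : IsFunOn g A)
    (h : ∀ x y, Val f x y ↔ Val g x y) : f = g := by
  refine Model.ext fun p => ?_
  have key : ∀ {f : M}, IsFunOn f A → p ∈' f → ∃ x y, p = pair x y := by
    intro f hf hp
    obtain ⟨x, -, y, hxy⟩ := hf.1 p hp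
    exact ⟨x, y, isPair_iff.1 hxy⟩
  constructor
  · intro hp
    obtain ⟨x, y, rfl⟩ := key hf hp
    exact val_iff.1 ((h x y).1 (val_iff.2 hp))
  · intro hp
    obtain ⟨x, y, rfl⟩ := key hg hp
    exact val_iff.1 ((h x y).2 (val_iff.2 hp))

theorem exists_inter (x y : M) : ∃ z, IsInter z x y := ZF.sep (fun w => w ∈' y) x

omit [ZF M] in
theorem IsInter.sub_left {x y z : M} (h : IsInter z x y) : Sub z x := fun w hw => ((h w).1 hw).1

omit [ZF M] in
theorem IsInter.sub_right {x y z : M} (h : IsInter z x y) : Sub z y := fun w hw => ((h w).1 hw).2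

theorem res_iff {U V s t : M} : Res r U V s t ↔ ∃ g, Val r (pair U V) g ∧ Val g s t := by
  simp [Res, isPair_iff]

/-- `x * y = z` for the operation of `a` on the sections over `U`. -/
def OpAt (a U x y z : M) : Prop := ∃ b, Val a U b ∧ Op b x y z

namespace IsRingedSpace

variable (hX : IsRingedSpace P T O a m r)
include hX

theorem inter_mem (hU : U ∈' T) (hV : V ∈' T) (hW : IsInter W U V) : W ∈' T := by
  obtain ⟨W', hW', h⟩ := hX.1.2.2.2 U hU V hV
  rwa [show W = W' from Model.ext fun z => (hW z).trans (h z).symm]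

theorem ringAt_iff {φ : M → M → M → Prop} {A b n : M} (hA : Val O U A) (hb : Val a U b)
    (hn : Val m U n) : RingAt O a m U φ ↔ φ A b n := by
  constructor
  · rintro ⟨A', b', n', hA', hb', hn', h⟩
    rwa [hX.2.1.unique hA hA', hX.2.2.1.unique hb hb', hX.2.2.2.1.unique hn hn']
  · exact fun h => ⟨A, b, n, hA, hb, hn, h⟩

omit [ZF M] in
theorem exists_ring (hU : U ∈' T) : ∃ A b n, Val O U A ∧ Val a U b ∧ Val m U n ∧ IsRing A b n :=
  hX.2.2.2.2.1 U hU

theorem isSection_iff {A s : M} (hA : Val O U A) : IsSection O U s ↔ s ∈' A :=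
  ⟨fun ⟨A', hA', h⟩ => by rwa [hX.2.1.unique hA hA'], fun h => ⟨A, hA, h⟩⟩

theorem addAt_iff {x y z : M} (hb : Val a U b) : OpAt a U x y z ↔ Op b x y z :=
  ⟨fun ⟨b', hb', h⟩ => by rwa [hX.2.2.1.unique hb hb'], fun h => ⟨b, hb, h⟩⟩

theorem mulAt_iff {x y z : M} (hn : Val m U n) : OpAt m U x y z ↔ Op n x y z :=
  ⟨fun ⟨b', hb', h⟩ => by rwa [hX.2.2.2.1.unique hn hb'], fun h => ⟨n, hn, h⟩⟩

theorem opens_of_res {g : M} (h : Val r (pair U V) g) : U ∈' T ∧ V ∈' T ∧ Sub V U := by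
  obtain ⟨U', hU', V', hV', p, g', hs, hp, hq⟩ := hX.2.2.2.2.2.1 _ (val_iff.1 h)
  rw [isPair_iff] at hp hq
  subst hp
  simp only [pair_eq_pair] at hq
  obtain ⟨⟨rfl, rfl⟩, rfl⟩ := hq
  exact ⟨hU', hV', hs⟩

theorem exists_res_map (hU : U ∈' T) (hV : V ∈' T) (hVU : Sub V U) :
    ∃! g, Val r (pair U V) g :=
  hX.2.2.2.2.2.2.1 U hU V hV hVU _ (isPair_iff.2 rfl)

theorem isRingHom {A b n A' b' n' g : M} (hg : Val r (pair U V) g) (hA : Val O U A)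
    (hb : Val a U b) (hn : Val m U n) (hA' : Val O V A') (hb' : Val a V b') (hn' : Val m V n') :
    IsRingHom A b n A' b' n' g := by
  obtain ⟨hU, hV, -⟩ := hX.opens_of_res hg
  have := hX.2.2.2.2.2.2.2.1 U hU V hV _ g (isPair_iff.2 rfl) hg
  rwa [hX.ringAt_iff hA hb hn, hX.ringAt_iff hA' hb' hn'] at this

theorem res_opens {s t : M} (h : Res r U V s t) : U ∈' T ∧ V ∈' T ∧ Sub V U := by
  obtain ⟨g, hg, -⟩ := res_iff.1 h
  exact hX.opens_of_res hg

theorem res_isSection {s t : M} (h : Res r U V s t) : IsSection O U s ∧ IsSection O V t := by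
  obtain ⟨g, hg, h⟩ := res_iff.1 h
  obtain ⟨hU, hV, -⟩ := hX.opens_of_res hg
  obtain ⟨A, b, n, hA, hb, hn, -⟩ := hX.exists_ring hU
  obtain ⟨A', b', n', hA', hb', hn', -⟩ := hX.exists_ring hV
  have := hX.isRingHom hg hA hb hn hA' hb' hn'
  exact ⟨⟨A, hA, this.1.1.mem h⟩, ⟨A', hA', this.1.2 _ _ h⟩⟩

theorem exists_res (hU : U ∈' T) (hV : V ∈' T) (hVU : Sub V U) {s : M} (hs : IsSection O U s) :
    ∃ t, Res r U V s t := by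
  obtain ⟨g, hg, -⟩ := hX.exists_res_map hU hV hVU
  obtain ⟨A, b, n, hA, hb, hn, -⟩ := hX.exists_ring hU
  obtain ⟨A', b', n', hA', hb', hn', -⟩ := hX.exists_ring hV
  obtain ⟨t, ht, -⟩ := (hX.isRingHom hg hA hb hn hA' hb' hn').1.1.2 s ((hX.isSection_iff hA).1 hs)
  exact ⟨t, res_iff.2 ⟨g, hg, ht⟩⟩

theorem res_unique {s t t' : M} (h : Res r U V s t) (h' : Res r U V s t') : t = t' := by
  obtain ⟨g, hg, h⟩ := res_iff.1 h
  obtain ⟨g', hg', h'⟩ := res_iff.1 h'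
  obtain ⟨hU, hV, hVU⟩ := hX.opens_of_res hg
  obtain rfl := (hX.exists_res_map hU hV hVU).unique hg hg'
  obtain ⟨A, b, n, hA, hb, hn, -⟩ := hX.exists_ring hU
  obtain ⟨A', b', n', hA', hb', hn', -⟩ := hX.exists_ring hV
  exact (hX.isRingHom hg hA hb hn hA' hb' hn').1.1.unique h h'

omit [ZF M] in
theorem res_trans {s t u : M} (h : Res r U V s t) (h' : Res r V W t u) : Res r U W s u :=
  hX.2.2.2.2.2.2.2.2.2.1 U V W s t u h h'

/-- Two restrictions of one section are compatible, by transitivity and uniqueness of restriction.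
-/
theorem res_of_res {s t u : M} (h : Res r U V s t) (h' : Res r U W s u) (hWV : Sub W V) :
    Res r V W t u := by
  obtain ⟨u', hu'⟩ := hX.exists_res (hX.res_opens h).2.1 (hX.res_opens h').2.1 hWV
    (hX.res_isSection h).2
  rwa [hX.res_unique h' (hX.res_trans h hu')]

theorem addAt_res {x y z x' y' z' : M} (h : OpAt a U x y z) (hx : Res r U V x x')
    (hy : Res r U V y y') (hz : Res r U V z z') : OpAt a V x' y' z' := by
  obtain ⟨g, hg, hx⟩ := res_iff.1 hx
  obtain ⟨hU, hV, hVU⟩ := hX.opens_of_res hg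
  obtain ⟨g', hg', hy⟩ := res_iff.1 hy
  obtain ⟨g'', hg'', hz⟩ := res_iff.1 hz
  obtain rfl := (hX.exists_res_map hU hV hVU).unique hg hg'
  obtain rfl := (hX.exists_res_map hU hV hVU).unique hg hg''
  obtain ⟨A, b, n, hA, hb, hn, -⟩ := hX.exists_ring hU
  obtain ⟨A', b', n', hA', hb', hn', -⟩ := hX.exists_ring hV
  exact ⟨b', hb', (hX.isRingHom hg hA hb hn hA' hb' hn').2.1 _ _ _ _ _ _
    ((hX.addAt_iff hb).1 h) hx hy hz⟩

theorem mulAt_res {x y z x' y' z' : M} (h : OpAt m U x y z) (hx : Res r U V x x')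
    (hy : Res r U V y y') (hz : Res r U V z z') : OpAt m V x' y' z' := by
  obtain ⟨g, hg, hx⟩ := res_iff.1 hx
  obtain ⟨hU, hV, hVU⟩ := hX.opens_of_res hg
  obtain ⟨g', hg', hy⟩ := res_iff.1 hy
  obtain ⟨g'', hg'', hz⟩ := res_iff.1 hz
  obtain rfl := (hX.exists_res_map hU hV hVU).unique hg hg'
  obtain rfl := (hX.exists_res_map hU hV hVU).unique hg hg''
  obtain ⟨A, b, n, hA, hb, hn, -⟩ := hX.exists_ring hU
  obtain ⟨A', b', n', hA', hb', hn', -⟩ := hX.exists_ring hV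
  exact ⟨n', hn', (hX.isRingHom hg hA hb hn hA' hb' hn').2.2.1 _ _ _ _ _ _
    ((hX.mulAt_iff hn).1 h) hx hy hz⟩

theorem mulAt_comm {x y z : M} (h : OpAt m U x y z) : OpAt m U y x z := by
  obtain ⟨n', hn', h⟩ := h
  obtain ⟨A, b, n, hA, hb, hn, hR⟩ := hX.exists_ring (hX.2.2.2.1.mem hn')
  obtain rfl := hX.2.2.2.1.unique hn hn'
  have := hR.2.1.mem h
  exact ⟨n, hn, hR.2.2.2.2.2.1 _ this.1 _ this.2.1 _ h⟩

/-! ### Ideal sheaves -/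

theorem isIdeal_of_isIdealSheaf (hI : IsIdealSheaf T O a m r I) (hU : U ∈' T) :
    ∃ A b n J, Val O U A ∧ Val a U b ∧ Val m U n ∧ Val I U J ∧ IsRing A b n ∧
      IsIdeal A b n J := by
  obtain ⟨A, b, n, hA, hb, hn, hR⟩ := hX.exists_ring hU
  obtain ⟨J, hJ, h⟩ := (hX.ringAt_iff hA hb hn).1 (hI.2.1 U hU)
  exact ⟨A, b, n, J, hA, hb, hn, hJ, hR, h⟩

omit hX in
theorem mem_opens_of_isSection (hI : IsIdealSheaf T O a m r I) {s : M} (h : IsSection I U s) :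
    U ∈' T :=
  let ⟨_, hJ, _⟩ := h
  hI.1.mem hJ

theorem isSection_of_isIdealSheaf (hI : IsIdealSheaf T O a m r I) {s : M} (h : IsSection I U s) :
    IsSection O U s := by
  obtain ⟨A, b, n, J, hA, hb, hn, hJ, hR, hid⟩ :=
    hX.isIdeal_of_isIdealSheaf hI (mem_opens_of_isSection hI h)
  obtain ⟨J', hJ', hs⟩ := h
  obtain rfl := hI.1.unique hJ hJ'
  exact ⟨A, hA, hid.1 s hs⟩

theorem add_mem (hI : IsIdealSheaf T O a m r I) {x y z : M} (hz : OpAt a U x y z)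
    (hx : IsSection I U x) (hy : IsSection I U y) : IsSection I U z := by
  obtain ⟨A, b, n, J, hA, hb, hn, hJ, hR, hid⟩ :=
    hX.isIdeal_of_isIdealSheaf hI (mem_opens_of_isSection hI hx)
  obtain ⟨J', hJ', hx⟩ := hx
  obtain rfl := hI.1.unique hJ hJ'
  obtain ⟨J', hJ', hy⟩ := hy
  obtain rfl := hI.1.unique hJ hJ'
  exact ⟨J, hJ, hid.2.2.1 x hx y hy z ((hX.addAt_iff hb).1 hz)⟩

theorem mul_mem (hI : IsIdealSheaf T O a m r I) {x y z : M} (hz : OpAt m U x y z)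
    (hy : IsSection I U y) : IsSection I U z := by
  obtain ⟨A, b, n, J, hA, hb, hn, hJ, hR, hid⟩ :=
    hX.isIdeal_of_isIdealSheaf hI (mem_opens_of_isSection hI hy)
  obtain ⟨J', hJ', hy⟩ := hy
  obtain rfl := hI.1.unique hJ hJ'
  have := (hX.mulAt_iff hn).1 hz
  exact ⟨J, hJ, hid.2.2.2 x (hR.2.1.mem this).1 y hy z this⟩

/-! ### Images of the elements of a ring -/

variable (hθ : RingAt O a m U fun A a' m' => IsRingHom R b n A a' m' θ)
include hθ

theorem exists_imageOn (hU : U ∈' T) (hV : V ∈' T) (hVU : Sub V U) {g : M} (hg : g ∈' R) :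
    ∃ t, ImageOn r U V θ g t := by
  obtain ⟨A, a', m', hA, -, -, h⟩ := hθ
  obtain ⟨s, hs, -⟩ := h.1.1.2 g hg
  obtain ⟨t, ht⟩ := hX.exists_res hU hV hVU ⟨A, hA, h.1.2 _ _ hs⟩
  exact ⟨t, s, hs, ht⟩

theorem imageOn_unique {g t t' : M} (h : ImageOn r U V θ g t) (h' : ImageOn r U V θ g t') :
    t = t' := by
  obtain ⟨A, a', m', hA, -, -, hθ⟩ := hθ
  obtain ⟨s, hs, h⟩ := h
  obtain ⟨s', hs', h'⟩ := h'
  obtain rfl := hθ.1.1.unique hs hs'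
  exact hX.res_unique h h'

omit hθ in
theorem imageOn_opens {g t : M} (h : ImageOn r U V θ g t) : U ∈' T ∧ V ∈' T ∧ Sub V U := by
  obtain ⟨s, -, h⟩ := h
  exact hX.res_opens h

omit hθ in
theorem imageOn_isSection {g t : M} (h : ImageOn r U V θ g t) : IsSection O V t := by
  obtain ⟨s, -, h⟩ := h
  exact (hX.res_isSection h).2

omit [ZF M] hθ in
theorem imageOn_res {g t t' : M} (h : ImageOn r U V θ g t) (h' : Res r V W t t') :
    ImageOn r U W θ g t' := by
  obtain ⟨s, hs, h⟩ := h
  exact ⟨s, hs, hX.res_trans h h'⟩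

theorem res_of_imageOn {g t t' : M} (h : ImageOn r U V θ g t) (h' : ImageOn r U W θ g t')
    (hWV : Sub W V) : Res r V W t t' := by
  obtain ⟨A, a', m', hA, -, -, hθ⟩ := hθ
  obtain ⟨s, hs, h⟩ := h
  obtain ⟨s', hs', h'⟩ := h'
  obtain rfl := hθ.1.1.unique hs hs'
  exact hX.res_of_res h h' hWV

theorem addAt_imageOn {x y z x' y' z' : M} (h : Op b x y z) (hx : ImageOn r U V θ x x')
    (hy : ImageOn r U V θ y y') (hz : ImageOn r U V θ z z') : OpAt a V x' y' z' := by
  obtain ⟨A, a', m', hA, ha, hm, hθ⟩ := hθ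
  obtain ⟨s, hs, hx⟩ := hx
  obtain ⟨t, ht, hy⟩ := hy
  obtain ⟨u, hu, hz⟩ := hz
  exact hX.addAt_res ⟨a', ha, hθ.2.1 _ _ _ _ _ _ h hs ht hu⟩ hx hy hz

theorem mulAt_imageOn {x y z x' y' z' : M} (h : Op n x y z) (hx : ImageOn r U V θ x x')
    (hy : ImageOn r U V θ y y') (hz : ImageOn r U V θ z z') : OpAt m V x' y' z' := by
  obtain ⟨A, a', m', hA, ha, hm, hθ⟩ := hθ
  obtain ⟨s, hs, hx⟩ := hx
  obtain ⟨t, ht, hy⟩ := hy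
  obtain ⟨u, hu, hz⟩ := hz
  exact hX.mulAt_res ⟨m', hm, hθ.2.2.1 _ _ _ _ _ _ h hs ht hu⟩ hx hy hz

theorem isUnitOf_imageOn {e e' A m' : M} (h : IsUnitOf R n e) (he : ImageOn r U V θ e e')
    (hA : Val O V A) (hm' : Val m V m') : IsUnitOf A m' e' := by
  obtain ⟨B, a₁, m₁, hB, ha₁, hm₁, hθ⟩ := hθ
  obtain ⟨s, hs, he⟩ := he
  obtain ⟨g, hg, he⟩ := res_iff.1 he
  obtain ⟨A', a', m'', hA', ha', hm'', -⟩ := hX.exists_ring (hX.opens_of_res hg).2.1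
  obtain rfl := hX.2.1.unique hA hA'
  obtain rfl := hX.2.2.2.1.unique hm' hm''
  exact (hX.isRingHom hg hB ha₁ hm₁ hA ha' hm').2.2.2 _ _ (hθ.2.2.2 _ _ h hs) he

/-- The elements of `R` whose image is, on some member of a directed family of open sets, a section
of the ideal sheaf `I`, form an ideal. -/
theorem isIdeal_of_imageOn (hR : IsRing R b n) (hI : IsIdealSheaf T O a m r I) {𝒲 : M → Prop}
    (hne : ∃ W, 𝒲 W) (h𝒲 : ∀ W, 𝒲 W → W ∈' T ∧ Sub W U)
    (hdir : ∀ V W Z, 𝒲 V → 𝒲 W → IsInter Z V W → 𝒲 Z) {L : M}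
    (hL : ∀ g, g ∈' L ↔ g ∈' R ∧ ∃ W, 𝒲 W ∧ ∃ t, ImageOn r U W θ g t ∧ IsSection I W t) :
    IsIdeal R b n L := by
  have hU : U ∈' T := by
    obtain ⟨A, a', m', hA, -⟩ := hθ
    exact hX.2.1.mem hA
  have key : ∀ W, 𝒲 W → ∀ g, g ∈' R → ∃ t, ImageOn r U W θ g t := fun W hW g hg =>
    hX.exists_imageOn hθ hU (h𝒲 W hW).1 (h𝒲 W hW).2 hg
  refine ⟨fun g hg => ((hL g).1 hg).1, ?_, ?_, ?_⟩
  · obtain ⟨o, ho, -⟩ := hR.2.2.2.2.1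
    obtain ⟨W, hW⟩ := hne
    obtain ⟨t, ht⟩ := key W hW o ho.1
    refine ⟨o, ho, (hL o).2 ⟨ho.1, W, hW, t, ht, ?_⟩⟩
    obtain ⟨A, a', m', J, hA, ha', hm', hJ, hRA, hid⟩ := hX.isIdeal_of_isIdealSheaf hI (h𝒲 W hW).1
    -- The image of `0` is additively idempotent, hence zero.
    refine ⟨J, hJ, hRA.zero_mem hid (isUnitOf_of_op_self hRA.1 hRA.2.2.1 hRA.2.2.2.1
      hRA.2.2.2.2.1 ?_)⟩
    exact (hX.addAt_iff ha').1 (hX.addAt_imageOn hθ (ho.2 o ho.1) ht ht ht)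
  · intro x hx y hy z hz
    obtain ⟨hxR, V, hV, s, hs, hsI⟩ := (hL x).1 hx
    obtain ⟨hyR, W, hW, t, ht, htI⟩ := (hL y).1 hy
    obtain ⟨Z, hZ⟩ := exists_inter V W
    have hZ' := hdir V W Z hV hW hZ
    have hzR := (hR.1.mem hz).2.2
    obtain ⟨s', hs'⟩ := key Z hZ' x hxR
    obtain ⟨t', ht'⟩ := key Z hZ' y hyR
    obtain ⟨u, hu⟩ := key Z hZ' z hzR
    exact (hL z).2 ⟨hzR, Z, hZ', u, hu, hX.add_mem hI (hX.addAt_imageOn hθ hz hs' ht' hu)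
      (hI.2.2.1 _ _ _ _ hsI (hX.res_of_imageOn hθ hs hs' hZ.sub_left))
      (hI.2.2.1 _ _ _ _ htI (hX.res_of_imageOn hθ ht ht' hZ.sub_right))⟩
  · intro x hxR y hy z hz
    obtain ⟨hyR, W, hW, t, ht, htI⟩ := (hL y).1 hy
    have hzR := (hR.2.1.mem hz).2.2
    obtain ⟨s, hs⟩ := key W hW x hxR
    obtain ⟨u, hu⟩ := key W hW z hzR
    exact (hL z).2 ⟨hzR, W, hW, u, hu, hX.mul_mem hI (hX.mulAt_imageOn hθ hz hs ht hu) htI⟩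

/-- The image of a power of an element with invertible image has an inverse. -/
theorem exists_inverse_of_isPower (hR : IsRing R b n) (hU : U ∈' T) (hV : V ∈' T) (hVU : Sub V U)
    {f k A m' e : M} (hf : f ∈' R) (hk : IsPower R n f k) (hA : Val O V A) (hm : Val m V m')
    (he : IsUnitOf A m' e)
    (hinv : ∀ t, ImageOn r U V θ f t → ∃ v, v ∈' A ∧ Op m' t v e) :
    ∃ t v, ImageOn r U V θ k t ∧ Op m' t v e := by
  obtain ⟨A', a', m'', hA', ha', hm', hRA⟩ := hX.exists_ring hV
  obtain rfl := hX.2.1.unique hA hA'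
  obtain rfl := hX.2.2.2.1.unique hm hm'
  obtain ⟨-, hmul, -, -, -, hcomm, hassoc, -⟩ := hRA
  -- Powers are defined by closure, so it is enough that the elements with invertible image contain
  -- `1` and are closed under multiplication by `f`.
  obtain ⟨S, hS⟩ := ZF.sep (fun x => ∃ t v, ImageOn r U V θ x t ∧ Op m' t v e) R
  refine ((hS k).1 (hk S ?_ ?_)).2
  · obtain ⟨i, hi⟩ := hR.2.2.2.2.2.2.2.1
    obtain ⟨t, ht⟩ := hX.exists_imageOn hθ hU hV hVU hi.1
    have := (hX.isUnitOf_imageOn hθ hi ht hA hm)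
    exact ⟨i, hi, (hS i).2 ⟨hi.1, t, e, ht, this.2 e he.1⟩⟩
  · intro y hy z hz
    obtain ⟨hyR, t, v, ht, hv⟩ := (hS y).1 hy
    have hzR := (hR.2.1.mem hz).2.2
    obtain ⟨s, hs⟩ := hX.exists_imageOn hθ hU hV hVU hf
    obtain ⟨w, hw, hsw⟩ := hinv s hs
    obtain ⟨u, hu⟩ := hX.exists_imageOn hθ hU hV hVU hzR
    have h₁ := (hX.mulAt_iff hm).1 (hX.mulAt_imageOn hθ hz ht hs hu)
    obtain ⟨q, hq⟩ := hmul.exists (hmul.mem hv).2.1 hw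
    exact (hS z).2 ⟨hzR, u, q, hu, op_mul_mul hmul hcomm hassoc he hv hsw h₁ hq⟩

end IsRingedSpace

end Sections

end Model

namespace Model

/-! ### Finite generation of ideal sheaves -/

section Generation

variable {M : Type} [LSet.Structure M] [ZF M] {Γ : Type} [Ctx Γ M]
  {P T O a m r I U V W R b n h θ : M}

/-- Every pair `(W, s)` in `F` consists of an open set and a section of `I` on it. -/
def Inside (F I : M) : Prop := ∀ W s, pair W s ∈' F → IsSection I W s

instance D_Inside (f g : Γ → M) [DF f] [DF g] : D fun w => Inside (f w) (g w) :=
  D.comp (P := fun w : M × M => Inside w.1 w.2) (by unfold Inside; infer_instance)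
    fun w => (f w, g w)

/-- Near the point `x`, the sections of `I` belong to each ideal sheaf that contains `F`. -/
def GeneratesAt (T O a m r I F x : M) : Prop :=
  ∀ J, IsIdealSheaf T O a m r J → Inside F J → ∀ W, x ∈' W → ∀ s, IsSection I W s →
    ∃ Z, Z ∈' T ∧ x ∈' Z ∧ Sub Z W ∧ ∃ t, Res r W Z s t ∧ IsSection J Z t

instance D_GeneratesAt (f g : Γ → M) [DF f] [DF g] :
    D fun w => GeneratesAt T O a m r I (f w) (g w) :=
  D.comp (P := fun w : M × M => GeneratesAt T O a m r I w.1 w.2)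
    (by unfold GeneratesAt; infer_instance) fun w => (f w, g w)

theorem Inside.mono {F F' : M} (h : Inside F' I) (hF : Sub F F') : Inside F I :=
  fun W s hs => h W s (hF _ hs)

theorem GeneratesAt.mono {F F' x : M} (h : GeneratesAt T O a m r I F x) (hF : Sub F F') :
    GeneratesAt T O a m r I F' x :=
  fun J hJ hFJ => h J hJ (hFJ.mono hF)

theorem inside_adj {F s : M} (hF : Inside F I) (hs : IsSection I W s) :
    Inside (adj F (pair W s)) I := by
  intro W' s' h'
  rcases mem_adj.1 h' with h' | h'
  · exact hF _ _ h'
  · obtain ⟨rfl, rfl⟩ := pair_eq_pair.1 h'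
    exact hs

variable (hX : IsRingedSpace P T O a m r) (hR : IsRing R b n)
  (hS : IsSpecVia T O a m r U R b n h θ)

include hX hS in
theorem IsSpecVia.mem_opens : U ∈' T := by
  obtain ⟨A, a', m', hA, -⟩ := hS.2.2.2.2.1
  exact hX.2.1.mem hA

include hX hS in
-- Distinguished open sets form a basis: the part of `V` in `U` is the complement of some V(J), and
-- any `f` in `J` outside `q` serves.
theorem IsSpecVia.exists_notMem {x q : M} (hV : V ∈' T) (hxV : x ∈' V) (hx : Val h x q) :
    ∃ f, f ∈' R ∧ ¬ f ∈' q ∧ ∀ y p, Val h y p → ¬ f ∈' p → y ∈' V := by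
  obtain ⟨Z, hZ⟩ := exists_inter V U
  obtain ⟨J, hJ, h'⟩ := (hS.2.2.2.1 Z hZ.sub_right).1
    (hX.inter_mem hV (hS.mem_opens hX) hZ)
  have hxU := hS.1.mem hx
  obtain ⟨p, hp, hJp⟩ := (h' x hxU).1 ((hZ x).2 ⟨hxV, hxU⟩)
  obtain rfl := hS.1.unique hp hx
  simp only [Sub, not_forall] at hJp
  obtain ⟨f, hf, hfp⟩ := hJp
  refine ⟨f, hJ.1 f hf, hfp, fun y q hy hq => hZ.sub_left y ?_⟩
  exact (h' y (hS.1.mem hy)).2 ⟨q, hy, fun hJq => hq (hJq f hf)⟩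

include hR hS in
-- The set D(f) is open as the complement of V(J) for the ideal `J` generated by `f`.
theorem IsSpecVia.exists_isDistinguished {f : M} (hf : f ∈' R) :
    ∃ V, V ∈' T ∧ IsDistinguished h U f V := by
  obtain ⟨V, hV⟩ := ZF.sep (fun x => ∃ p, Val h x p ∧ ¬ f ∈' p) U
  have hVU : Sub V U := fun x hx => ((hV x).1 hx).1
  obtain ⟨K, hK, hfK, hmin⟩ := hR.exists_span (S := adj empty f)
    (sub_adj.2 ⟨fun z hz => absurd hz (notMem_empty z), hf⟩)
  refine ⟨V, (hS.2.2.2.1 V hVU).2 ⟨K, hK, fun x hx => ?_⟩, hVU, fun x hx => ?_⟩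
  · rw [hV]
    refine ⟨?_, ?_⟩
    · rintro ⟨-, p, hp, hfp⟩
      exact ⟨p, hp, fun hKp => hfp (hKp f (hfK f (by simp)))⟩
    · rintro ⟨p, hp, hKp⟩
      refine ⟨hx, p, hp, fun hfp => hKp (hmin p (hS.2.1 x p hp).1 (sub_adj.2 ⟨?_, hfp⟩))⟩
      exact fun z hz => absurd hz (notMem_empty z)
  · rw [hV]
    exact ⟨fun h => h.2, fun h => ⟨hx, h⟩⟩

include hX hR hS in
/-- If the elements of `R` whose images are sections of `I` near the point `y` have images in `J`
on `W`, then the sections of `I` are in `J` near each specialization of `y` in `W`. -/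
theorem IsSpecVia.exists_res_mem {J x y p q s : M} (hI : IsIdealSheaf T O a m r I)
    (hJ : IsIdealSheaf T O a m r J)
    (hIJ : ∀ g, g ∈' R → ∀ V, y ∈' V → ∀ t, ImageOn r U V θ g t → IsSection I V t →
      ∃ t', ImageOn r U W θ g t' ∧ IsSection J W t')
    (hx : Val h x q) (hy : Val h y p) (hpq : Sub p q) (hxW : x ∈' W) (hxV : x ∈' V)
    (hs : IsSection I V s) :
    ∃ Z, Z ∈' T ∧ x ∈' Z ∧ Sub Z V ∧ ∃ t, Res r V Z s t ∧ IsSection J Z t := by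
  have hθ := hS.2.2.2.2.1
  have hV := IsRingedSpace.mem_opens_of_isSection hI hs
  obtain ⟨f, hf, hfq, hfV⟩ := hS.exists_notMem hX hV hxV hx
  obtain ⟨N, hN, hNU, hNf⟩ := hS.exists_isDistinguished hR hf
  have hNV : Sub N V := fun z hz => by
    obtain ⟨p', hp', hfp'⟩ := (hNf z (hNU z hz)).1 hz
    exact hfV z p' hp' hfp'
  have hxN : x ∈' N := (hNf x (hS.1.mem hx)).2 ⟨q, hx, hfq⟩
  -- A neighbourhood of the specialization `x` contains `y` too; this carries information from `y`
  -- to `x`.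
  have hyN : y ∈' N := (hNf y (hS.1.mem hy)).2 ⟨p, hy, fun h => hfq (hpq f h)⟩
  obtain ⟨s', hs'⟩ := hX.exists_res hV hN hNV (hX.isSection_of_isIdealSheaf hI hs)
  have hsI := hI.2.2.1 _ _ _ _ hs hs'
  obtain ⟨A, a', m', hA, ha', hm', hRA⟩ := hX.exists_ring hN
  have hloc := (hX.ringAt_iff hA ha' hm').1 (hS.2.2.2.2.2 f hf N hN ⟨hNU, hNf⟩)
  -- On D(f) the section is `g/k` with `k` a power of `f`. Its numerator is again a section of `I`
  -- near `y`, so `hIJ` puts the image of `g` on `W` into `J`.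
  obtain ⟨k, -, hpow, g, hg, u, t, hu, ht, hsu⟩ := hloc.2.1 s'
    ((hX.isSection_iff hA).1 (hX.isSection_of_isIdealSheaf hI hsI))
  have htI : IsSection I N t :=
    hX.mul_mem hI (hX.mulAt_comm ((hX.mulAt_iff hm').2 hsu)) hsI
  obtain ⟨w, hw, hwJ⟩ := hIJ g hg N hyN t ht htI
  obtain ⟨-, hmul, -, -, -, hcomm, hassoc, ⟨e, he⟩, -⟩ := hRA
  obtain ⟨u', v, hu', huv⟩ := hX.exists_inverse_of_isPower hθ hR (hS.mem_opens hX) hN hNU hf hpow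
    hA hm' he fun t ht => by
      obtain ⟨v, hv, e', he', h⟩ := hloc.1 t ht
      obtain rfl := he.unique hmul hcomm he'
      exact ⟨v, hv, h⟩
  obtain rfl := hX.imageOn_unique hθ hu hu'
  have hvt := op_of_op_unit hmul hcomm hassoc he hsu huv
  -- On the intersection, `k` is invertible and the numerator lies in `J`, hence so does the
  -- section.
  obtain ⟨Z, hZ⟩ := exists_inter W N
  have hZT := hX.inter_mem (hX.imageOn_opens hw).2.1 hN hZ
  obtain ⟨v', hv'⟩ := hX.exists_res hN hZT hZ.sub_right ⟨A, hA, (hmul.mem hvt).1⟩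
  obtain ⟨t', ht'⟩ := hX.exists_res hN hZT hZ.sub_right (hX.imageOn_isSection ht)
  obtain ⟨s'', hs''⟩ := hX.exists_res hN hZT hZ.sub_right ⟨A, hA, (hmul.mem hvt).2.2⟩
  refine ⟨Z, hZT, (hZ x).2 ⟨hxW, hxN⟩, hZ.sub_right.trans hNV, s'', hX.res_trans hs' hs'', ?_⟩
  refine hX.mul_mem hJ (hX.mulAt_res ((hX.mulAt_iff hm').2 hvt) hv' ht' hs'') ?_
  exact hJ.2.2.1 _ _ _ _ hwJ
    (hX.res_of_imageOn hθ hw (hX.imageOn_res ht ht') hZ.sub_left)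

variable {𝓕 A : M}

include hX in
/-- Finitely many elements of a ring whose images are sections of `I` near `y` have this property on
a common neighbourhood, and a finite set of sections includes these images. -/
theorem exists_common_neighbourhood {G y F₀ : M} (hU : U ∈' T) (hy : y ∈' U)
    (hG : IsFinite G)
    (hI : IsIdealSheaf T O a m r I) (hA : ∀ W s, IsSection O W s → pair W s ∈' A)
    (h𝓕 : ∀ F, F ∈' 𝓕 → ∀ x, x ∈' A → adj F x ∈' 𝓕) (hF₀ : F₀ ∈' 𝓕) (hF₀I : Inside F₀ I)
    (hGy : ∀ g, g ∈' G → g ∈' R ∧ ∃ V, y ∈' V ∧ ∃ t, ImageOn r U V θ g t ∧ IsSection I V t) :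
    ∃ W, W ∈' T ∧ y ∈' W ∧ Sub W U ∧ ∃ F, F ∈' 𝓕 ∧ Sub F₀ F ∧ Inside F I ∧
      ∀ g, g ∈' G → ∃ t, ImageOn r U W θ g t ∧ pair W t ∈' F := by
  have hW : ∃ W, W ∈' T ∧ y ∈' W ∧ Sub W U ∧
      ∀ g, g ∈' G → ∃ t, ImageOn r U W θ g t ∧ IsSection I W t := by
    refine hG.induction (P := fun S => ∃ W, W ∈' T ∧ y ∈' W ∧ Sub W U ∧
      ∀ g, g ∈' S → ∃ t, ImageOn r U W θ g t ∧ IsSection I W t)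
      ⟨U, hU, hy, Sub.rfl, fun g hg => absurd hg (notMem_empty g)⟩ ?_
    rintro S g₀ hSG hg₀ ⟨W, hW, hyW, hWU, h⟩
    obtain ⟨hg₀R, V, hyV, t, ht, htI⟩ := hGy g₀ hg₀
    obtain ⟨Z, hZ⟩ := exists_inter W V
    have hZT := hX.inter_mem hW (hX.imageOn_opens ht).2.1 hZ
    refine ⟨Z, hZT, (hZ y).2 ⟨hyW, hyV⟩, hZ.sub_left.trans hWU, fun g hg => ?_⟩
    rcases mem_adj.1 hg with hg | rfl
    · obtain ⟨t, ht, htI⟩ := h g hg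
      obtain ⟨t', ht'⟩ := hX.exists_res hW hZT hZ.sub_left (hX.imageOn_isSection ht)
      exact ⟨t', hX.imageOn_res ht ht', hI.2.2.1 _ _ _ _ htI ht'⟩
    · obtain ⟨t', ht'⟩ := hX.exists_res (hX.imageOn_opens ht).2.1 hZT hZ.sub_right
        (hX.imageOn_isSection ht)
      exact ⟨t', hX.imageOn_res ht ht', hI.2.2.1 _ _ _ _ htI ht'⟩
  obtain ⟨W, hW, hyW, hWU, h⟩ := hW
  refine ⟨W, hW, hyW, hWU, ?_⟩
  -- Pairs are adjoined only after `W` is fixed, so that all of them have the same open set.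
  refine hG.induction (P := fun S => ∃ F, F ∈' 𝓕 ∧ Sub F₀ F ∧ Inside F I ∧
    ∀ g, g ∈' S → ∃ t, ImageOn r U W θ g t ∧ pair W t ∈' F)
    ⟨F₀, hF₀, Sub.rfl, hF₀I, fun g hg => absurd hg (notMem_empty g)⟩ ?_
  rintro S g₀ hSG hg₀ ⟨F, hF, hF₀F, hFI, hFS⟩
  obtain ⟨t, ht, htI⟩ := h g₀ hg₀
  refine ⟨adj F (pair W t), h𝓕 F hF _ (hA _ _ (hX.imageOn_isSection ht)),
    fun z hz => mem_adj.2 (.inl (hF₀F z hz)), inside_adj hFI htI, fun g hg => ?_⟩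
  rcases mem_adj.1 hg with hg | rfl
  · obtain ⟨t, ht, htF⟩ := hFS g hg
    exact ⟨t, ht, mem_adj.2 (.inl htF)⟩
  · exact ⟨t, ht, mem_adj.2 (.inr rfl)⟩

include hX in
-- Noetherian induction on `K` for generation at the points of V(K), then `K` is the least ideal.
-- The arbitrary start `F₀` lets successive constructions accumulate, and generation persists when
-- `F` grows.
theorem exists_generatesAt_of_affine {F₀ : M} (hR : IsNoetherianRing R b n)
    (hS : IsSpecVia T O a m r U R b n h θ)
    (hI : IsIdealSheaf T O a m r I) (hA : ∀ W s, IsSection O W s → pair W s ∈' A)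
    (h𝓕 : ∀ F, F ∈' 𝓕 → ∀ x, x ∈' A → adj F x ∈' 𝓕) (hF₀ : F₀ ∈' 𝓕) (hF₀I : Inside F₀ I) :
    ∃ F, F ∈' 𝓕 ∧ Sub F₀ F ∧ Inside F I ∧ ∀ x, x ∈' U → GeneratesAt T O a m r I F x := by
  have hU := hS.mem_opens hX
  have hθ := hS.2.2.2.2.1
  have key : ∀ K, IsIdeal R b n K → ∀ F₀, F₀ ∈' 𝓕 → Inside F₀ I → ∃ F, F ∈' 𝓕 ∧ Sub F₀ F ∧
      Inside F I ∧ ∀ x q, Val h x q → Sub K q → GeneratesAt T O a m r I F x := by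
    intro K hK
    refine hR.induction (Φ := fun K => ∀ F₀, F₀ ∈' 𝓕 → Inside F₀ I → ∃ F, F ∈' 𝓕 ∧ Sub F₀ F ∧
      Inside F I ∧ ∀ x q, Val h x q → Sub K q → GeneratesAt T O a m r I F x) ?_ hK
    intro K hK ih F₀ hF₀ hF₀I
    -- The induction hypothesis for the ideal generated by `K` and `f`, stated for the points of
    -- V(K) where `f` vanishes.
    have ih' : ∀ f, f ∈' R → ¬ f ∈' K → ∀ F₀, F₀ ∈' 𝓕 → Inside F₀ I → ∃ F, F ∈' 𝓕 ∧ Sub F₀ F ∧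
        Inside F I ∧ ∀ x q, Val h x q → Sub K q → f ∈' q → GeneratesAt T O a m r I F x := by
      intro f hf hfK F₀ hF₀ hF₀I
      obtain ⟨J, hJ, hKJ, hmin⟩ := hR.1.exists_span (sub_adj.2 ⟨hK.1, hf⟩)
      rw [sub_adj] at hKJ
      obtain ⟨F, hF, h₁, h₂, h₃⟩ := ih J hJ hKJ.1 (fun h' => hfK (h' f hKJ.2)) F₀ hF₀ hF₀I
      exact ⟨F, hF, h₁, h₂, fun x q hx hKq hfq =>
        h₃ x q hx (hmin q (hS.2.1 x q hx).1 (sub_adj.2 ⟨hKq, hfq⟩))⟩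
    by_cases hne : ∃ x, x ∈' R ∧ ¬ x ∈' K
    swap
    · refine ⟨F₀, hF₀, Sub.rfl, hF₀I, fun x q hx hKq => ?_⟩
      obtain ⟨z, hz, hzq⟩ := (hS.2.1 x q hx).2.1
      exact absurd ⟨z, hz, fun h' => hzq (hKq z h')⟩ hne
    by_cases hprime : ∀ x, x ∈' R → ∀ y, y ∈' R → ∀ z, z ∈' K → Op n x y z → (x ∈' K ∨ y ∈' K)
    swap
    · push Not at hprime
      obtain ⟨f, hf, g, hg, z, hz, hfg, hfK, hgK⟩ := hprime
      obtain ⟨F, hF, h₁, h₂, h₃⟩ := ih' f hf hfK F₀ hF₀ hF₀I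
      obtain ⟨F', hF', h₁', h₂', h₃'⟩ := ih' g hg hgK F hF h₂
      refine ⟨F', hF', h₁.trans h₁', h₂', fun x q hx hKq => ?_⟩
      rcases (hS.2.1 x q hx).2.2 f hf g hg z (hKq z hz) hfg with h' | h'
      · exact (h₃ x q hx hKq h').mono h₁'
      · exact h₃' x q hx hKq h'
    -- Now `K` is prime, and `y` is the generic point of V(K).
    obtain ⟨y, hy, -⟩ := hS.2.2.1 K ⟨hK, hne, hprime⟩
    have hyU := hS.1.mem hy
    obtain ⟨L, hL⟩ := ZF.sep
      (fun g => ∃ V, (V ∈' T ∧ y ∈' V ∧ Sub V U) ∧ ∃ t, ImageOn r U V θ g t ∧ IsSection I V t) R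
    have hLideal : IsIdeal R b n L := by
      refine hX.isIdeal_of_imageOn hθ hR.1 hI ⟨U, hU, hyU, Sub.rfl⟩ (fun W hW => ⟨hW.1, hW.2.2⟩) ?_
        hL
      rintro V W Z ⟨hV, hyV, hVU⟩ ⟨hW, hyW, -⟩ hZ
      exact ⟨hX.inter_mem hV hW hZ, (hZ y).2 ⟨hyV, hyW⟩, hZ.sub_left.trans hVU⟩
    obtain ⟨G, hG, hGL, hgen⟩ := hR.2 L hLideal
    obtain ⟨W, hW, hyW, hWU, F, hF, hF₀F, hFI, hGF⟩ := exists_common_neighbourhood hX hU hyU hG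
      hI hA h𝓕 hF₀ hF₀I fun g hg => by
        obtain ⟨hgR, V, ⟨-, hyV, -⟩, h'⟩ := (hL g).1 (hGL g hg)
        exact ⟨hgR, V, hyV, h'⟩
    -- Points of V(K) with `f` in their prime are left to `ih'`; all others lie in `W`.
    obtain ⟨f, hf, hfK, hfW⟩ := hS.exists_notMem hX hW hyW hy
    obtain ⟨F', hF', h₁, h₂, h₃⟩ := ih' f hf hfK F hF hFI
    refine ⟨F', hF', hF₀F.trans h₁, h₂, fun x q hx hKq => ?_⟩
    by_cases hfq : f ∈' q
    · exact h₃ x q hx hKq hfq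
    intro J hJ hF'J V hxV s hs
    -- The elements whose images on the fixed set `W` belong to `J` form an ideal containing the
    -- generators of `L`, hence `L`. The family with the one member `W` is a directed family.
    obtain ⟨L', hL'⟩ := ZF.sep
      (fun g => ∃ V, V = W ∧ ∃ t, ImageOn r U V θ g t ∧ IsSection J V t) R
    have hL'ideal : IsIdeal R b n L' := by
      refine hX.isIdeal_of_imageOn hθ hR.1 hJ (𝒲 := fun V => V = W) ⟨W, rfl⟩ ?_ ?_ hL'
      · rintro _ rfl
        exact ⟨hW, hWU⟩
      · rintro _ _ Z rfl rfl hZ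
        exact Model.ext fun z => (hZ z).trans and_self_iff
    have hLL' : Sub L L' := hgen L' hL'ideal fun g hg => by
      obtain ⟨t, ht, htF⟩ := hGF g hg
      exact (hL' g).2 ⟨((hL g).1 (hGL g hg)).1, W, rfl, t, ht, hF'J _ _ (h₁ _ htF)⟩
    refine hS.exists_res_mem hX hR.1 hI hJ (W := W) ?_ hx hy hKq (hfW x q hx hfq) hxV hs
    intro g hg N hyN t ht htI
    obtain ⟨-, _, rfl, h'⟩ := (hL' g).1 <| hLL' g <| (hL g).2
      ⟨hg, N, ⟨(hX.imageOn_opens ht).2.1, hyN, (hX.imageOn_opens ht).2.2⟩, t, ht, htI⟩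
    exact h'
  obtain ⟨K, hK, -, hmin⟩ := hR.1.exists_span (S := empty) fun z hz => absurd hz (notMem_empty z)
  obtain ⟨F, hF, h₁, h₂, h₃⟩ := key K hK F₀ hF₀ hF₀I
  refine ⟨F, hF, h₁, h₂, fun x hx => ?_⟩
  obtain ⟨q, hq, -⟩ := hS.1.2 x hx
  exact h₃ x q hq (hmin q (hS.2.1 x q hq).1 fun z hz => absurd hz (notMem_empty z))

end Generation

end Model

namespace Model

/-! ### The set of ideal sheaves -/

section IdealSheaves

variable {M : Type} [LSet.Structure M] [ZF M] {Γ : Type} [Ctx Γ M] {P T O a m r I J : M}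

theorem IsIdealSheaf.ext (hI : IsIdealSheaf T O a m r I) (hJ : IsIdealSheaf T O a m r J)
    (h : ∀ U s, IsSection I U s ↔ IsSection J U s) : I = J := by
  refine hI.1.ext hJ.1 fun U K => ?_
  by_cases hU : U ∈' T
  · obtain ⟨K₁, hK₁, -⟩ := hI.1.2 U hU
    obtain ⟨K₂, hK₂, -⟩ := hJ.1.2 U hU
    obtain rfl : K₁ = K₂ := by
      refine Model.ext fun s => ⟨fun hs => ?_, fun hs => ?_⟩
      · obtain ⟨K', hK', h'⟩ := (h U s).1 ⟨K₁, hK₁, hs⟩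
        rwa [hJ.1.unique hK₂ hK']
      · obtain ⟨K', hK', h'⟩ := (h U s).2 ⟨K₂, hK₂, hs⟩
        rwa [hI.1.unique hK₁ hK']
    exact ⟨fun h' => by rwa [hI.1.unique h' hK₁], fun h' => by rwa [hJ.1.unique h' hK₂]⟩
  · exact ⟨fun h' => absurd (hI.1.mem h') hU, fun h' => absurd (hJ.1.mem h') hU⟩

/-- An ideal sheaf that contains a section locally contains it. -/
theorem IsRingedSpace.isSection_of_locally (hX : IsRingedSpace P T O a m r)
    (hJ : IsIdealSheaf T O a m r J) {U s : M} (hs : IsSection O U s) (hU : U ∈' T)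
    (hloc : ∀ x, x ∈' U → ∃ Z, Z ∈' T ∧ x ∈' Z ∧ Sub Z U ∧ ∃ t, Res r U Z s t ∧ IsSection J Z t) :
    IsSection J U s := by
  obtain ⟨C, hC⟩ := ZF.sep (fun Z => Sub Z U ∧ ∃ t, Res r U Z s t ∧ IsSection J Z t) T
  have hCT : Sub C T := fun Z hZ => ((hC Z).1 hZ).1
  have hUC : IsUnion U C := by
    refine fun x => ⟨fun hx => ?_, ?_⟩
    · obtain ⟨Z, hZ, hxZ, h⟩ := hloc x hx
      exact ⟨Z, (hC Z).2 ⟨hZ, h⟩, hxZ⟩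
    · rintro ⟨Z, hZ, hxZ⟩
      exact ((hC Z).1 hZ).2.1 x hxZ
  obtain ⟨c, hc⟩ := ZF.repl (fun Z p => ∃ t, Res r U Z s t ∧ p = pair Z t) C fun Z hZ => by
    obtain ⟨-, -, t, ht, -⟩ := (hC Z).1 hZ
    refine ⟨pair Z t, ⟨t, ht, rfl⟩, ?_⟩
    rintro _ ⟨t', ht', rfl⟩
    rw [hX.res_unique ht ht']
  have hval : ∀ Z t, Val c Z t ↔ Z ∈' C ∧ Res r U Z s t := by
    intro Z t
    rw [val_iff, hc]
    constructor
    · rintro ⟨Z', hZ', t', ht', h⟩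
      obtain ⟨rfl, rfl⟩ := pair_eq_pair.1 h
      exact ⟨hZ', ht'⟩
    · rintro ⟨hZ, ht⟩
      exact ⟨Z, hZ, t, ht, rfl⟩
  have hcC : IsFunOn c C := by
    constructor
    · intro p hp
      obtain ⟨Z, hZ, t, -, rfl⟩ := (hc p).1 hp
      exact ⟨Z, hZ, t, isPair_iff.2 rfl⟩
    · intro Z hZ
      obtain ⟨-, -, t, ht, -⟩ := (hC Z).1 hZ
      exact ⟨t, (hval Z t).2 ⟨hZ, ht⟩,
        fun t' ht' => hX.res_unique ((hval Z t').1 ht').2 ht⟩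
  have hsec : ∀ Z t, Val c Z t → IsSection J Z t := by
    intro Z t ht
    obtain ⟨hZ, ht⟩ := (hval Z t).1 ht
    obtain ⟨-, -, t', ht', hJt'⟩ := (hC Z).1 hZ
    rwa [hX.res_unique ht ht']
  have hcompat : ∀ V W t t', Val c V t → Val c W t' → ∀ Z, IsInter Z V W →
      ∃ u, Res r V Z t u ∧ Res r W Z t' u := by
    intro V W t t' ht ht' Z hZ
    obtain ⟨hV, ht⟩ := (hval V t).1 ht
    obtain ⟨hW, ht'⟩ := (hval W t').1 ht'
    obtain ⟨u, hu⟩ := hX.exists_res hU (hX.inter_mem (hCT V hV) (hCT W hW) hZ)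
      (hZ.sub_left.trans (hX.res_opens ht).2.2) hs
    exact ⟨u, hX.res_of_res ht hu hZ.sub_left, hX.res_of_res ht' hu hZ.sub_right⟩
  -- The restrictions of `s` glue in `J` to some `s'`; uniqueness of gluing in `O` identifies `s'`
  -- with `s`.
  obtain ⟨s', ⟨hs', hs'c⟩, -⟩ := hJ.2.2.2 U hU C hCT hUC c hcC hsec hcompat
  have hO := hX.2.2.2.2.2.2.2.2.2.2 U hU C hCT hUC c hcC
    (fun Z t ht => hX.isSection_of_isIdealSheaf hJ (hsec Z t ht)) hcompat
  rwa [hO.unique ⟨hs, fun V t ht => ((hval V t).1 ht).2⟩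
    ⟨hX.isSection_of_isIdealSheaf hJ hs', hs'c⟩]

theorem IsRingedSpace.isSection_of_generatesAt (hX : IsRingedSpace P T O a m r)
    (hI : IsIdealSheaf T O a m r I) (hJ : IsIdealSheaf T O a m r J) {F : M} (hFJ : Inside F J)
    (hF : ∀ x, x ∈' P → GeneratesAt T O a m r I F x) {U s : M} (hs : IsSection I U s) :
    IsSection J U s := by
  have hU := mem_opens_of_isSection hI hs
  exact hX.isSection_of_locally hJ (hX.isSection_of_isIdealSheaf hI hs) hU
    fun x hx => hF x (hX.1.1 U hU x hx) J hJ hFJ U hx s hs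

/-- The product of `T` with the union of all section rings is enough: an upper bound is needed, not
the exact set. -/
theorem IsRingedSpace.exists_pairs (hX : IsRingedSpace P T O a m r) :
    ∃ A : M, ∀ W s, IsSection O W s → pair W s ∈' A := by
  obtain ⟨c, hc⟩ := ZF.repl (fun W A => Val O W A) T hX.2.1.2
  obtain ⟨u, hu⟩ := ZF.union c
  obtain ⟨A, hA⟩ := exists_image₂ pair T u
  refine ⟨A, fun W s hs => (hA _).2 ?_⟩
  obtain ⟨B, hB, hs⟩ := hs
  have hW := hX.2.1.mem hB
  exact ⟨W, hW, s, (hu s).2 ⟨B, (hc B).2 ⟨W, hW, hB⟩, hs⟩, rfl⟩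

/-- `I` is the least ideal sheaf that contains the sections in `F`. -/
def IsLeastIdealSheaf (T O a m r F I : M) : Prop :=
  IsIdealSheaf T O a m r I ∧ Inside F I ∧
    ∀ J, IsIdealSheaf T O a m r J → Inside F J → ∀ U s, IsSection I U s → IsSection J U s

instance D_IsLeastIdealSheaf (f g : Γ → M) [DF f] [DF g] :
    D fun w => IsLeastIdealSheaf T O a m r (f w) (g w) :=
  D.comp (P := fun w : M × M => IsLeastIdealSheaf T O a m r w.1 w.2)
    (by unfold IsLeastIdealSheaf; infer_instance) fun w => (f w, g w)

theorem IsLeastIdealSheaf.unique {F : M} (hI : IsLeastIdealSheaf T O a m r F I)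
    (hJ : IsLeastIdealSheaf T O a m r F J) : I = J :=
  hI.1.ext hJ.1 fun U s =>
    ⟨hI.2.2 J hJ.1 hJ.2.1 U s, hJ.2.2 I hI.1 hI.2.1 U s⟩

/-- The ideal sheaves on a Noetherian scheme form a set. -/
theorem IsNoetherianScheme.exists_set_of_isIdealSheaf (hX : IsNoetherianScheme P T O a m r) :
    ∃ S, ∀ I, I ∈' S ↔ IsIdealSheaf T O a m r I := by
  obtain ⟨hX, C, hC, -, hPC, haff⟩ := hX
  obtain ⟨A, hA⟩ := hX.exists_pairs
  obtain ⟨𝓕, h₀, h𝓕⟩ := exists_adj_closed A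
  have key : ∀ I, IsIdealSheaf T O a m r I → ∃ F, F ∈' 𝓕 ∧ IsLeastIdealSheaf T O a m r F I := by
    intro I hI
    -- The generating set is enlarged over one affine piece at a time, by induction on the finite
    -- cover.
    have : ∃ F, F ∈' 𝓕 ∧ Inside F I ∧
        ∀ U, U ∈' C → ∀ x, x ∈' U → GeneratesAt T O a m r I F x := by
      refine hC.induction (P := fun S => ∃ F, F ∈' 𝓕 ∧ Inside F I ∧
        ∀ U, U ∈' S → ∀ x, x ∈' U → GeneratesAt T O a m r I F x)
        ⟨empty, h₀, fun W s h => absurd h (notMem_empty _),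
          fun U h => absurd h (notMem_empty U)⟩ ?_
      rintro S U - hU ⟨F, hF, hFI, hFS⟩
      obtain ⟨R, b, n, h, θ, hR, hS⟩ := haff U hU
      obtain ⟨F', hF', h₁, h₂, h₃⟩ := exists_generatesAt_of_affine hX hR hS hI hA h𝓕 hF hFI
      refine ⟨F', hF', h₂, fun V hV x hx => ?_⟩
      rcases mem_adj.1 hV with hV | rfl
      · exact (hFS V hV x hx).mono h₁
      · exact h₃ x hx
    obtain ⟨F, hF, hFI, h⟩ := this
    refine ⟨F, hF, hI, hFI, fun J hJ hFJ U s hs =>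
      hX.isSection_of_generatesAt hI hJ hFJ (fun x hx => ?_) hs⟩
    obtain ⟨U, hU, hxU⟩ := (hPC x).1 hx
    exact h U hU x hxU
  -- Replacement needs a relation that is total on its set, so members of `𝓕` without a least ideal
  -- sheaf are discarded.
  obtain ⟨𝓖, h𝓖⟩ := ZF.sep (fun F => ∃ I, IsLeastIdealSheaf T O a m r F I) 𝓕
  obtain ⟨S, hS⟩ := ZF.repl (fun F I => IsLeastIdealSheaf T O a m r F I) 𝓖 fun F hF => by
    obtain ⟨-, I, hI⟩ := (h𝓖 F).1 hF
    exact ⟨I, hI, fun J hJ => hJ.unique hI⟩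
  refine ⟨S, fun I => (hS I).trans ⟨?_, fun hI => ?_⟩⟩
  · rintro ⟨F, -, hI⟩
    exact hI.1
  · obtain ⟨F, hF, h⟩ := key I hI
    exact ⟨F, (h𝓖 F).2 ⟨hF, I, h⟩, h⟩

end IdealSheaves

end Model

end ZFG

/-- ZFG[0] proves: for every Noetherian scheme there is a set of all sheaves of ideals of its
structure sheaf. -/
theorem mainTheorem2 :
    Provable ZFG0 (Fm.sentence <|
      Fm.all fun P => Fm.all fun T => Fm.all fun O => Fm.all fun a => Fm.all fun m =>
        Fm.all fun r => IsNoetherianScheme P T O a m r →ₛ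
          Fm.ex fun S => Fm.all fun I => I ∈ₛ S ↔ₛ IsIdealSheaf T O a m r I) := by
  refine provable_of_forall_model fun M _ _ hM => ?_
  have := Model.zf_of_model hM
  rw [Fm.realize_sentence fun _ => Classical.arbitrary M]
  simp (disch := omega)
  intro P T O a m r hX
  exact hX.exists_set_of_isIdealSheaf
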